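/- **Conventions.** For an endofunctor $H$ of a category $\mathbb A$ and a natural transformation $f$ between endofunctors, $Hf$ and $fH$ have components $(Hf)_a=H(f_a)$ and $(fH)_a=f_{H(a)}$. A category is Cauchy complete if all idempotents in it split. **Weak braided bimonads.** A weak YB-pair on $H$ is a pair $\tau,\tau':HH\to HH$ with $\tau\tau'\tau=\tau$, $\tau'\tau\tau'=\tau'$, $\tau\tau'=\tau'\tau$, $$H\tau\cdot\tau H\cdot H\tau=\tau H\cdot H\tau\cdot\tau H,\qquad H\tau'\cdot\tau' H\cdot H\tau'=\tau' H\cdot H\tau'\cdot\tau' H,$$ and, for $\nabla:=\tau\cdot\tau'$, $$\tau H\cdot H\nabla=H\nabla\cdot\tau H,\quad H\tau\cdot\nabla H=\nabla H\cdot H\tau,\quad \tau' H\cdot H\nabla=H\nabla\cdot\tau' H,\quad H\tau'\cdot\nabla H=\nabla H\cdot H\tau'.$$ A weak braided bimonad $\mathbf H$ on $\mathbb A$ is a monad $(H,m,e)$ and a comonad $(H,\delta,\varepsilon)$ on the same endofunctor $H$ of $\mathbb A$ together with a weak YB-pair $\tau,\tau'$ on $H$ such that, with $mm=mH\cdot HHm$,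 $\delta\delta=\delta HH\cdot H\delta$, $ee=He\cdot e$, $\varepsilon\varepsilon=\varepsilon\cdot H\varepsilon$, 1. $m\cdot\nabla=m$ and $\nabla\cdot\delta=\delta$; 2. $\nabla\cdot He=\tau\cdot eH$, $\ H\varepsilon\cdot\nabla=\varepsilon H\cdot\tau$, $\ \nabla\cdot eH=\tau\cdot He$, $\ \varepsilon H\cdot\nabla=H\varepsilon\cdot\tau$; 3. $\delta H\cdot\tau=H\tau\cdot\tau H\cdot H\delta$ and $\tau\cdot mH=Hm\cdot\tau H\cdot H\tau$; 4. $H\delta\cdot\tau=\tau H\cdot H\tau\cdot\delta H$ and $\tau\cdot Hm=mH\cdot H\tau\cdot\tau H$; 5. $\delta\cdot m=mm\cdot H\tau H\cdot\delta\delta$; 6. $\varepsilon\varepsilon\cdot mm\cdot H\delta H=\varepsilon\cdot m\cdot mH=\varepsilon\varepsilon\cdot mm\cdot H\tau'H\cdot H\delta H$; 7. $HmH\cdot\delta\delta\cdot ee=\delta H\cdot\delta\cdot e=HmH\cdot H\tau'H\cdot\delta\delta\cdot ee$. Put $$\omega=mH\cdot H\tau\cdot\delta H,\quad \bar\omega=Hm\cdot\tau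 H\cdot H\delta,\quad \xi=\varepsilon H\cdot\omega\cdot eH,\quad \bar\xi=H\varepsilon\cdot\bar\omega\cdot He,\quad \sigma=Hm\cdot\delta H,\quad \bar\sigma=mH\cdot H\delta .$$ A weak antipode is a natural transformation $S:H\to H$ with $1*S=\xi$, $S*1=\bar\xi$ and $S*1*S=S$, where $f*g=m\cdot fH\cdot Hg\cdot\delta$. **Mixed bimodules.** A mixed bimodule is a triple $(a,h,\theta)$ where $(a,h)$ is a module over the monad $(H,m,e)$ and $(a,\theta)$ a comodule over the comonad $(H,\delta,\varepsilon)$ with $\theta\cdot h=H(h)\cdot\omega_a\cdot H(\theta)$. Morphisms are the morphisms of $\mathbb A$ that are morphisms of modules and of comodules; they form a category $\mathbb A^{H}_{H}(\omega)$. Let $K_\omega:\mathbb A\to\mathbb A^H_H(\omega)$ be the functor $a\mapsto(H(a),m_a,\delta_a)$. A right adjoint is called monadic if the comparison functor of the adjunction into the category of modules over the monad it generates is an equivalence; a comonadic left adjoint is defined dually. **Base and canonical maps.** Let $\mathbb A$ be Cauchy complete. Then the following idempotents split and the following coequalisers and equalisers exist. * $\bar\xi:H\to H$ is idempotent; let $\bar\xi=\iota\cdot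 q$, $q\cdot\iota=1$ be a splitting through $H^{\bar\xi}$. With multiplication $q\cdot m\cdot(\iota\iota)$ and unit $q\cdot e$, $H^{\bar\xi}$ is a monad, which acts on $H$ from the right by $\rho_r=m\cdot H\iota$ and from the left by $\rho_l=m\cdot\iota H$. The tensor product $H\otimes_{H^{\bar\xi}}H$, with $\mathrm{can}:HH\to H\otimes_{H^{\bar\xi}}H$, is the coequaliser of $\rho_rH,\,H\rho_l:HH^{\bar\xi}H\to HH$ in the category of endofunctors of $\mathbb A$. Dually, $\theta_r=Hq\cdot\delta$ and $\theta_l=qH\cdot\delta$ are coactions on $H$ of the comonad $H_{\bar\xi}$ that splits $\bar\xi$ (its underlying functor is $H^{\bar\xi}$), and the cotensor product $H\otimes^{H_{\bar\xi}}H$, with $\mathrm{can}':H\otimes^{H_{\bar\xi}}H\to HH$, is the equaliser of $\theta_rH,\,H\theta_l:HH\to HH^{\bar\xi}H$. * On the category of $H$-modules, the natural transformation with components $\Gamma_{(a,h)}=H(h)\cdot\omega_a\cdot e_{H(a)}:H(a)\to H(a)$ is idempotent. Let a functor $G$ split it, with $p:(a,h)\mapsto \bigl(H(a)\to G(a,h)\bigr)$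 the epimorphic part; let $\bar G(a)=G(H(a),m_a)$ and $\bar p_a=p_{(H(a),m_a)}:HH(a)\to\bar G(a)$. * On the category of $H$-comodules, the natural transformation with components $\Gamma'_{(a,\theta)}=\varepsilon_{H(a)}\cdot\omega_a\cdot H(\theta):H(a)\to H(a)$ is idempotent. Let a functor $T$ split it, with $i':(a,\theta)\mapsto\bigl(T(a,\theta)\to H(a)\bigr)$ the monomorphic part; let $\bar T(a)=T(H(a),\delta_a)$ and $\bar i'_a=i'_{(H(a),\delta_a)}:\bar T(a)\to HH(a)$. * There are unique natural transformations $\gamma:H\otimes_{H^{\bar\xi}}H\to\bar G$ with $\gamma\cdot\mathrm{can}=\bar p\cdot\sigma$ and $\gamma':\bar T\to H\otimes^{H_{\bar\xi}}H$ with $\mathrm{can}'\cdot\gamma'=\bar\sigma\cdot\bar i'$. **Theorem.** Let $\mathbf H$ be a weak braided bimonad on a Cauchy complete category $\mathbb A$. For all choices of the splittings above, the following are equivalent: * (a) $\mathbf H$ has a weak antipode; * (b) $K_\omega$ has a left adjoint and a right adjoint, and the right adjoint is monadic; * (c) $K_\omega$ has a left adjoint and a right adjoint, and the left adjoint is comonadic;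 * (d) $\gamma:H\otimes_{H^{\bar\xi}}H\to\bar G$ is an isomorphism; * (e) $\gamma':\bar T\to H\otimes^{H_{\bar\xi}}H$ is an isomorphism. If these conditions hold, then the category of modules over the monad $H^{\bar\xi}$ is equivalent to the category $\mathbb A^H_H(\omega)$ of mixed bimodules. -/

import Mathlib

open CategoryTheory CategoryTheory.Limits

universe v u

/-!
Conventions. For an endofunctor `H` of `A` and natural transformations `f`, `g`, the composite of
natural transformations `g · f` is `f ≫ g`; the component of `f H` at `a` is `f.app (H.obj a)` and
the component of `H f` at `a` is `H.map (f.app a)`.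
-/

/-- A weak Yang-Baxter pair `(τ, τ')` on an endofunctor `H`: `τ'` is a commuting generalised inverse
of `τ`, both satisfy the Yang-Baxter equation, and for the idempotent `∇ = τ · τ'` the maps `τH`,
`τ'H` commute with `H∇` and the maps `Hτ`, `Hτ'` commute with `∇H`. Here `tauInv` is `τ'`. -/
structure WeakYBPair {A : Type u} [Category.{v} A] (H : A ⥤ A) where
  tau : H ⋙ H ⟶ H ⋙ H
  tauInv : H ⋙ H ⟶ H ⋙ H
  tau_tauInv_tau : tau ≫ tauInv ≫ tau = tau
  tauInv_tau_tauInv : tauInv ≫ tau ≫ tauInv = tauInv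
  tau_tauInv_comm : tau ≫ tauInv = tauInv ≫ tau
  yang_baxter : ∀ a : A,
    H.map (tau.app a) ≫ tau.app (H.obj a) ≫ H.map (tau.app a) =
      tau.app (H.obj a) ≫ H.map (tau.app a) ≫ tau.app (H.obj a)
  yang_baxter_inv : ∀ a : A,
    H.map (tauInv.app a) ≫ tauInv.app (H.obj a) ≫ H.map (tauInv.app a) =
      tauInv.app (H.obj a) ≫ H.map (tauInv.app a) ≫ tauInv.app (H.obj a)
  tau_nabla : ∀ a : A,
    H.map ((tauInv ≫ tau).app a) ≫ tau.app (H.obj a) =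
      tau.app (H.obj a) ≫ H.map ((tauInv ≫ tau).app a)
  nabla_tau : ∀ a : A,
    (tauInv ≫ tau).app (H.obj a) ≫ H.map (tau.app a) =
      H.map (tau.app a) ≫ (tauInv ≫ tau).app (H.obj a)
  tauInv_nabla : ∀ a : A,
    H.map ((tauInv ≫ tau).app a) ≫ tauInv.app (H.obj a) =
      tauInv.app (H.obj a) ≫ H.map ((tauInv ≫ tau).app a)
  nabla_tauInv : ∀ a : A,
    (tauInv ≫ tau).app (H.obj a) ≫ H.map (tauInv.app a) =
      H.map (tauInv.app a) ≫ (tauInv ≫ tau).app (H.obj a)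

/-- `∇ = τ · τ'`. -/
def WeakYBPair.nabla {A : Type u} [Category.{v} A] {H : A ⥤ A} (P : WeakYBPair H) :
    H ⋙ H ⟶ H ⋙ H :=
  P.tauInv ≫ P.tau

/-- A weak braided bimonad: a monad `(H, m, e)` and a comonad `(H, δ, ε)` on the same endofunctor
`H = toFunctor` (with `m = μ`, `e = η`) and a weak Yang-Baxter pair `(τ, τ')` on `H` subject to the
compatibility conditions below. The horizontal composites are written out as
`ee = He · e`, `δδ = δHH · Hδ`, `mm = mH · HHm`, `εε = ε · Hε`. -/
structure WeakBraidedBimonad (A : Type u) [Category.{v} A] extends Monad A, Comonad A where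
  -- the weak Yang-Baxter pair
  yb : WeakYBPair toFunctor
  -- `m · ∇ = m` and `∇ · δ = δ`
  nabla_mul : ∀ a : A, yb.nabla.app a ≫ μ.app a = μ.app a
  comul_nabla : ∀ a : A, δ.app a ≫ yb.nabla.app a = δ.app a
  -- `∇ · He = τ · eH`, `Hε · ∇ = εH · τ`, `∇ · eH = τ · He`, `εH · ∇ = Hε · τ`
  map_unit_nabla : ∀ a : A,
    toFunctor.map (η.app a) ≫ yb.nabla.app a = η.app (toFunctor.obj a) ≫ yb.tau.app a
  nabla_map_counit : ∀ a : A,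
    yb.nabla.app a ≫ toFunctor.map (ε.app a) = yb.tau.app a ≫ ε.app (toFunctor.obj a)
  unit_nabla : ∀ a : A,
    η.app (toFunctor.obj a) ≫ yb.nabla.app a = toFunctor.map (η.app a) ≫ yb.tau.app a
  nabla_counit : ∀ a : A,
    yb.nabla.app a ≫ ε.app (toFunctor.obj a) = yb.tau.app a ≫ toFunctor.map (ε.app a)
  -- `δH · τ = Hτ · τH · Hδ` and `τ · mH = Hm · τH · Hτ`
  tau_comul : ∀ a : A,
    yb.tau.app a ≫ δ.app (toFunctor.obj a) =
      toFunctor.map (δ.app a) ≫ yb.tau.app (toFunctor.obj a) ≫ toFunctor.map (yb.tau.app a)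
  mul_tau : ∀ a : A,
    μ.app (toFunctor.obj a) ≫ yb.tau.app a =
      toFunctor.map (yb.tau.app a) ≫ yb.tau.app (toFunctor.obj a) ≫ toFunctor.map (μ.app a)
  -- `Hδ · τ = τH · Hτ · δH` and `τ · Hm = mH · Hτ · τH`
  tau_map_comul : ∀ a : A,
    yb.tau.app a ≫ toFunctor.map (δ.app a) =
      δ.app (toFunctor.obj a) ≫ toFunctor.map (yb.tau.app a) ≫ yb.tau.app (toFunctor.obj a)
  map_mul_tau : ∀ a : A,
    toFunctor.map (μ.app a) ≫ yb.tau.app a =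
      yb.tau.app (toFunctor.obj a) ≫ toFunctor.map (yb.tau.app a) ≫ μ.app (toFunctor.obj a)
  -- `δ · m = mm · HτH · δδ`
  mul_comul : ∀ a : A,
    μ.app a ≫ δ.app a =
      (toFunctor.map (δ.app a) ≫ δ.app (toFunctor.obj (toFunctor.obj a))) ≫
        toFunctor.map (yb.tau.app (toFunctor.obj a)) ≫
          (toFunctor.map (toFunctor.map (μ.app a)) ≫ μ.app (toFunctor.obj a))
  -- `εε · mm · HδH = ε · m · mH = εε · mm · Hτ'H · HδH`
  counit_mul : ∀ a : A,
    toFunctor.map (δ.app (toFunctor.obj a)) ≫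
        (toFunctor.map (toFunctor.map (μ.app a)) ≫ μ.app (toFunctor.obj a)) ≫
          (toFunctor.map (ε.app a) ≫ ε.app a) =
      μ.app (toFunctor.obj a) ≫ μ.app a ≫ ε.app a
  counit_mul_tauInv : ∀ a : A,
    toFunctor.map (δ.app (toFunctor.obj a)) ≫
        toFunctor.map (yb.tauInv.app (toFunctor.obj a)) ≫
          (toFunctor.map (toFunctor.map (μ.app a)) ≫ μ.app (toFunctor.obj a)) ≫
            (toFunctor.map (ε.app a) ≫ ε.app a) =
      μ.app (toFunctor.obj a) ≫ μ.app a ≫ ε.app a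
  -- `HmH · δδ · ee = δH · δ · e = HmH · Hτ'H · δδ · ee`
  unit_comul : ∀ a : A,
    (η.app a ≫ toFunctor.map (η.app a)) ≫
        (toFunctor.map (δ.app a) ≫ δ.app (toFunctor.obj (toFunctor.obj a))) ≫
          toFunctor.map (μ.app (toFunctor.obj a)) =
      η.app a ≫ δ.app a ≫ δ.app (toFunctor.obj a)
  unit_comul_tauInv : ∀ a : A,
    (η.app a ≫ toFunctor.map (η.app a)) ≫
        (toFunctor.map (δ.app a) ≫ δ.app (toFunctor.obj (toFunctor.obj a))) ≫
          toFunctor.map (yb.tauInv.app (toFunctor.obj a)) ≫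
            toFunctor.map (μ.app (toFunctor.obj a)) =
      η.app a ≫ δ.app a ≫ δ.app (toFunctor.obj a)


/-- A splitting of an endomorphism `f`: a factorisation `f = i · p` with `p · i = 1`. -/
structure IdempotentSplitting {C : Type*} [Category* C] {X : C} (f : X ⟶ X) where
  obj : C
  p : X ⟶ obj
  i : obj ⟶ X
  p_i : p ≫ i = f
  i_p : i ≫ p = 𝟙 obj

/-- In a Cauchy complete category every idempotent has a splitting. -/
theorem IdempotentSplitting.nonempty_of_idem {C : Type*} [Category* C] [IsIdempotentComplete C]
    {X : C} (f : X ⟶ X) (h : f ≫ f = f) : Nonempty (IdempotentSplitting f) := by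
  obtain ⟨Y, i, p, h1, h2⟩ := IsIdempotentComplete.idempotents_split X f h
  exact ⟨⟨Y, p, i, h2, h1⟩⟩

namespace WeakBraidedBimonad

variable {A : Type u} [Category.{v} A] (B : WeakBraidedBimonad A)

/-- The underlying endofunctor. -/
abbrev H : A ⥤ A := B.toFunctor
/-! Components of the structure maps. -/

/-- `m_a`. -/
def m (a : A) : B.H.obj (B.H.obj a) ⟶ B.H.obj a := B.μ.app a
/-- `e_a`. -/
def e (a : A) : a ⟶ B.H.obj a := B.η.app a
/-- `δ_a`. -/
def d (a : A) : B.H.obj a ⟶ B.H.obj (B.H.obj a) := B.δ.app a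
/-- `ε_a`. -/
def c (a : A) : B.H.obj a ⟶ a := B.ε.app a
/-- `τ_a`. -/
def t (a : A) : B.H.obj (B.H.obj a) ⟶ B.H.obj (B.H.obj a) := B.yb.tau.app a
/-- `τ'_a`. -/
def s (a : A) : B.H.obj (B.H.obj a) ⟶ B.H.obj (B.H.obj a) := B.yb.tauInv.app a
/-- `∇_a = τ_a · τ'_a`. -/
def n (a : A) : B.H.obj (B.H.obj a) ⟶ B.H.obj (B.H.obj a) := B.s a ≫ B.t a

/-! ### The axioms in components -/

section lemmas

variable (a : A)

theorem m_nat {X Y : A} (f : X ⟶ Y) : B.H.map (B.H.map f) ≫ B.m Y = B.m X ≫ B.H.map f :=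
  B.μ.naturality f
theorem e_nat {X Y : A} (f : X ⟶ Y) : f ≫ B.e Y = B.e X ≫ B.H.map f := B.η.naturality f
theorem d_nat {X Y : A} (f : X ⟶ Y) : B.H.map f ≫ B.d Y = B.d X ≫ B.H.map (B.H.map f) :=
  B.δ.naturality f
theorem c_nat {X Y : A} (f : X ⟶ Y) : B.H.map f ≫ B.c Y = B.c X ≫ f := B.ε.naturality f
theorem t_nat {X Y : A} (f : X ⟶ Y) :
    B.H.map (B.H.map f) ≫ B.t Y = B.t X ≫ B.H.map (B.H.map f) := B.yb.tau.naturality f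
theorem s_nat {X Y : A} (f : X ⟶ Y) :
    B.H.map (B.H.map f) ≫ B.s Y = B.s X ≫ B.H.map (B.H.map f) := B.yb.tauInv.naturality f
theorem n_nat {X Y : A} (f : X ⟶ Y) :
    B.H.map (B.H.map f) ≫ B.n Y = B.n X ≫ B.H.map (B.H.map f) := by
  rw [n, n, reassoc_of% B.s_nat, B.t_nat, Category.assoc]

theorem m_assoc : B.H.map (B.m a) ≫ B.m a = B.m (B.H.obj a) ≫ B.m a := B.toMonad.assoc a
theorem e_m : B.e (B.H.obj a) ≫ B.m a = 𝟙 _ := B.left_unit a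
theorem He_m : B.H.map (B.e a) ≫ B.m a = 𝟙 _ := B.right_unit a
theorem d_coassoc : B.d a ≫ B.H.map (B.d a) = B.d a ≫ B.d (B.H.obj a) := B.coassoc a
theorem d_c : B.d a ≫ B.c (B.H.obj a) = 𝟙 _ := B.left_counit a
theorem d_Hc : B.d a ≫ B.H.map (B.c a) = 𝟙 _ := B.right_counit a

theorem t_s : B.t a ≫ B.s a = B.n a := NatTrans.congr_app B.yb.tau_tauInv_comm a
theorem s_t : B.s a ≫ B.t a = B.n a := rfl
theorem t_s_t : B.t a ≫ B.s a ≫ B.t a = B.t a := NatTrans.congr_app B.yb.tau_tauInv_tau a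
theorem s_t_s : B.s a ≫ B.t a ≫ B.s a = B.s a := NatTrans.congr_app B.yb.tauInv_tau_tauInv a
theorem t_n : B.t a ≫ B.n a = B.t a := B.t_s_t a
theorem s_n : B.s a ≫ B.n a = B.s a := by rw [← B.t_s, B.s_t_s]
theorem n_t : B.n a ≫ B.t a = B.t a := by rw [← B.t_s, Category.assoc, B.t_s_t]
theorem n_s : B.n a ≫ B.s a = B.s a := by rw [← B.s_t, Category.assoc, B.s_t_s]
theorem Hn_t : B.H.map (B.n a) ≫ B.t (B.H.obj a) = B.t (B.H.obj a) ≫ B.H.map (B.n a) :=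
  B.yb.tau_nabla a
theorem Hn_s : B.H.map (B.n a) ≫ B.s (B.H.obj a) = B.s (B.H.obj a) ≫ B.H.map (B.n a) :=
  B.yb.tauInv_nabla a
theorem n_Ht : B.n (B.H.obj a) ≫ B.H.map (B.t a) = B.H.map (B.t a) ≫ B.n (B.H.obj a) :=
  B.yb.nabla_tau a
theorem n_Hs : B.n (B.H.obj a) ≫ B.H.map (B.s a) = B.H.map (B.s a) ≫ B.n (B.H.obj a) :=
  B.yb.nabla_tauInv a
theorem Hn_n : B.H.map (B.n a) ≫ B.n (B.H.obj a) = B.n (B.H.obj a) ≫ B.H.map (B.n a) := by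
  rw [← B.s_t (B.H.obj a), reassoc_of% B.Hn_s, B.Hn_t, Category.assoc]

theorem n_m : B.n a ≫ B.m a = B.m a := B.nabla_mul a
theorem d_n : B.d a ≫ B.n a = B.d a := B.comul_nabla a
theorem He_n : B.H.map (B.e a) ≫ B.n a = B.e (B.H.obj a) ≫ B.t a := B.map_unit_nabla a
theorem n_Hc : B.n a ≫ B.H.map (B.c a) = B.t a ≫ B.c (B.H.obj a) := B.nabla_map_counit a
theorem e_n : B.e (B.H.obj a) ≫ B.n a = B.H.map (B.e a) ≫ B.t a := B.unit_nabla a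
theorem n_c : B.n a ≫ B.c (B.H.obj a) = B.t a ≫ B.H.map (B.c a) := B.nabla_counit a
theorem t_d : B.t a ≫ B.d (B.H.obj a) =
    B.H.map (B.d a) ≫ B.t (B.H.obj a) ≫ B.H.map (B.t a) := B.tau_comul a
theorem m_t : B.m (B.H.obj a) ≫ B.t a =
    B.H.map (B.t a) ≫ B.t (B.H.obj a) ≫ B.H.map (B.m a) := B.mul_tau a
theorem t_Hd : B.t a ≫ B.H.map (B.d a) =
    B.d (B.H.obj a) ≫ B.H.map (B.t a) ≫ B.t (B.H.obj a) := B.tau_map_comul a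
theorem Hm_t : B.H.map (B.m a) ≫ B.t a =
    B.t (B.H.obj a) ≫ B.H.map (B.t a) ≫ B.m (B.H.obj a) := B.map_mul_tau a
theorem m_d : B.m a ≫ B.d a = B.H.map (B.d a) ≫ B.d (B.H.obj (B.H.obj a)) ≫
    B.H.map (B.t (B.H.obj a)) ≫ B.H.map (B.H.map (B.m a)) ≫ B.m (B.H.obj a) :=
  (B.mul_comul a).trans (Category.assoc _ _ _)
theorem dmmcc : B.H.map (B.d (B.H.obj a)) ≫ B.H.map (B.H.map (B.m a)) ≫ B.m (B.H.obj a) ≫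
    B.H.map (B.c a) ≫ B.c a = B.m (B.H.obj a) ≫ B.m a ≫ B.c a := by
  rw [← show _ = B.m (B.H.obj a) ≫ B.m a ≫ B.c a from B.counit_mul a]
  exact congrArg (_ ≫ ·) (Category.assoc _ _ _).symm
theorem dsmmcc : B.H.map (B.d (B.H.obj a)) ≫ B.H.map (B.s (B.H.obj a)) ≫
    B.H.map (B.H.map (B.m a)) ≫ B.m (B.H.obj a) ≫
    B.H.map (B.c a) ≫ B.c a = B.m (B.H.obj a) ≫ B.m a ≫ B.c a := by
  rw [← show _ = B.m (B.H.obj a) ≫ B.m a ≫ B.c a from B.counit_mul_tauInv a]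
  exact congrArg (_ ≫ _ ≫ ·) (Category.assoc _ _ _).symm
theorem eeddm : B.e a ≫ B.H.map (B.e a) ≫ B.H.map (B.d a) ≫ B.d (B.H.obj (B.H.obj a)) ≫
    B.H.map (B.m (B.H.obj a)) = B.e a ≫ B.d a ≫ B.d (B.H.obj a) := by
  rw [← show _ = B.e a ≫ B.d a ≫ B.d (B.H.obj a) from B.unit_comul a]
  refine .trans ?_ (Category.assoc _ _ _).symm
  exact congrArg (_ ≫ _ ≫ ·) (Category.assoc _ _ _).symm
theorem eeddsm : B.e a ≫ B.H.map (B.e a) ≫ B.H.map (B.d a) ≫ B.d (B.H.obj (B.H.obj a)) ≫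
    B.H.map (B.s (B.H.obj a)) ≫ B.H.map (B.m (B.H.obj a)) =
      B.e a ≫ B.d a ≫ B.d (B.H.obj a) := by
  rw [← show _ = B.e a ≫ B.d a ≫ B.d (B.H.obj a) from B.unit_comul_tauInv a]
  refine .trans ?_ (Category.assoc _ _ _).symm
  exact congrArg (_ ≫ _ ≫ ·) (Category.assoc _ _ _).symm
end lemmas

/-- The weak braided bimonad on the opposite category, with the monad and the comonad structure
interchanged. It serves to dualise the lemmas below. -/
def op : WeakBraidedBimonad Aᵒᵖ where
  toFunctor := B.H.op
  η := { app := fun X => (B.c X.unop).op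
         naturality := fun X Y f => congrArg Quiver.Hom.op (B.c_nat f.unop).symm }
  μ := { app := fun X => (B.d X.unop).op
         naturality := fun X Y f => congrArg Quiver.Hom.op (B.d_nat f.unop).symm }
  assoc := fun X => congrArg Quiver.Hom.op (B.d_coassoc X.unop)
  left_unit := fun X => congrArg Quiver.Hom.op (B.d_c X.unop)
  right_unit := fun X => congrArg Quiver.Hom.op (B.d_Hc X.unop)
  ε := { app := fun X => (B.e X.unop).op
         naturality := fun X Y f => congrArg Quiver.Hom.op (B.e_nat f.unop).symm }
  δ := { app := fun X => (B.m X.unop).op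
         naturality := fun X Y f => congrArg Quiver.Hom.op (B.m_nat f.unop).symm }
  coassoc := fun X => congrArg Quiver.Hom.op (B.m_assoc X.unop)
  left_counit := fun X => congrArg Quiver.Hom.op (B.e_m X.unop)
  right_counit := fun X => congrArg Quiver.Hom.op (B.He_m X.unop)
  yb :=
    { tau := { app := fun X => (B.t X.unop).op
               naturality := fun X Y f => congrArg Quiver.Hom.op (B.t_nat f.unop).symm }
      tauInv := { app := fun X => (B.s X.unop).op
                  naturality := fun X Y f => congrArg Quiver.Hom.op (B.s_nat f.unop).symm }
      tau_tauInv_tau := by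
        ext X
        exact congrArg Quiver.Hom.op ((Category.assoc _ _ _).trans (B.t_s_t X.unop))
      tauInv_tau_tauInv := by
        ext X
        exact congrArg Quiver.Hom.op ((Category.assoc _ _ _).trans (B.s_t_s X.unop))
      tau_tauInv_comm := by
        ext X
        exact congrArg Quiver.Hom.op (B.t_s X.unop).symm
      yang_baxter := fun X => congrArg Quiver.Hom.op
        ((Category.assoc _ _ _).trans
          ((B.yb.yang_baxter X.unop).trans (Category.assoc _ _ _).symm))
      yang_baxter_inv := fun X => congrArg Quiver.Hom.op
        ((Category.assoc _ _ _).trans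
          ((B.yb.yang_baxter_inv X.unop).trans (Category.assoc _ _ _).symm))
      tau_nabla := fun X => congrArg Quiver.Hom.op <|
        show B.t _ ≫ B.H.map (B.t _ ≫ B.s _) = B.H.map (B.t _ ≫ B.s _) ≫ B.t _ by
          rw [B.t_s, B.Hn_t]
      nabla_tau := fun X => congrArg Quiver.Hom.op <|
        show B.H.map (B.t _) ≫ B.t _ ≫ B.s _ = (B.t _ ≫ B.s _) ≫ B.H.map (B.t _) by
          rw [B.t_s, B.n_Ht]
      tauInv_nabla := fun X => congrArg Quiver.Hom.op <|
        show B.s _ ≫ B.H.map (B.t _ ≫ B.s _) = B.H.map (B.t _ ≫ B.s _) ≫ B.s _ by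
          rw [B.t_s, B.Hn_s]
      nabla_tauInv := fun X => congrArg Quiver.Hom.op <|
        show B.H.map (B.s _) ≫ B.t _ ≫ B.s _ = (B.t _ ≫ B.s _) ≫ B.H.map (B.s _) by
          rw [B.t_s, B.n_Hs] }
  nabla_mul := fun X => congrArg Quiver.Hom.op <|
    show B.d _ ≫ B.t _ ≫ B.s _ = B.d _ by rw [B.t_s, B.d_n]
  comul_nabla := fun X => congrArg Quiver.Hom.op <|
    show (B.t _ ≫ B.s _) ≫ B.m _ = B.m _ by rw [B.t_s, B.n_m]
  map_unit_nabla := fun X => congrArg Quiver.Hom.op <|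
    show (B.t _ ≫ B.s _) ≫ B.H.map (B.c _) = B.t _ ≫ B.c _ by rw [B.t_s, B.n_Hc]
  nabla_map_counit := fun X => congrArg Quiver.Hom.op <|
    show B.H.map (B.e _) ≫ B.t _ ≫ B.s _ = B.e _ ≫ B.t _ by rw [B.t_s, B.He_n]
  unit_nabla := fun X => congrArg Quiver.Hom.op <|
    show (B.t _ ≫ B.s _) ≫ B.c _ = B.t _ ≫ B.H.map (B.c _) by rw [B.t_s, B.n_c]
  nabla_counit := fun X => congrArg Quiver.Hom.op <|
    show B.e _ ≫ B.t _ ≫ B.s _ = B.H.map (B.e _) ≫ B.t _ by rw [B.t_s, B.e_n]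
  tau_comul := fun X => congrArg Quiver.Hom.op <|
    (B.m_t X.unop).trans (Category.assoc _ _ _).symm
  mul_tau := fun X => congrArg Quiver.Hom.op <|
    (B.t_d X.unop).trans (Category.assoc _ _ _).symm
  tau_map_comul := fun X => congrArg Quiver.Hom.op <|
    (B.Hm_t X.unop).trans (Category.assoc _ _ _).symm
  map_mul_tau := fun X => congrArg Quiver.Hom.op <|
    (B.t_Hd X.unop).trans (Category.assoc _ _ _).symm
  mul_comul := fun X => congrArg Quiver.Hom.op <|
    show B.m X.unop ≫ B.d X.unop =
      ((B.d _ ≫ B.H.map (B.H.map (B.d _))) ≫ B.H.map (B.t _)) ≫ B.m _ ≫ B.H.map (B.m _) by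
        simp only [Category.assoc, ← B.m_nat, B.m_d]
        rw [reassoc_of% B.d_nat]
  counit_mul := fun X => congrArg Quiver.Hom.op <|
    show ((B.e X.unop ≫ B.H.map (B.e _)) ≫ B.d _ ≫ B.H.map (B.H.map (B.d _))) ≫
        B.H.map (B.m _) = (B.e X.unop ≫ B.d _) ≫ B.d _ by
      rw [← B.d_nat]
      simpa only [Category.assoc] using B.eeddm X.unop
  counit_mul_tauInv := fun X => congrArg Quiver.Hom.op <|
    show (((B.e X.unop ≫ B.H.map (B.e _)) ≫ B.d _ ≫ B.H.map (B.H.map (B.d _))) ≫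
        B.H.map (B.s _)) ≫ B.H.map (B.m _) = (B.e X.unop ≫ B.d _) ≫ B.d _ by
      rw [← B.d_nat]
      simpa only [Category.assoc] using B.eeddsm X.unop
  unit_comul := fun X => congrArg Quiver.Hom.op <|
    show (B.H.map (B.d _) ≫ B.m _ ≫ B.H.map (B.m _)) ≫ B.H.map (B.c _) ≫ B.c X.unop =
      (B.m _ ≫ B.m _) ≫ B.c X.unop by
      rw [← B.m_nat]
      simpa only [Category.assoc] using B.dmmcc X.unop
  unit_comul_tauInv := fun X => congrArg Quiver.Hom.op <|
    show ((B.H.map (B.d _) ≫ B.H.map (B.s _)) ≫ B.m _ ≫ B.H.map (B.m _)) ≫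
        B.H.map (B.c _) ≫ B.c X.unop = (B.m _ ≫ B.m _) ≫ B.c X.unop by
      rw [← B.m_nat]
      simpa only [Category.assoc] using B.dsmmcc X.unop

/-! ### Identities needed to know that `ξ̄` is idempotent, that `H^ξ̄` is a monad and that the
tensor and the cotensor product exist -/

section lemmas

variable (a : A)

theorem n_eq : B.H.map (B.e (B.H.obj a)) ≫ B.H.map (B.n a) ≫ B.m (B.H.obj a) = B.n a := by
  rw [← B.n_m (B.H.obj a), reassoc_of% B.Hn_n, reassoc_of% B.He_n, ← reassoc_of% B.Hn_t,
    ← reassoc_of% B.e_nat, ← reassoc_of% B.He_n, B.n_m, B.He_m, Category.comp_id]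

theorem m_n : B.m (B.H.obj a) ≫ B.n a = B.H.map (B.n a) ≫ B.m (B.H.obj a) := by
  conv_lhs => rw [← B.n_eq a]
  conv_rhs => rw [← B.n_eq a]
  rw [← reassoc_of% B.m_nat, ← reassoc_of% B.m_nat, ← B.m_assoc]
  simp only [Functor.map_comp, Category.assoc]

theorem n_d : B.n a ≫ B.d (B.H.obj a) = B.d (B.H.obj a) ≫ B.H.map (B.n a) := by
  have h : (B.t a ≫ B.s a) ≫ B.d (B.H.obj a) = B.d (B.H.obj a) ≫ B.H.map (B.t a ≫ B.s a) :=
    congrArg Quiver.Hom.unop (B.op.m_n (Opposite.op a))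
  rwa [B.t_s] at h

/-- `ω = mH · Hτ · δH`, at `a`. -/
def omega : B.H.obj (B.H.obj a) ⟶ B.H.obj (B.H.obj a) :=
  B.d (B.H.obj a) ≫ B.H.map (B.t a) ≫ B.m (B.H.obj a)

/-- `ω̄ = Hm · τH · Hδ`, at `a`. -/
def omegaBar : B.H.obj (B.H.obj a) ⟶ B.H.obj (B.H.obj a) :=
  B.H.map (B.d a) ≫ B.t (B.H.obj a) ≫ B.H.map (B.m a)

/-- `ξ̄ = Hε · ω̄ · He`, at `a`. -/
def xiBar : B.H.obj a ⟶ B.H.obj a :=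
  B.H.map (B.e a) ≫ B.omegaBar a ≫ B.H.map (B.c a)

theorem omega_nat {X Y : A} (f : X ⟶ Y) :
    B.H.map (B.H.map f) ≫ B.omega Y = B.omega X ≫ B.H.map (B.H.map f) := by
  simp only [omega, Category.assoc]
  rw [← B.m_nat, reassoc_of% B.d_nat, ← B.H.map_comp_assoc, B.t_nat]
  simp only [Functor.map_comp, Category.assoc]

theorem omegaBar_nat {X Y : A} (f : X ⟶ Y) :
    B.H.map (B.H.map f) ≫ B.omegaBar Y = B.omegaBar X ≫ B.H.map (B.H.map f) := by
  simp only [omegaBar, Category.assoc]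
  rw [← B.H.map_comp, ← B.m_nat, ← B.H.map_comp_assoc, B.d_nat]
  simp only [Functor.map_comp, Category.assoc]
  rw [reassoc_of% B.t_nat]

theorem xiBar_nat {X Y : A} (f : X ⟶ Y) : B.H.map f ≫ B.xiBar Y = B.xiBar X ≫ B.H.map f := by
  simp only [xiBar, Category.assoc]
  rw [← B.H.map_comp_assoc, B.e_nat, ← B.H.map_comp, ← B.c_nat]
  simp only [Functor.map_comp, Category.assoc]
  rw [reassoc_of% B.omegaBar_nat]

theorem unop_xiBar : (B.op.xiBar (Opposite.op a)).unop = B.xiBar a := by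
  change ((B.H.map (B.e a)) ≫ (B.H.map (B.d a) ≫ B.t _) ≫ B.H.map (B.m a)) ≫
    B.H.map (B.c a) = _
  simp only [xiBar, omegaBar, Category.assoc]

theorem xiBar_eq : B.xiBar a =
    B.e (B.H.obj a) ≫ B.d (B.H.obj a) ≫ B.H.map (B.s a ≫ B.m a ≫ B.c a) := by
  simp only [xiBar, omegaBar, Category.assoc, Functor.map_comp]
  have h : B.H.map (B.m a) = B.H.map (B.t a) ≫ B.H.map (B.s a) ≫ B.H.map (B.m a) := by
    rw [← B.H.map_comp, ← B.H.map_comp, reassoc_of% B.t_s, B.n_m]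
  conv_lhs => rw [h]
  simp only [Category.assoc]
  rw [← reassoc_of% B.t_d, ← reassoc_of% B.e_n, reassoc_of% B.n_d, ← B.H.map_comp_assoc (B.n a),
    B.n_s]

theorem xiBar_eq' : B.xiBar a =
    B.H.map (B.e a ≫ B.d a ≫ B.s a) ≫ B.m (B.H.obj a) ≫ B.c (B.H.obj a) := by
  rw [← B.unop_xiBar, B.op.xiBar_eq]
  change (B.H.map ((B.e a ≫ B.d a) ≫ B.s a) ≫ B.m _) ≫ B.c _ = _
  simp only [Category.assoc]

theorem e_d_xiBar : B.e a ≫ B.d a ≫ B.xiBar (B.H.obj a) = B.e a ≫ B.d a := by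
  rw [xiBar_eq, reassoc_of% B.e_nat, reassoc_of% B.e_nat]
  simp only [Functor.map_comp]
  rw [reassoc_of% B.eeddsm, ← reassoc_of% B.d_coassoc, ← B.H.map_comp, B.d_c]
  simp

theorem xiBar_idem : B.xiBar a ≫ B.xiBar a = B.xiBar a := by
  conv_lhs => lhs; rw [B.xiBar_eq]
  simp only [Category.assoc]
  rw [B.xiBar_nat, reassoc_of% B.e_d_xiBar, ← B.xiBar_eq]

theorem xiBar_m_c : B.xiBar (B.H.obj a) ≫ B.m a ≫ B.c a = B.m a ≫ B.c a := by
  rw [← B.unop_xiBar (B.H.obj a)]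
  exact (Category.assoc _ _ _).symm.trans
    (congrArg Quiver.Hom.unop (B.op.e_d_xiBar (Opposite.op a)))

theorem xiBar_d_xiBar : B.xiBar a ≫ B.d a ≫ B.xiBar (B.H.obj a) = B.xiBar a ≫ B.d a := by
  rw [B.xiBar_eq]
  simp only [Category.assoc]
  rw [reassoc_of% B.d_nat, B.xiBar_nat, B.d_nat, ← reassoc_of% B.d_coassoc,
    ← reassoc_of% B.d_coassoc, reassoc_of% B.xiBar_nat, reassoc_of% B.e_d_xiBar]

theorem xiBar_m_xiBar : B.xiBar (B.H.obj a) ≫ B.m a ≫ B.xiBar a = B.m a ≫ B.xiBar a := by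
  rw [← B.unop_xiBar (B.H.obj a), ← B.unop_xiBar a]
  exact (Category.assoc _ _ _).symm.trans
    (congrArg Quiver.Hom.unop (B.op.xiBar_d_xiBar (Opposite.op a)))

theorem xiBar_d : B.xiBar a ≫ B.d a =
    B.xiBar a ≫ B.e (B.H.obj a) ≫ B.d (B.H.obj a) ≫ B.H.map (B.m a) := by
  have hx := B.xiBar_eq a
  generalize B.s a ≫ B.m a ≫ B.c a = g at hx
  have h := B.eeddm (B.H.obj a)
  calc _ = (B.e (B.H.obj a) ≫ B.d (B.H.obj a) ≫ B.d (B.H.obj (B.H.obj a))) ≫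
        B.H.map (B.H.map g) := by
        rw [hx]; simp only [Category.assoc]; rw [B.d_nat]
    _ = _ := by
        rw [← h, reassoc_of% B.e_nat, hx]
        simp only [Functor.map_comp, Category.assoc]
        rw [reassoc_of% B.d_nat (B.H.map g), ← B.H.map_comp (B.H.map (B.H.map g)), B.m_nat,
          B.H.map_comp]

/-- `Hm · δH · eH`, at `a`. -/
def K : B.H.obj a ⟶ B.H.obj (B.H.obj a) :=
  B.e (B.H.obj a) ≫ B.d (B.H.obj a) ≫ B.H.map (B.m a)

theorem K_nat {X Y : A} (f : X ⟶ Y) : B.H.map f ≫ B.K Y = B.K X ≫ B.H.map (B.H.map f) := by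
  simp only [K, Category.assoc]
  rw [reassoc_of% B.e_nat, reassoc_of% B.d_nat, ← B.H.map_comp, ← B.H.map_comp, B.m_nat]

theorem m_K : B.m a ≫ B.K a = B.K (B.H.obj a) ≫ B.H.map (B.m a) := by
  simp only [K, Category.assoc]
  rw [reassoc_of% B.e_nat, reassoc_of% B.d_nat, ← B.H.map_comp, ← B.H.map_comp, B.m_assoc]

theorem K_xiBar : B.K a ≫ B.xiBar (B.H.obj a) = B.K a := by
  simp only [K, Category.assoc]
  rw [B.xiBar_nat, reassoc_of% B.e_d_xiBar]

variable {a}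

theorem coinv_of_xiBar {X : A} {f : X ⟶ B.H.obj a} (h : f ≫ B.xiBar a = f) :
    f ≫ B.d a = f ≫ B.K a := by
  rw [← h, Category.assoc, Category.assoc, B.xiBar_d]
  rfl

theorem xiBar_of_coinv {X : A} {f : X ⟶ B.H.obj a} (h : f ≫ B.d a = f ≫ B.K a) :
    f ≫ B.xiBar a = f := by
  have h1 : f ≫ B.K a ≫ B.H.map (B.c a) = f := by
    rw [← reassoc_of% h, B.d_Hc, Category.comp_id]
  conv_lhs => lhs; rw [← h1]
  simp only [Category.assoc]
  rw [B.xiBar_nat, reassoc_of% B.K_xiBar, h1]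

theorem map_m_d {X : A} {f : X ⟶ B.H.obj a} (h : f ≫ B.d a = f ≫ B.K a) :
    B.H.map f ≫ B.m a ≫ B.d a = B.H.map f ≫ B.d (B.H.obj a) ≫ B.H.map (B.m a) := by
  have key : B.H.map (B.K a) ≫ B.d (B.H.obj (B.H.obj a)) ≫
      B.H.map (B.t (B.H.obj a)) ≫ B.H.map (B.H.map (B.m a)) ≫ B.m (B.H.obj a) =
      B.d (B.H.obj a) ≫ B.H.map (B.m a) := by
    simp only [K, Functor.map_comp, Category.assoc]
    rw [reassoc_of% B.d_nat, ← B.H.map_comp_assoc (B.H.map (B.H.map (B.m a))), B.t_nat,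
      B.H.map_comp_assoc, ← B.H.map_comp_assoc (B.H.map (B.H.map (B.m a))),
      ← B.H.map_comp (B.H.map (B.m a)), B.m_assoc]
    simp only [Functor.map_comp, Category.assoc]
    rw [B.m_nat, ← reassoc_of% B.m_d, reassoc_of% B.He_m]
  rw [B.m_d, ← B.H.map_comp_assoc f, h, B.H.map_comp_assoc, key]

theorem coinv_mul {X Y : A} {f : X ⟶ B.H.obj a} {g : Y ⟶ B.H.obj X}
    (hf : f ≫ B.xiBar a = f) (hg : g ≫ B.xiBar X = g) :
    (g ≫ B.H.map f ≫ B.m a) ≫ B.xiBar a = g ≫ B.H.map f ≫ B.m a := by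
  apply B.xiBar_of_coinv
  simp only [Category.assoc]
  rw [B.map_m_d (B.coinv_of_xiBar hf), reassoc_of% B.d_nat, reassoc_of% B.coinv_of_xiBar hg,
    B.m_K, reassoc_of% B.K_nat]

variable (a)

theorem e_xiBar : B.e a ≫ B.xiBar a = B.e a := by
  apply B.xiBar_of_coinv
  simp only [K]
  rw [reassoc_of% B.e_nat, reassoc_of% B.d_nat, ← B.H.map_comp, B.He_m]
  simp

theorem d_map_xiBar_m : B.d a ≫ B.H.map (B.xiBar a) ≫ B.m a = 𝟙 _ := by
  simp only [xiBar, omegaBar, Functor.map_comp, Category.assoc]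
  rw [B.m_nat, ← reassoc_of% B.d_nat, ← reassoc_of% B.d_nat, ← reassoc_of% B.m_d]
  rw [reassoc_of% B.He_m, B.d_Hc]

/-- `mH · Hδ · He`, at `a`. -/
def L : B.H.obj a ⟶ B.H.obj (B.H.obj a) :=
  B.H.map (B.e a) ≫ B.H.map (B.d a) ≫ B.m (B.H.obj a)

theorem L_nat {X Y : A} (f : X ⟶ Y) : B.H.map f ≫ B.L Y = B.L X ≫ B.H.map (B.H.map f) := by
  simp only [L, Category.assoc]
  rw [← B.m_nat, ← B.H.map_comp_assoc, ← B.H.map_comp_assoc, Category.assoc,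
    reassoc_of% B.e_nat, B.d_nat]
  simp only [Functor.map_comp, Category.assoc]

theorem L_d : B.L a ≫ B.d (B.H.obj a) = B.d a ≫ B.H.map (B.L a) := by
  have h := congrArg B.H.map (B.eeddm a)
  simp only [Functor.map_comp] at h
  simp only [L, Category.assoc, Functor.map_comp]
  rw [B.m_d, ← reassoc_of% h, reassoc_of% B.d_nat (B.H.map (B.m (B.H.obj a))),
    ← B.H.map_comp_assoc (B.H.map (B.H.map (B.m (B.H.obj a)))), B.t_nat, B.H.map_comp_assoc,
    ← B.H.map_comp_assoc (B.H.map (B.H.map (B.m (B.H.obj a)))),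
    ← B.H.map_comp (B.H.map (B.m (B.H.obj a))), B.m_assoc]
  simp only [Functor.map_comp, Category.assoc]
  rw [B.m_nat, ← reassoc_of% B.m_d, reassoc_of% B.m_nat, reassoc_of% B.m_nat,
    reassoc_of% B.He_m, reassoc_of% B.d_nat, reassoc_of% B.d_nat]

theorem e_d_K_Hc : B.e a ≫ B.d a ≫ B.K (B.H.obj a) ≫ B.H.map (B.c (B.H.obj a)) =
    B.e a ≫ B.d a := by
  simp only [K, Category.assoc]
  rw [reassoc_of% B.e_nat, reassoc_of% B.e_nat]
  rw [reassoc_of% B.eeddm, ← reassoc_of% B.d_coassoc, ← B.H.map_comp, B.d_c]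
  simp

theorem L_c_m_c : B.L (B.H.obj a) ≫ B.c (B.H.obj (B.H.obj a)) ≫ B.m a ≫ B.c a =
    B.m a ≫ B.c a := by
  have h := congrArg Quiver.Hom.unop (B.op.e_d_K_Hc (Opposite.op a))
  change ((B.H.map (B.e _) ≫ (B.H.map (B.d _) ≫ B.m _) ≫ B.c _) ≫ B.m _) ≫ B.c a =
    B.m a ≫ B.c a at h
  simpa only [L, Category.assoc] using h

theorem L_c_xiBar : B.L a ≫ B.c (B.H.obj a) ≫ B.xiBar a = B.xiBar a := by
  rw [xiBar_eq', ← reassoc_of% B.c_nat, ← reassoc_of% B.L_nat, B.L_c_m_c]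

theorem L_map_xiBar : B.L a ≫ B.H.map (B.xiBar a) = B.d a ≫ B.H.map (B.xiBar a) := by
  have h : B.L a = B.d a ≫ B.H.map (B.L a) ≫ B.H.map (B.c (B.H.obj a)) := by
    rw [← reassoc_of% B.L_d, B.d_Hc, Category.comp_id]
  conv_lhs => rw [h]
  simp only [Category.assoc, ← Functor.map_comp]
  rw [B.L_c_xiBar]

/-- `Hm · Hξ̄H · δH · eH`, at `a`. -/
def J : B.H.obj a ⟶ B.H.obj (B.H.obj a) :=
  B.e (B.H.obj a) ≫ B.d (B.H.obj a) ≫ B.H.map (B.xiBar (B.H.obj a)) ≫ B.H.map (B.m a)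

theorem J_nat {X Y : A} (f : X ⟶ Y) : B.H.map f ≫ B.J Y = B.J X ≫ B.H.map (B.H.map f) := by
  simp only [J, Category.assoc]
  rw [reassoc_of% B.e_nat, reassoc_of% B.d_nat, ← B.H.map_comp_assoc, B.xiBar_nat,
    B.H.map_comp_assoc, ← B.H.map_comp, B.m_nat, B.H.map_comp]

theorem J_m : B.J a ≫ B.m a = 𝟙 _ := by
  simp only [J, Category.assoc]
  rw [B.m_assoc, reassoc_of% B.d_map_xiBar_m, B.e_m]

theorem J_xiBar : B.J a ≫ B.xiBar (B.H.obj a) = B.J a := by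
  simp only [J, Category.assoc]
  rw [B.xiBar_nat, reassoc_of% B.xiBar_nat, reassoc_of% B.e_d_xiBar]

theorem casimir {X : A} {f : X ⟶ B.H.obj (B.H.obj a)} (hf : f ≫ B.xiBar (B.H.obj a) = f) :
    f ≫ B.H.map (B.J a) ≫ B.m (B.H.obj a) = f ≫ B.m a ≫ B.J a := by
  have h1 : B.H.map (B.J a) ≫ B.m (B.H.obj a) =
      B.d (B.H.obj a) ≫ B.H.map (B.xiBar (B.H.obj a)) ≫ B.H.map (B.m a) := by
    simp only [J, Functor.map_comp, Category.assoc]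
    rw [B.m_nat, reassoc_of% B.m_nat, ← reassoc_of% B.L_map_xiBar]
    simp only [L, Category.assoc]
  have h2 : B.m a ≫ B.J a = B.e _ ≫ B.d _ ≫ B.H.map (B.xiBar _) ≫ B.H.map (B.m _) ≫
      B.H.map (B.m a) := by
    simp only [J]
    rw [reassoc_of% B.e_nat, reassoc_of% B.d_nat, ← B.H.map_comp_assoc (B.H.map (B.m a)),
      B.xiBar_nat, B.H.map_comp_assoc, ← B.H.map_comp, B.m_assoc, B.H.map_comp]
  have h3 : B.H.map (B.xiBar (B.H.obj a)) ≫ B.xiBar (B.H.obj (B.H.obj a)) ≫ B.m (B.H.obj a) =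
      B.H.map (B.xiBar (B.H.obj a)) ≫ B.m (B.H.obj a) ≫ B.xiBar (B.H.obj a) := by
    have := B.coinv_mul (B.xiBar_idem (B.H.obj a)) (B.xiBar_idem (B.H.obj (B.H.obj a)))
    rw [← B.xiBar_m_xiBar, reassoc_of% B.xiBar_nat, reassoc_of% B.xiBar_nat, ← this]
    simp only [Category.assoc]
  rw [h1, h2]
  conv_rhs => rw [← hf]
  simp only [Category.assoc]
  rw [reassoc_of% B.e_nat, reassoc_of% B.d_nat, ← B.H.map_comp_assoc, ← B.H.map_comp_assoc,
    Category.assoc, h3]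
  simp only [Functor.map_comp, Category.assoc]
  have h4 := B.coinv_of_xiBar hf
  rw [← reassoc_of% B.d_nat, ← reassoc_of% B.e_nat, reassoc_of% hf, reassoc_of% h4]
  simp only [K, Category.assoc]

theorem m_omega : B.m (B.H.obj a) ≫ B.omega a =
    B.H.map (B.omega a) ≫ B.omega (B.H.obj a) ≫ B.H.map (B.m a) := by
  simp only [omega, Functor.map_comp, Category.assoc]
  rw [reassoc_of% B.m_d, ← reassoc_of% B.m_nat (B.t a), ← B.H.map_comp_assoc (B.H.map (B.m _)),
    ← B.H.map_comp (B.m _), B.m_t, reassoc_of% B.d_nat (B.m (B.H.obj a)),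
    ← B.H.map_comp_assoc (B.H.map (B.m (B.H.obj a))) (B.t (B.H.obj a)), B.Hm_t]
  simp only [Functor.map_comp, Category.assoc]
  rw [reassoc_of% B.m_nat (B.H.map (B.m a)), B.m_nat, reassoc_of% B.m_assoc (B.H.obj (B.H.obj a)),
    reassoc_of% B.d_nat (B.H.map (B.t a)),
    ← B.H.map_comp_assoc (B.H.map (B.H.map (B.t a))) (B.t _), B.t_nat]
  simp only [Functor.map_comp, Category.assoc]

theorem omega_d : B.omega a ≫ B.d (B.H.obj a) =
    B.H.map (B.d a) ≫ B.omega (B.H.obj a) ≫ B.H.map (B.omega a) := by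
  have h := congrArg Quiver.Hom.unop (B.op.m_omega (Opposite.op a))
  change ((B.d _ ≫ B.H.map (B.t _)) ≫ B.m _) ≫ B.d _ = (B.H.map (B.d _) ≫
    ((B.d _ ≫ B.H.map (B.t _)) ≫ B.m _)) ≫ B.H.map ((B.d _ ≫ B.H.map (B.t _)) ≫ B.m _) at h
  simpa only [omega, Category.assoc] using h
end lemmas

/-- `ξ = εH · ω · eH : H ⟶ H` as a natural transformation. -/
def xiNat : B.H ⟶ B.H where
  app a := B.e (B.H.obj a) ≫ B.omega a ≫ B.c (B.H.obj a)
  naturality X Y f := by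
    simp only [Category.assoc]
    rw [reassoc_of% B.e_nat, reassoc_of% B.omega_nat, B.c_nat]

/-- `ξ̄ = Hε · ω̄ · He : H ⟶ H` as a natural transformation. -/
def xiBarNat : B.H ⟶ B.H where
  app a := B.xiBar a
  naturality _ _ f := B.xiBar_nat f

/-- The convolution product `f * g = m · (fg) · δ` of natural transformations `H ⟶ H`. -/
def conv (f g : B.H ⟶ B.H) : B.H ⟶ B.H where
  app a := B.d a ≫ B.H.map (g.app a) ≫ f.app (B.H.obj a) ≫ B.m a
  naturality X Y h := by
    simp only [Category.assoc]
    rw [reassoc_of% B.d_nat, ← B.m_nat, ← B.H.map_comp_assoc, g.naturality,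
      B.H.map_comp_assoc, ← reassoc_of% f.naturality (B.H.map h)]

/-- A weak antipode: `1 * S = ξ`, `S * 1 = ξ̄` and `S * 1 * S = S`. -/
structure IsWeakAntipode (S : B.H ⟶ B.H) : Prop where
  id_conv : B.conv (𝟙 B.H) S = B.xiNat
  conv_id : B.conv S (𝟙 B.H) = B.xiBarNat
  conv_id_conv : B.conv (B.conv S (𝟙 B.H)) S = S

/-- A weak braided Hopf monad is a weak braided bimonad that has a weak antipode. -/
def IsWeakHopf : Prop := ∃ S : B.H ⟶ B.H, B.IsWeakAntipode S

/-! ### Mixed bimodules -/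

/-- A mixed bimodule: an `H`-module `act : H(pt) ⟶ pt` and `H`-comodule `coact : pt ⟶ H(pt)` with
`coact · act = H(act) · ω · H(coact)`. -/
structure MixedBimodule where
  pt : A
  act : B.H.obj pt ⟶ pt
  coact : pt ⟶ B.H.obj pt
  unit_act : B.e pt ≫ act = 𝟙 pt
  mul_act : B.m pt ≫ act = B.H.map act ≫ act
  coact_counit : coact ≫ B.c pt = 𝟙 pt
  coact_comul : coact ≫ B.d pt = coact ≫ B.H.map coact
  act_coact : act ≫ coact = B.H.map coact ≫ B.omega pt ≫ B.H.map act

namespace MixedBimodule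

variable {B}

/-- Morphisms of mixed bimodules: morphisms of modules and of comodules. -/
@[ext]
structure Hom (M N : B.MixedBimodule) where
  f : M.pt ⟶ N.pt
  act_f : M.act ≫ f = B.H.map f ≫ N.act
  f_coact : f ≫ N.coact = M.coact ≫ B.H.map f

/-- The category of mixed bimodules; composition is that of the base category. -/
instance : Category B.MixedBimodule where
  Hom M N := Hom M N
  id M := ⟨𝟙 _, by simp, by simp⟩
  comp g h := ⟨g.f ≫ h.f,
    by rw [reassoc_of% g.act_f, h.act_f, Functor.map_comp, Category.assoc],
    by rw [Category.assoc, h.f_coact, reassoc_of% g.f_coact, Functor.map_comp]⟩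
  id_comp _ := Hom.ext (Category.id_comp _)
  comp_id _ := Hom.ext (Category.comp_id _)
  assoc _ _ _ := Hom.ext (Category.assoc _ _ _)

end MixedBimodule

/-- The functor `K_ω`, sending `a` to `(H(a), m_a, δ_a)`. -/
def KOmega : A ⥤ B.MixedBimodule where
  obj a :=
    { pt := B.H.obj a
      act := B.m a
      coact := B.d a
      unit_act := B.e_m a
      mul_act := (B.m_assoc a).symm
      coact_counit := B.d_c a
      coact_comul := (B.d_coassoc a).symm
      act_coact := by
        simp only [omega, Category.assoc]
        rw [B.m_d, B.m_nat] }
  map f :=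
    { f := B.H.map f
      act_f := (B.m_nat f).symm
      f_coact := B.d_nat f }
  map_id _ := MixedBimodule.Hom.ext (B.H.map_id _)
  map_comp _ _ := MixedBimodule.Hom.ext (B.H.map_comp _ _)

/-! ### The monad obtained by splitting `ξ̄` -/

section splitting

variable {B} (E : IdempotentSplitting B.xiBarNat)

/-- Components of the inclusion `ι : H^ξ̄ ⟶ H`. -/
def inc (E : IdempotentSplitting B.xiBarNat) (a : A) : E.obj.obj a ⟶ B.H.obj a := E.i.app a

/-- Components of the projection `q : H ⟶ H^ξ̄`. -/
def proj (E : IdempotentSplitting B.xiBarNat) (a : A) : B.H.obj a ⟶ E.obj.obj a := E.p.app a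

theorem proj_inc (a : A) : proj E a ≫ inc E a = B.xiBar a := NatTrans.congr_app E.p_i a

theorem inc_proj (a : A) : inc E a ≫ proj E a = 𝟙 _ := NatTrans.congr_app E.i_p a

theorem inc_nat {X Y : A} (f : X ⟶ Y) : E.obj.map f ≫ inc E Y = inc E X ≫ B.H.map f :=
  E.i.naturality f

theorem proj_nat {X Y : A} (f : X ⟶ Y) : B.H.map f ≫ proj E Y = proj E X ≫ E.obj.map f :=
  E.p.naturality f

theorem inc_xiBar (a : A) : inc E a ≫ B.xiBar a = inc E a := by
  rw [← proj_inc E, reassoc_of% inc_proj E]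

theorem e_proj_inc (a : A) : B.e a ≫ proj E a ≫ inc E a = B.e a := by
  rw [proj_inc, B.e_xiBar]

theorem inc_inc_m_proj_inc (a : A) :
    inc E (E.obj.obj a) ≫ B.H.map (inc E a) ≫ B.m a ≫ proj E a ≫ inc E a =
      inc E (E.obj.obj a) ≫ B.H.map (inc E a) ≫ B.m a := by
  rw [proj_inc]
  simpa only [Category.assoc] using B.coinv_mul (inc_xiBar E a) (inc_xiBar E (E.obj.obj a))

theorem eq_of_comp_inc {X a : A} {f g : X ⟶ E.obj.obj a} (h : f ≫ inc E a = g ≫ inc E a) :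
    f = g := by
  have := congrArg (· ≫ proj E a) h
  simpa only [Category.assoc, inc_proj, Category.comp_id] using this

/-- The monad `H^ξ̄` with multiplication `q · m · (ιι)` and unit `q · e`. -/
def xiMonad : Monad A where
  toFunctor := E.obj
  μ :=
    { app := fun a => inc E (E.obj.obj a) ≫ B.H.map (inc E a) ≫ B.m a ≫ proj E a
      naturality := fun X Y f => by
        change E.obj.map (E.obj.map f) ≫ _ = _
        simp only [Category.assoc]
        rw [← proj_nat, ← reassoc_of% B.m_nat, reassoc_of% inc_nat, ← B.H.map_comp_assoc,
          inc_nat, B.H.map_comp_assoc] }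
  η :=
    { app := fun a => B.e a ≫ proj E a
      naturality := fun X Y f => by
        change f ≫ _ = _
        simp only [Category.assoc]
        rw [← proj_nat, reassoc_of% B.e_nat] }
  assoc a := by
    apply eq_of_comp_inc E
    change (E.obj.map (inc E (E.obj.obj a) ≫ B.H.map (inc E a) ≫ B.m a ≫ proj E a) ≫
      inc E (E.obj.obj a) ≫ B.H.map (inc E a) ≫ B.m a ≫ proj E a) ≫ inc E a =
      ((inc E (E.obj.obj (E.obj.obj a)) ≫ B.H.map (inc E (E.obj.obj a)) ≫ B.m (E.obj.obj a) ≫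
        proj E (E.obj.obj a)) ≫
        inc E (E.obj.obj a) ≫ B.H.map (inc E a) ≫ B.m a ≫ proj E a) ≫ inc E a
    simp only [Category.assoc]
    rw [inc_inc_m_proj_inc, reassoc_of% inc_nat, ← B.H.map_comp_assoc]
    simp only [Category.assoc]
    rw [inc_inc_m_proj_inc, reassoc_of% inc_inc_m_proj_inc]
    simp only [Functor.map_comp, Category.assoc]
    rw [B.m_assoc, reassoc_of% B.m_nat]
  left_unit a := by
    apply eq_of_comp_inc E
    change ((B.e (E.obj.obj a) ≫ proj E (E.obj.obj a)) ≫
      inc E (E.obj.obj a) ≫ B.H.map (inc E a) ≫ B.m a ≫ proj E a) ≫ inc E a = 𝟙 _ ≫ inc E a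
    simp only [Category.assoc]
    rw [inc_inc_m_proj_inc, reassoc_of% e_proj_inc, ← reassoc_of% B.e_nat, B.e_m,
      Category.comp_id, Category.id_comp]
  right_unit a := by
    apply eq_of_comp_inc E
    change (E.obj.map (B.e a ≫ proj E a) ≫
      inc E (E.obj.obj a) ≫ B.H.map (inc E a) ≫ B.m a ≫ proj E a) ≫ inc E a = 𝟙 _ ≫ inc E a
    simp only [Category.assoc]
    rw [inc_inc_m_proj_inc, reassoc_of% inc_nat, ← B.H.map_comp_assoc, Category.assoc,
      e_proj_inc, B.He_m, Category.comp_id, Category.id_comp]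

end splitting

/-! ### The idempotents `Γ`, `Γ'`, the functors `Ḡ`, `T̄` -/

theorem gamma_nat {X Y : A} {h : B.H.obj X ⟶ X} {k : B.H.obj Y ⟶ Y} {f : X ⟶ Y}
    (hf : B.H.map f ≫ k = h ≫ f) :
    B.H.map f ≫ B.e (B.H.obj Y) ≫ B.omega Y ≫ B.H.map k =
      (B.e (B.H.obj X) ≫ B.omega X ≫ B.H.map h) ≫ B.H.map f := by
  simp only [Category.assoc]
  rw [← B.H.map_comp, ← hf, reassoc_of% B.e_nat, reassoc_of% B.omega_nat, B.H.map_comp]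

theorem gammaCo_nat {X Y : A} {h : X ⟶ B.H.obj X} {k : Y ⟶ B.H.obj Y} {f : X ⟶ Y}
    (hf : h ≫ B.H.map f = f ≫ k) :
    B.H.map f ≫ B.H.map k ≫ B.omega Y ≫ B.c (B.H.obj Y) =
      (B.H.map h ≫ B.omega X ≫ B.c (B.H.obj X)) ≫ B.H.map f := by
  simp only [Category.assoc]
  rw [← B.H.map_comp_assoc, ← hf, ← B.c_nat, ← reassoc_of% B.omega_nat, B.H.map_comp_assoc]

/-- The idempotent `Γ` on `H U_H`: its component at a module `(a, h)` is
`H(h) · ω_a · e_{H(a)}`. -/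
def Gamma : B.toMonad.forget ⋙ B.H ⟶ B.toMonad.forget ⋙ B.H where
  app M := B.e (B.H.obj M.A) ≫ B.omega M.A ≫ B.H.map M.a
  naturality _ _ f := B.gamma_nat f.h

/-- The idempotent `Γ'` on `H U^H`: its component at a comodule `(a, θ)` is
`ε_{H(a)} · ω_a · H(θ)`. -/
def GammaCo : B.toComonad.forget ⋙ B.H ⟶ B.toComonad.forget ⋙ B.H where
  app M := B.H.map M.a ≫ B.omega M.A ≫ B.c (B.H.obj M.A)
  naturality _ _ f := B.gammaCo_nat f.h

theorem Gamma_idem : B.Gamma ≫ B.Gamma = B.Gamma := by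
  ext M
  have h : B.m M.A ≫ M.a = B.H.map M.a ≫ M.a := M.assoc
  change (B.e (B.H.obj M.A) ≫ B.omega M.A ≫ B.H.map M.a) ≫
    B.e (B.H.obj M.A) ≫ B.omega M.A ≫ B.H.map M.a = B.e (B.H.obj M.A) ≫ B.omega M.A ≫ B.H.map M.a
  simp only [Category.assoc]
  rw [reassoc_of% B.e_nat, reassoc_of% B.omega_nat, ← B.H.map_comp, ← h, B.H.map_comp,
    reassoc_of% B.e_nat (B.omega M.A), ← reassoc_of% B.m_omega, reassoc_of% B.e_m]

theorem GammaCo_idem : B.GammaCo ≫ B.GammaCo = B.GammaCo := by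
  ext M
  have h : M.a ≫ B.d M.A = M.a ≫ B.H.map M.a := M.coassoc
  change (B.H.map M.a ≫ B.omega M.A ≫ B.c (B.H.obj M.A)) ≫
    B.H.map M.a ≫ B.omega M.A ≫ B.c (B.H.obj M.A) =
      B.H.map M.a ≫ B.omega M.A ≫ B.c (B.H.obj M.A)
  simp only [Category.assoc]
  rw [← reassoc_of% B.c_nat, ← reassoc_of% B.omega_nat, ← B.H.map_comp_assoc, ← h,
    B.H.map_comp_assoc, ← reassoc_of% B.c_nat (B.omega M.A), ← reassoc_of% B.omega_d,
    reassoc_of% B.d_c]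

/-! The three idempotents have splittings when `A` is Cauchy complete. -/

theorem nonempty_splitting_xiBar [IsIdempotentComplete A] :
    Nonempty (IdempotentSplitting B.xiBarNat) :=
  IdempotentSplitting.nonempty_of_idem _ (by ext a; exact B.xiBar_idem a)

theorem nonempty_splitting_Gamma [IsIdempotentComplete A] :
    Nonempty (IdempotentSplitting B.Gamma) :=
  IdempotentSplitting.nonempty_of_idem _ B.Gamma_idem

theorem nonempty_splitting_GammaCo [IsIdempotentComplete A] :
    Nonempty (IdempotentSplitting B.GammaCo) :=
  IdempotentSplitting.nonempty_of_idem _ B.GammaCo_idem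

section canonical

variable {B}

/-- `Ḡ = G φ_H`, where `G` splits `Γ` and `φ_H` is the free module functor. -/
def Gbar (G : IdempotentSplitting B.Gamma) : A ⥤ A := B.toMonad.free ⋙ G.obj

/-- `p̄ = p φ_H : HH ⟶ Ḡ`. -/
def pBar (G : IdempotentSplitting B.Gamma) : B.H ⋙ B.H ⟶ Gbar G :=
  Functor.whiskerLeft B.toMonad.free G.p

/-- `T̄ = T φ^H`, where `T` splits `Γ'` and `φ^H` is the cofree comodule functor. -/
def Tbar (T : IdempotentSplitting B.GammaCo) : A ⥤ A := B.toComonad.cofree ⋙ T.obj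

/-- `ī' = i' φ^H : T̄ ⟶ HH`. -/
def iBarCo (T : IdempotentSplitting B.GammaCo) : Tbar T ⟶ B.H ⋙ B.H :=
  Functor.whiskerLeft B.toComonad.cofree T.i

variable (B) in
/-- `σ = Hm · δH : HH ⟶ HH`. -/
def sigma : B.H ⋙ B.H ⟶ B.H ⋙ B.H where
  app a := B.d (B.H.obj a) ≫ B.H.map (B.m a)
  naturality X Y f := by
    change B.H.map (B.H.map f) ≫ _ = _ ≫ B.H.map (B.H.map f)
    rw [reassoc_of% B.d_nat, Category.assoc, ← B.H.map_comp, ← B.H.map_comp, B.m_nat]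

variable (B) in
/-- `σ̄ = mH · Hδ : HH ⟶ HH`. -/
def sigmaBar : B.H ⋙ B.H ⟶ B.H ⋙ B.H where
  app a := B.H.map (B.d a) ≫ B.m (B.H.obj a)
  naturality X Y f := by
    change B.H.map (B.H.map f) ≫ _ = _ ≫ B.H.map (B.H.map f)
    rw [Category.assoc, ← B.m_nat, ← B.H.map_comp_assoc, ← B.H.map_comp_assoc, B.d_nat]

/-! ### The tensor product `H ⊗_{H^ξ̄} H` and the map `γ` -/

/-- `ρ_r H : H H^ξ̄ H ⟶ HH`, where `ρ_r = m · Hι` is the right action of `H^ξ̄` on `H`. -/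
def rightAct (E : IdempotentSplitting B.xiBarNat) : B.H ⋙ E.obj ⋙ B.H ⟶ B.H ⋙ B.H where
  app a := B.H.map (inc E (B.H.obj a)) ≫ B.m (B.H.obj a)
  naturality X Y f := by
    change B.H.map (E.obj.map (B.H.map f)) ≫ _ = _ ≫ B.H.map (B.H.map f)
    rw [← B.H.map_comp_assoc, inc_nat, B.H.map_comp_assoc, B.m_nat, Category.assoc]

/-- `H ρ_l : H H^ξ̄ H ⟶ HH`, where `ρ_l = m · ιH` is the left action of `H^ξ̄` on `H`. -/
def leftAct (E : IdempotentSplitting B.xiBarNat) : B.H ⋙ E.obj ⋙ B.H ⟶ B.H ⋙ B.H where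
  app a := B.H.map (inc E (B.H.obj a) ≫ B.m a)
  naturality X Y f := by
    change B.H.map (E.obj.map (B.H.map f)) ≫ _ = _ ≫ B.H.map (B.H.map f)
    rw [← B.H.map_comp, ← B.H.map_comp, reassoc_of% inc_nat, B.m_nat, Category.assoc]

theorem sigma_balanced (E : IdempotentSplitting B.xiBarNat) :
    rightAct E ≫ B.sigma = leftAct E ≫ B.sigma := by
  ext a
  change (B.H.map (inc E (B.H.obj a)) ≫ B.m (B.H.obj a)) ≫ B.d (B.H.obj a) ≫ B.H.map (B.m a) =
    B.H.map (inc E (B.H.obj a) ≫ B.m a) ≫ B.d (B.H.obj a) ≫ B.H.map (B.m a)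
  have h := B.map_m_d (B.coinv_of_xiBar (inc_xiBar E (B.H.obj a)))
  rw [Category.assoc, reassoc_of% h, B.H.map_comp_assoc, reassoc_of% B.d_nat (B.m a),
    ← B.H.map_comp (B.H.map (B.m a)), B.m_assoc, B.H.map_comp]

/-- Auxiliary idempotent on `HH`; its splitting is the tensor product. -/
def insertNat (B : WeakBraidedBimonad A) : B.H ⋙ B.H ⟶ B.H ⋙ B.H where
  app a := B.H.map (B.J a) ≫ B.m (B.H.obj a)
  naturality X Y f := by
    change B.H.map (B.H.map f) ≫ _ = _ ≫ B.H.map (B.H.map f)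
    rw [Category.assoc, ← B.m_nat, ← B.H.map_comp_assoc, ← B.H.map_comp_assoc, B.J_nat]

/-- Auxiliary section of `H ρ_l`. -/
def tensorSection (E : IdempotentSplitting B.xiBarNat) : B.H ⋙ B.H ⟶ B.H ⋙ E.obj ⋙ B.H where
  app a := B.H.map (B.J a ≫ proj E (B.H.obj a))
  naturality X Y f := by
    change B.H.map (B.H.map f) ≫ _ = _ ≫ B.H.map (E.obj.map (B.H.map f))
    rw [← B.H.map_comp, ← B.H.map_comp, reassoc_of% B.J_nat, proj_nat, Category.assoc]

theorem tensorSection_leftAct (E : IdempotentSplitting B.xiBarNat) :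
    tensorSection E ≫ leftAct E = 𝟙 _ := by
  ext a
  change B.H.map (B.J a ≫ proj E (B.H.obj a)) ≫ B.H.map (inc E (B.H.obj a) ≫ B.m a) = 𝟙 _
  rw [← B.H.map_comp, Category.assoc, reassoc_of% proj_inc, reassoc_of% B.J_xiBar, B.J_m,
    B.H.map_id]

theorem tensorSection_rightAct (E : IdempotentSplitting B.xiBarNat) :
    tensorSection E ≫ rightAct E = insertNat B := by
  ext a
  change B.H.map (B.J a ≫ proj E (B.H.obj a)) ≫ B.H.map (inc E (B.H.obj a)) ≫ B.m (B.H.obj a) =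
    B.H.map (B.J a) ≫ B.m (B.H.obj a)
  rw [← B.H.map_comp_assoc, Category.assoc, proj_inc, B.J_xiBar]

theorem act_insert (E : IdempotentSplitting B.xiBarNat) :
    rightAct E ≫ insertNat B = leftAct E ≫ insertNat B := by
  ext a
  change (B.H.map (inc E (B.H.obj a)) ≫ B.m (B.H.obj a)) ≫ B.H.map (B.J a) ≫ B.m (B.H.obj a) =
    B.H.map (inc E (B.H.obj a) ≫ B.m a) ≫ B.H.map (B.J a) ≫ B.m (B.H.obj a)
  rw [← B.H.map_comp_assoc, Category.assoc (inc E (B.H.obj a)),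
    ← B.casimir _ (inc_xiBar E (B.H.obj a)), Category.assoc, ← reassoc_of% B.m_nat, ← B.m_assoc]
  simp only [Functor.map_comp, Category.assoc]

instance hasTensor [IsIdempotentComplete A] (E : IdempotentSplitting B.xiBarNat) :
    HasCoequalizer (rightAct E) (leftAct E) := by
  have hid : insertNat B ≫ insertNat B = insertNat B := by
    conv_lhs => lhs; rw [← tensorSection_rightAct E]
    rw [Category.assoc, act_insert, reassoc_of% tensorSection_leftAct]
  obtain ⟨S⟩ := IdempotentSplitting.nonempty_of_idem _ hid
  have h : IsSplitCoequalizer (rightAct E) (leftAct E) S.p :=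
    { rightSection := S.i
      leftSection := tensorSection E
      condition := by
        have h1 := congrArg (· ≫ S.p) (act_insert E)
        simp only [← S.p_i, Category.assoc, S.i_p, Category.comp_id] at h1
        exact h1
      rightSection_π := S.i_p
      leftSection_bottom := tensorSection_leftAct E
      leftSection_top := (tensorSection_rightAct E).trans S.p_i.symm }
  exact ⟨⟨⟨_, h.isCoequalizer⟩⟩⟩

/-! ### The cotensor product `H ⊗^{H_ξ̄} H` and the map `γ'`

The functor underlying the comonad `H_ξ̄` is `H^ξ̄`. -/

/-- `θ_r H : HH ⟶ H H^ξ̄ H`, where `θ_r = Hq · δ` is the right coaction of `H^ξ̄` on `H`. -/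
def rightCoact (E : IdempotentSplitting B.xiBarNat) : B.H ⋙ B.H ⟶ B.H ⋙ E.obj ⋙ B.H where
  app a := B.d (B.H.obj a) ≫ B.H.map (proj E (B.H.obj a))
  naturality X Y f := by
    change B.H.map (B.H.map f) ≫ _ = _ ≫ B.H.map (E.obj.map (B.H.map f))
    rw [Category.assoc, ← B.H.map_comp, ← proj_nat, B.H.map_comp, reassoc_of% B.d_nat]

/-- `H θ_l : HH ⟶ H H^ξ̄ H`, where `θ_l = qH · δ` is the left coaction of `H^ξ̄` on `H`. -/
def leftCoact (E : IdempotentSplitting B.xiBarNat) : B.H ⋙ B.H ⟶ B.H ⋙ E.obj ⋙ B.H where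
  app a := B.H.map (B.d a ≫ proj E (B.H.obj a))
  naturality X Y f := by
    change B.H.map (B.H.map f) ≫ _ = _ ≫ B.H.map (E.obj.map (B.H.map f))
    rw [← B.H.map_comp, ← B.H.map_comp, Category.assoc, ← proj_nat, reassoc_of% B.d_nat]

/-- A splitting of `ξ̄` read in the opposite category. -/
def opSplitting (E : IdempotentSplitting B.xiBarNat) : IdempotentSplitting B.op.xiBarNat where
  obj := E.obj.op
  p := { app := fun X => (inc E X.unop).op
         naturality := fun X Y f => congrArg Quiver.Hom.op (inc_nat E f.unop).symm }
  i := { app := fun X => (proj E X.unop).op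
         naturality := fun X Y f => congrArg Quiver.Hom.op (proj_nat E f.unop).symm }
  p_i := by
    ext X
    exact congrArg Quiver.Hom.op ((proj_inc E X.unop).trans (B.unop_xiBar X.unop).symm)
  i_p := by
    ext X
    exact congrArg Quiver.Hom.op (inc_proj E X.unop)

theorem sigmaBar_balanced (E : IdempotentSplitting B.xiBarNat) :
    B.sigmaBar ≫ rightCoact E = B.sigmaBar ≫ leftCoact E := by
  ext a
  have h := congrArg Quiver.Hom.unop
    (NatTrans.congr_app (sigma_balanced (opSplitting E)) (Opposite.op a))
  exact h

/-- The dual of `insertNat`. -/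
def coinsertNat (B : WeakBraidedBimonad A) : B.H ⋙ B.H ⟶ B.H ⋙ B.H where
  app a := ((insertNat B.op).app (Opposite.op a)).unop
  naturality _ _ f := congrArg Quiver.Hom.unop ((insertNat B.op).naturality f.op).symm

/-- Auxiliary retraction of `H θ_l`. -/
def cotensorRetraction (E : IdempotentSplitting B.xiBarNat) :
    B.H ⋙ E.obj ⋙ B.H ⟶ B.H ⋙ B.H where
  app a := ((tensorSection (opSplitting E)).app (Opposite.op a)).unop
  naturality _ _ f :=
    congrArg Quiver.Hom.unop ((tensorSection (opSplitting E)).naturality f.op).symm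

theorem leftCoact_retraction (E : IdempotentSplitting B.xiBarNat) :
    leftCoact E ≫ cotensorRetraction E = 𝟙 _ := by
  ext a
  exact congrArg Quiver.Hom.unop
    (NatTrans.congr_app (tensorSection_leftAct (opSplitting E)) (Opposite.op a))

theorem rightCoact_retraction (E : IdempotentSplitting B.xiBarNat) :
    rightCoact E ≫ cotensorRetraction E = coinsertNat B := by
  ext a
  exact congrArg Quiver.Hom.unop
    (NatTrans.congr_app (tensorSection_rightAct (opSplitting E)) (Opposite.op a))

theorem coinsert_coact (E : IdempotentSplitting B.xiBarNat) :
    coinsertNat B ≫ rightCoact E = coinsertNat B ≫ leftCoact E := by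
  ext a
  exact congrArg Quiver.Hom.unop
    (NatTrans.congr_app (act_insert (opSplitting E)) (Opposite.op a))

instance hasCotensor [IsIdempotentComplete A] (E : IdempotentSplitting B.xiBarNat) :
    HasEqualizer (rightCoact E) (leftCoact E) := by
  have hid : coinsertNat B ≫ coinsertNat B = coinsertNat B := by
    conv_lhs => rhs; rw [← rightCoact_retraction E]
    rw [← Category.assoc, coinsert_coact, Category.assoc, leftCoact_retraction, Category.comp_id]
  obtain ⟨S⟩ := IdempotentSplitting.nonempty_of_idem _ hid
  have h : IsSplitEqualizer (rightCoact E) (leftCoact E) S.i :=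
    { leftRetraction := S.p
      rightRetraction := cotensorRetraction E
      condition := by
        have h1 := congrArg (S.i ≫ ·) (coinsert_coact E)
        simp only [← S.p_i, Category.assoc] at h1
        rwa [reassoc_of% S.i_p, reassoc_of% S.i_p] at h1
      ι_leftRetraction := S.i_p
      bottom_rightRetraction := leftCoact_retraction E
      top_rightRetraction := (rightCoact_retraction E).trans S.p_i.symm }
  exact ⟨⟨⟨_, h.isEqualizer⟩⟩⟩

variable [IsIdempotentComplete A]

/-- The tensor product `H ⊗_{H^ξ̄} H`: the coequaliser of `ρ_r H` and `H ρ_l`. -/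
noncomputable def tensor (E : IdempotentSplitting B.xiBarNat) : A ⥤ A :=
  coequalizer (rightAct E) (leftAct E)

/-- The canonical map `γ : H ⊗_{H^ξ̄} H ⟶ Ḡ`, determined by `γ · can = p̄ · σ`. -/
noncomputable def gamma (E : IdempotentSplitting B.xiBarNat) (G : IdempotentSplitting B.Gamma) :
    tensor E ⟶ Gbar G :=
  coequalizer.desc (B.sigma ≫ pBar G) (by
    rw [← Category.assoc, ← Category.assoc, sigma_balanced])

/-- The cotensor product `H ⊗^{H_ξ̄} H`: the equaliser of `θ_r H` and `H θ_l`. -/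
noncomputable def cotensor (E : IdempotentSplitting B.xiBarNat) : A ⥤ A :=
  equalizer (rightCoact E) (leftCoact E)

/-- The canonical map `γ' : T̄ ⟶ H ⊗^{H_ξ̄} H`, determined by `can · γ' = σ̄ · ī'`. -/
noncomputable def gammaCo (E : IdempotentSplitting B.xiBarNat)
    (T : IdempotentSplitting B.GammaCo) : Tbar T ⟶ cotensor E :=
  equalizer.lift (iBarCo T ≫ B.sigmaBar) (by
    rw [Category.assoc, Category.assoc, sigmaBar_balanced])

end canonical

end WeakBraidedBimonad

namespace WeakBraidedBimonad

variable {A : Type u} [Category.{v} A] (B : WeakBraidedBimonad A)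

/-! ### The map `ω · eH` -/

section lemmas

variable (a : A)

/-! Read HH(a) as H ⊗ H ⊗ a and use Sweedler notation as a guide. Then ω is x ⊗ y ↦ x₁y ⊗ x₂, the
Galois map σ is x ⊗ y ↦ x₁ ⊗ x₂y, Γ at a module is x ⊗ v ↦ 1₁x ⊗ 1₂v, and `insertNat` is x ⊗ y ↦ x₁
⊗ ξ̄(x₂)y.

Galois conditions. The tensor product splits `insertNat`, Ḡ splits γ̄ (which is Γ at the free
modules), and σ respects both idempotents. So γ is invertible exactly when σ has an inverse β
between the two images (`IdempotentSplitting.isIso_iff`). A weak antipode gives β(x ⊗ y) = x₁ ⊗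
S(x₂)y. Conversely β is automatically left colinear and right linear, hence of this form, and S is
recovered by applying ε to the first factor of β(x ⊗ 1). The axioms are self-dual, so γ' is γ for
the opposite bimonad.

From the antipode to adjoints. On a mixed bimodule, v ↦ S(v₋₁)v₀ is a natural idempotent whose image
is the coinvariants. Its splitting R is adjoint to K_ω on both sides, and the counit x ⊗ v ↦ xv of
K_ω ⊣ R has as section the unit v ↦ v₋₁ ⊗ π(v₀) of R ⊣ K_ω (`coinvSection_counit`). Over a Cauchy
complete category a naturally split counit or unit makes the comparison functor an equivalence. At
K_ω(a) the idempotent is ξ̄, so the generated monad is H^ξ̄.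

From monadicity to the antipode. Monadicity makes every mixed bimodule a coequaliser of objects
K_ω(x) in the sense of `IsPresentedBy`, a notion that does not mention the adjoint and so passes to
opposite categories. The cofree mixed bimodule on the module H(a) lives on Ḡ(a). The map p · σ from
K_ω(H(a)) to it is weakly universal among maps from objects K_ω(x), and `insertNat` equalises all
pairs that p · σ equalises. Hence p · σ has a section (`IsPresentedBy.exists_section`), and these
sections assemble into β. -/

theorem n_Hd : B.n a ≫ B.H.map (B.d a) = B.H.map (B.d a) ≫ B.n (B.H.obj a) := by
  -- This is `t_d` composed with τ' in front and Hτ' behind; the leftover ∇ is absorbed by δ.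
  have h1 : B.s a ≫ B.H.map (B.d a) ≫ B.t (B.H.obj a) = B.d (B.H.obj a) ≫ B.H.map (B.s a) := by
    have h : B.s a ≫ B.H.map (B.d a) ≫ B.t (B.H.obj a) ≫ B.H.map (B.t a) =
        B.d (B.H.obj a) ≫ B.H.map (B.n a) := by
      rw [← B.t_d, reassoc_of% B.s_t, B.n_d]
    have h' := congrArg (· ≫ B.H.map (B.s a)) h
    simp only [Category.assoc, ← Functor.map_comp] at h'
    rw [B.t_s, B.n_s, ← B.Hn_t, ← B.H.map_comp_assoc, B.d_n] at h'
    exact h'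
  have h2 : B.n a ≫ B.H.map (B.d a) = B.s a ≫ B.d (B.H.obj a) ≫ B.H.map (B.t a) ≫
      B.t (B.H.obj a) := by
    rw [← B.t_Hd, reassoc_of% B.s_t]
  -- By `h2` the composite ends in τ, which absorbs ∇.
  have h3 : B.n a ≫ B.H.map (B.d a) ≫ B.n (B.H.obj a) = B.n a ≫ B.H.map (B.d a) := by
    rw [reassoc_of% h2, B.t_n, ← h2]
  rw [← h3, ← B.t_s (B.H.obj a), ← B.t_s a]
  simp only [Category.assoc]
  rw [reassoc_of% h1, reassoc_of% B.t_d, ← B.H.map_comp_assoc, B.t_s, ← reassoc_of% B.Hn_t,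
    ← B.H.map_comp_assoc, B.d_n]

/-- `ω · eH`, at `a`. -/
def alpha : B.H.obj a ⟶ B.H.obj (B.H.obj a) :=
  B.e (B.H.obj a) ≫ B.omega a

theorem alpha_nat {X Y : A} (f : X ⟶ Y) :
    B.H.map f ≫ B.alpha Y = B.alpha X ≫ B.H.map (B.H.map f) := by
  simp only [alpha, Category.assoc]
  rw [reassoc_of% B.e_nat, B.omega_nat]

/-- Sliding Hδ past τ turns τ · eH into ∇ · He, and the remaining ∇ is absorbed by τ' and m. The
form with τ' is the one to which the axiom `eeddsm` applies. -/
theorem alpha_eq :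
    B.alpha a = B.H.map (B.e a ≫ B.d a) ≫ B.s (B.H.obj a) ≫ B.m (B.H.obj a) := by
  have h : B.e (B.H.obj a) ≫ B.d (B.H.obj a) ≫ B.H.map (B.t a) ≫ B.n (B.H.obj a) =
      B.H.map (B.e a) ≫ B.n a ≫ B.H.map (B.d a) ≫ B.s (B.H.obj a) := by
    rw [← B.t_s, ← reassoc_of% B.t_Hd, reassoc_of% B.He_n]
  simp only [alpha, omega]
  rw [← B.n_m (B.H.obj a), reassoc_of% h, reassoc_of% B.n_Hd, reassoc_of% B.n_s,
    B.H.map_comp_assoc]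
  rw [B.n_m]

/-- The axiom `eeddsm`, once `alpha` is written with τ': 1₁ ⊗ 1'₁1₂ ⊗ 1'₂ = 1₁ ⊗ 1₂ ⊗ 1₃. -/
theorem e_d_map_alpha :
    B.e a ≫ B.d a ≫ B.H.map (B.alpha a) = B.e a ≫ B.d a ≫ B.d (B.H.obj a) := by
  rw [← B.eeddsm, alpha_eq]
  simp only [Functor.map_comp, Category.assoc]
  rw [← reassoc_of% B.d_nat, ← reassoc_of% B.d_nat, ← reassoc_of% B.e_nat, ← reassoc_of% B.e_nat,
    reassoc_of% B.e_nat (B.d a), reassoc_of% B.e_nat (B.e a)]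

/-- By naturality the second `alpha` can be applied to the copy of 1₁ ⊗ 1₂ inside the first, before
the argument is moved past it; there `e_d_map_alpha` applies. -/
theorem alpha_map_alpha : B.alpha a ≫ B.H.map (B.alpha a) = B.alpha a ≫ B.H.map (B.d a) := by
  simp only [alpha_eq B a, Category.assoc]
  rw [← B.m_nat, ← B.m_nat, ← reassoc_of% B.s_nat, ← reassoc_of% B.s_nat,
    ← B.H.map_comp_assoc, ← B.H.map_comp_assoc]
  simp only [Category.assoc]
  rw [← alpha_eq, B.e_d_map_alpha, B.d_coassoc]

theorem map_m_omega : B.H.map (B.m a) ≫ B.omega a =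
    B.omega (B.H.obj a) ≫ B.H.map (B.t a) ≫ B.m (B.H.obj a) := by
  simp only [omega, Category.assoc]
  rw [reassoc_of% B.d_nat, ← B.H.map_comp_assoc, B.Hm_t, ← reassoc_of% B.m_nat, ← B.m_assoc]
  simp only [Functor.map_comp, Category.assoc]

/-- `ξ`, at `a`. -/
def xi : B.H.obj a ⟶ B.H.obj a := B.alpha a ≫ B.c (B.H.obj a)

theorem unop_xi : (B.op.xi (Opposite.op a)).unop = B.xi a := by
  change B.e _ ≫ ((B.d _ ≫ B.H.map (B.t _)) ≫ B.m _) ≫ B.c _ = _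
  simp only [xi, alpha, omega, Category.assoc]

theorem xiNat_app : B.xiNat.app a = B.xi a := (Category.assoc _ _ _).symm

variable {a}

/-- The diagonal action `H(h) · ω : HH(a) ⟶ H(a)`. -/
def diag (h : B.H.obj a ⟶ a) : B.H.obj (B.H.obj a) ⟶ B.H.obj a := B.omega a ≫ B.H.map h

/-- The component of the idempotent `Γ` at `(a, h)`. -/
def gam (h : B.H.obj a ⟶ a) : B.H.obj a ⟶ B.H.obj a := B.alpha a ≫ B.H.map h

theorem e_diag (h : B.H.obj a ⟶ a) : B.e (B.H.obj a) ≫ B.diag h = B.gam h :=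
  (Category.assoc _ _ _).symm

theorem diag_d (h : B.H.obj a ⟶ a) : B.diag h ≫ B.d a =
    B.H.map (B.d a) ≫ B.omega (B.H.obj a) ≫ B.H.map (B.diag h) := by
  simp only [diag, Category.assoc, B.d_nat]
  rw [reassoc_of% B.omega_d]
  simp only [Functor.map_comp]

theorem alpha_map_diag (h : B.H.obj a ⟶ a) :
    B.d a ≫ B.alpha (B.H.obj a) ≫ B.H.map (B.diag h) = B.gam h ≫ B.d a := by
  rw [← B.e_diag, Category.assoc, B.diag_d, alpha, Category.assoc, reassoc_of% B.e_nat]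

/-- Multiplicativity of δ at the product 1 · x. -/
theorem d_alpha : B.d a ≫ B.alpha (B.H.obj a) ≫ B.H.map (B.m a) = B.d a := by
  have h := B.e_m a =≫ B.d a
  simp only [Category.assoc, Category.id_comp] at h
  have h2 := (B.KOmega.obj a).act_coact
  change B.m a ≫ B.d a = B.H.map (B.d a) ≫ B.omega (B.H.obj a) ≫ B.H.map (B.m a) at h2
  rw [h2, ← reassoc_of% B.e_nat] at h
  simpa only [alpha, Category.assoc] using h

/-- By `d_alpha`, x₁ ⊗ x₂ may be replaced by 1₁x₁ ⊗ 1₂x₂. A further action of 1 on the second leg is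
then 1₁x₁ ⊗ 1'₁1₂x₂ ⊗ 1'₂v, and `alpha_map_alpha` merges the two units into 1₁ ⊗ 1₂ ⊗ 1₃. -/
theorem gam_d (h : B.H.obj a ⟶ a) : B.gam h ≫ B.d a = B.d a ≫ B.H.map (B.gam h) := by
  have key : B.H.map (B.m a) ≫ B.H.map (B.alpha a) =
      B.H.map (B.alpha (B.H.obj a)) ≫ B.H.map (B.H.map (B.t a)) ≫ B.H.map (B.m (B.H.obj a)) := by
    simp only [← Functor.map_comp, alpha, Category.assoc]
    rw [reassoc_of% B.e_nat, B.map_m_omega]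
  rw [← B.alpha_map_diag]
  conv_rhs => rw [← B.d_alpha]
  simp only [gam, diag, Functor.map_comp, Category.assoc]
  rw [reassoc_of% key, reassoc_of% B.alpha_map_alpha]
  simp only [omega, Functor.map_comp, Category.assoc]

variable (a)

theorem gam_m : B.H.map (B.e a) ≫ B.gam (B.m a) = B.alpha a := by
  rw [gam, reassoc_of% B.alpha_nat, ← B.H.map_comp, B.He_m, B.H.map_id, Category.comp_id]

theorem alpha_d : B.alpha a ≫ B.d (B.H.obj a) = B.d a ≫ B.H.map (B.alpha a) := by
  conv_lhs => rw [← B.gam_m]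
  rw [Category.assoc, B.gam_d, reassoc_of% B.d_nat, ← B.H.map_comp, B.gam_m]

/-- By `alpha_d` the map `alpha` is colinear, and a colinear map into a cofree comodule is
determined by its composite with the counit, here ξ. -/
theorem alpha_eq_xi : B.alpha a = B.d a ≫ B.H.map (B.xi a) := by
  rw [xi, Functor.map_comp, ← reassoc_of% B.alpha_d, B.d_Hc, Category.comp_id]

/-- The dual of `alpha_eq_xi`: ε(x₁y)x₂ = xξ(y). -/
theorem omega_c : B.omega a ≫ B.c (B.H.obj a) = B.H.map (B.xi a) ≫ B.m a := by
  have h := congrArg Quiver.Hom.unop (B.op.alpha_eq_xi (Opposite.op a))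
  change ((B.d _ ≫ B.H.map (B.t _)) ≫ B.m _) ≫ B.c _ =
    B.H.map (B.op.xi (Opposite.op a)).unop ≫ B.m a at h
  rw [unop_xi] at h
  simp only [omega, Category.assoc] at h ⊢
  exact h

theorem xiBar_c : B.xiBar a ≫ B.c a = B.c a := by
  rw [← B.unop_xiBar a]
  exact congrArg Quiver.Hom.unop (B.op.e_xiBar (Opposite.op a))

/-- Rests on x1₁ ⊗ ξ̄(1₂) = x₁ ⊗ ξ̄(x₂). The right side is the form of `insertNat` that can be
compared with an antipode. -/
theorem map_J_m : B.H.map (B.J a) ≫ B.m (B.H.obj a) =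
    B.d (B.H.obj a) ≫ B.H.map (B.xiBar (B.H.obj a)) ≫ B.H.map (B.m a) := by
  simp only [J, Functor.map_comp, Category.assoc]
  rw [B.m_nat, reassoc_of% B.m_nat, ← reassoc_of% B.L_map_xiBar]
  simp only [L, Category.assoc]

variable {a}

/-! ### Modules and the diagonal action -/

section module

variable {h : B.H.obj a ⟶ a} (ha : B.m a ≫ h = B.H.map h ≫ h)
include ha

theorem m_diag : B.m (B.H.obj a) ≫ B.diag h = B.H.map (B.diag h) ≫ B.diag h := by
  simp only [diag, Functor.map_comp, Category.assoc]
  rw [reassoc_of% B.m_omega, ← B.H.map_comp, ha, B.H.map_comp, reassoc_of% B.omega_nat]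

theorem map_gam_diag : B.H.map (B.gam h) ≫ B.diag h = B.diag h := by
  rw [← B.e_diag, Functor.map_comp, Category.assoc, ← B.m_diag ha, reassoc_of% B.He_m]

theorem diag_gam : B.diag h ≫ B.gam h = B.diag h := by
  rw [← B.e_diag, reassoc_of% B.e_nat, ← B.m_diag ha, reassoc_of% B.e_m]

/-- Multiplicativity of δ at the product x · 1. -/
theorem map_unit_diag : B.H.map (B.e a ≫ B.d a ≫ B.H.map h) ≫ B.diag h = B.d a ≫ B.H.map h := by
  have h2 := (B.KOmega.obj a).act_coact
  change B.m a ≫ B.d a = B.H.map (B.d a) ≫ B.omega (B.H.obj a) ≫ B.H.map (B.m a) at h2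
  simp only [diag, Functor.map_comp, Category.assoc]
  rw [reassoc_of% B.omega_nat, ← B.H.map_comp, ← ha, B.H.map_comp, ← reassoc_of% h2,
    reassoc_of% B.He_m]

theorem diag_c : B.diag h ≫ B.c a = B.H.map (B.gam h ≫ B.c a) ≫ h := by
  simp only [diag, gam, Functor.map_comp, Category.assoc]
  rw [B.c_nat, reassoc_of% B.omega_c, ha, ← B.H.map_comp_assoc (B.H.map h), B.c_nat]
  simp only [xi, Functor.map_comp, Category.assoc]

theorem map_sigma_diag :
    B.H.map (B.d a ≫ B.H.map h) ≫ B.diag h = B.m a ≫ B.d a ≫ B.H.map h := by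
  have h2 := (B.KOmega.obj a).act_coact
  change B.m a ≫ B.d a = B.H.map (B.d a) ≫ B.omega (B.H.obj a) ≫ B.H.map (B.m a) at h2
  rw [reassoc_of% h2, ← B.H.map_comp (B.m a), ha]
  simp only [diag, Functor.map_comp, Category.assoc]
  rw [reassoc_of% B.omega_nat]

/-- Γ is the diagonal action of 1, and σ is linear for the diagonal action (`map_sigma_diag`). -/
theorem sigma_gam : (B.d a ≫ B.H.map h) ≫ B.gam h = B.d a ≫ B.H.map h := by
  rw [← B.e_diag, reassoc_of% B.e_nat, B.map_sigma_diag ha, reassoc_of% B.e_m]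

end module

end lemmas

end WeakBraidedBimonad

/-! ### Maps between splittings of idempotents -/

theorem IdempotentSplitting.i_comp {C : Type*} [Category* C] {X : C} {e : X ⟶ X}
    (P : IdempotentSplitting e) : P.i ≫ e = P.i :=
  calc P.i ≫ e = P.i ≫ P.p ≫ P.i := by rw [P.p_i]
    _ = P.i := by rw [reassoc_of% P.i_p]

theorem IdempotentSplitting.comp_p {C : Type*} [Category* C] {X : C} {e : X ⟶ X}
    (P : IdempotentSplitting e) : e ≫ P.p = P.p :=
  calc e ≫ P.p = (P.p ≫ P.i) ≫ P.p := by rw [P.p_i]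
    _ = P.p := by rw [Category.assoc, P.i_p, Category.comp_id]

/-- A map `i₁ · σ · p₂` between the splittings of two idempotents is invertible if and only if
`σ`, restricted to the images, has an inverse. -/
theorem IdempotentSplitting.isIso_iff {C : Type*} [Category* C] {X : C} {e₁ e₂ σ : X ⟶ X}
    (P : IdempotentSplitting e₁) (Q : IdempotentSplitting e₂)
    (h₁ : e₁ ≫ σ = σ) (h₂ : σ ≫ e₂ = σ) :
    IsIso (P.i ≫ σ ≫ Q.p) ↔ ∃ β : X ⟶ X, σ ≫ β = e₁ ∧ β ≫ σ = e₂ ∧ β ≫ σ ≫ β = β := by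
  -- σ factors through the map between the images, so inverses of that map and generalised inverses
  -- of σ correspond. The condition β ≫ σ ≫ β = β records that β vanishes outside nothing but the
  -- images: it is fixed by both idempotents.
  have hσ : σ = P.p ≫ (P.i ≫ σ ≫ Q.p) ≫ Q.i := by
    simp only [Category.assoc, Q.p_i, reassoc_of% P.p_i, h₂, h₁]
  constructor
  · intro hi
    generalize P.i ≫ σ ≫ Q.p = g at hσ hi
    have h1 : (P.p ≫ g ≫ Q.i) ≫ Q.p ≫ inv g ≫ P.i = e₁ := by
      simp only [Category.assoc, reassoc_of% Q.i_p, IsIso.hom_inv_id_assoc, P.p_i]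
    refine ⟨Q.p ≫ inv g ≫ P.i, by rw [hσ, h1], ?_, ?_⟩
    · rw [hσ]
      simp only [Category.assoc, reassoc_of% P.i_p, IsIso.inv_hom_id_assoc, Q.p_i]
    · rw [hσ, h1]
      simp only [Category.assoc, P.i_comp]
  · rintro ⟨β, h3, h4, -⟩
    refine ⟨Q.i ≫ β ≫ P.p, ?_, ?_⟩
    · simp only [Category.assoc, reassoc_of% Q.p_i, reassoc_of% h₂, reassoc_of% h3,
        reassoc_of% P.i_comp, P.i_p]
    · simp only [Category.assoc, reassoc_of% P.p_i, reassoc_of% h₁, reassoc_of% h4,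
        reassoc_of% Q.i_comp, Q.i_p]

namespace WeakBraidedBimonad

variable {A : Type u} [Category.{v} A] (B : WeakBraidedBimonad A)

/-! ### The Galois property -/

/-- The idempotent `Γ` at the free modules. -/
def gammaBar : B.H ⋙ B.H ⟶ B.H ⋙ B.H := Functor.whiskerLeft B.toMonad.free B.Gamma

/-- The idempotent `Γ'` at the cofree comodules. -/
def gammaCoBar : B.H ⋙ B.H ⟶ B.H ⋙ B.H := Functor.whiskerLeft B.toComonad.cofree B.GammaCo

theorem gammaBar_app (a : A) : B.gammaBar.app a = B.gam (B.m a) := (Category.assoc _ _ _).symm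

theorem unop_gammaBar (a : A) : (B.op.gammaBar.app (Opposite.op a)).unop = B.gammaCoBar.app a := by
  change (B.H.map (B.d a) ≫ ((B.d _ ≫ B.H.map (B.t _)) ≫ B.m _)) ≫ B.c _ =
    B.H.map (B.d a) ≫ (B.d _ ≫ B.H.map (B.t _) ≫ B.m _) ≫ B.c _
  simp only [Category.assoc]

/-- `β` is inverse to `σ` between the images of `γ̄` and of the idempotent that splits to the tensor
product. -/
structure IsGaloisInverse (β : B.H ⋙ B.H ⟶ B.H ⋙ B.H) : Prop where
  sigma_comp : B.sigma ≫ β = insertNat B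
  comp_sigma : β ≫ B.sigma = B.gammaBar
  comp_sigma_comp : β ≫ B.sigma ≫ β = β

/-! ### Weak antipodes and Galois inverses. -/

section antipode

variable {B}

theorem app_nat (S : B.H ⟶ B.H) {X Y : A} (f : X ⟶ Y) :
    B.H.map f ≫ S.app Y = S.app X ≫ B.H.map f := S.naturality f

/-- In the third axiom S * 1 is replaced by ξ̄, giving ξ̄(x₁)S(x₂) = S(x), the form in which it is
used. -/
theorem isWeakAntipode_iff {S : B.H ⟶ B.H} : B.IsWeakAntipode S ↔
    (∀ a, B.d a ≫ B.H.map (S.app a) ≫ B.m a = B.xi a) ∧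
    (∀ a, B.d a ≫ S.app (B.H.obj a) ≫ B.m a = B.xiBar a) ∧
    (∀ a, B.d a ≫ B.H.map (S.app a) ≫ B.xiBar (B.H.obj a) ≫ B.m a = S.app a) := by
  have h1 : ∀ a, (B.conv (𝟙 B.H) S).app a = B.d a ≫ B.H.map (S.app a) ≫ B.m a := fun a => by
    change B.d a ≫ B.H.map (S.app a) ≫ 𝟙 _ ≫ B.m a = _
    rw [Category.id_comp]
  have h2 : ∀ a, (B.conv S (𝟙 B.H)).app a = B.d a ≫ S.app (B.H.obj a) ≫ B.m a := fun a => by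
    change B.d a ≫ B.H.map (𝟙 (B.H.obj a)) ≫ S.app (B.H.obj a) ≫ B.m a = _
    rw [B.H.map_id, Category.id_comp]
  constructor
  · rintro ⟨h3, h4, h5⟩
    refine ⟨fun a => by rw [← h1, h3, xiNat_app], fun a => by rw [← h2, h4]; rfl, fun a => ?_⟩
    rw [h4] at h5
    exact NatTrans.congr_app h5 a
  · rintro ⟨h3, h4, h5⟩
    have h6 : B.conv S (𝟙 B.H) = B.xiBarNat := by
      ext a
      rw [h2, h4]
      rfl
    refine ⟨?_, h6, ?_⟩
    · ext a
      rw [h1, h3, xiNat_app]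
    · rw [h6]
      ext a
      exact h5 a

namespace IsWeakAntipode

variable {S : B.H ⟶ B.H} (hS : B.IsWeakAntipode S) (a : A)
include hS

theorem d_map_m : B.d a ≫ B.H.map (S.app a) ≫ B.m a = B.xi a := (isWeakAntipode_iff.1 hS).1 a

theorem d_app_m : B.d a ≫ S.app (B.H.obj a) ≫ B.m a = B.xiBar a :=
  (isWeakAntipode_iff.1 hS).2.1 a

theorem d_map_xiBar_m : B.d a ≫ B.H.map (S.app a) ≫ B.xiBar (B.H.obj a) ≫ B.m a = S.app a :=
  (isWeakAntipode_iff.1 hS).2.2 a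

end IsWeakAntipode

variable (B) in
theorem isWeakHopf_of_op (h : B.op.IsWeakHopf) : B.IsWeakHopf := by
  obtain ⟨S, hS⟩ := h
  refine ⟨{ app := fun a => (S.app (Opposite.op a)).unop
            naturality := fun X Y f => congrArg Quiver.Hom.unop (S.naturality f.op).symm },
    isWeakAntipode_iff.2 ⟨fun a => ?_, fun a => ?_, fun a => ?_⟩⟩
  · have h1 := congrArg Quiver.Hom.unop (hS.d_map_m (Opposite.op a))
    rw [unop_xi] at h1
    exact (Category.assoc _ _ _).symm.trans h1
  · have h1 := congrArg Quiver.Hom.unop (hS.d_app_m (Opposite.op a))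
    rw [unop_xiBar] at h1
    exact (Category.assoc _ _ _).symm.trans h1
  · have h1 := congrArg Quiver.Hom.unop (hS.d_map_xiBar_m (Opposite.op a))
    change ((B.d a ≫ (B.op.xiBar (Opposite.op (B.H.obj a))).unop) ≫ B.H.map _) ≫ B.m a = _ at h1
    rw [unop_xiBar] at h1
    -- The opposite composite applies ξ̄ before S; naturality interchanges them.
    rw [reassoc_of% B.xiBar_nat]
    exact ((Category.assoc _ _ _).trans (Category.assoc _ _ _)).symm.trans h1

variable (B) in
theorem isWeakHopf_op (h : B.IsWeakHopf) : B.op.IsWeakHopf := by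
  obtain ⟨S, hS⟩ := h
  refine ⟨{ app := fun X => (S.app X.unop).op
            naturality := fun X Y f => congrArg Quiver.Hom.op (S.naturality f.unop).symm },
    isWeakAntipode_iff.2 ⟨fun X => ?_, fun X => ?_, fun X => ?_⟩⟩
  · refine .trans (congrArg Quiver.Hom.op ?_) (congrArg Quiver.Hom.op (B.unop_xi X.unop).symm)
    exact (Category.assoc _ _ _).trans (hS.d_map_m X.unop)
  · refine .trans (congrArg Quiver.Hom.op ?_) (congrArg Quiver.Hom.op (B.unop_xiBar X.unop).symm)
    exact (Category.assoc _ _ _).trans (hS.d_app_m X.unop)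
  · refine congrArg Quiver.Hom.op (.trans ?_ (hS.d_map_xiBar_m X.unop))
    change ((B.d _ ≫ (B.op.xiBar (Opposite.op (B.H.obj X.unop))).unop) ≫ B.H.map (S.app _)) ≫
      B.m _ = _
    rw [unop_xiBar, reassoc_of% B.xiBar_nat]
    exact (Category.assoc _ _ _).trans (Category.assoc _ _ _)

theorem insertNat_app (a : A) : (insertNat B).app a =
    B.d (B.H.obj a) ≫ B.H.map (B.xiBar (B.H.obj a)) ≫ B.H.map (B.m a) := B.map_J_m a

/-- The Galois inverse `β(x ⊗ y) = x₁ ⊗ S(x₂) y` given by a weak antipode `S`. -/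
def galoisOfAntipode (S : B.H ⟶ B.H) : B.H ⋙ B.H ⟶ B.H ⋙ B.H where
  app a := B.d (B.H.obj a) ≫ B.H.map (S.app (B.H.obj a)) ≫ B.H.map (B.m a)
  naturality X Y f := by
    change B.H.map (B.H.map f) ≫ _ = _ ≫ B.H.map (B.H.map f)
    rw [reassoc_of% B.d_nat]
    simp only [Category.assoc, ← Functor.map_comp]
    rw [← B.m_nat, reassoc_of% app_nat]

/-- Coassociativity brings the three composites to x₁ ⊗ S(x₂)x₃y, x₁ ⊗ x₂S(x₃)y and x₁ ⊗
ξ̄(x₂)S(x₃)y, where the three antipode axioms apply. The second becomes x₁ ⊗ ξ(x₂)y, which is γ̄ by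
`alpha_eq_xi`. -/
theorem IsWeakAntipode.isGaloisInverse {S : B.H ⟶ B.H} (hS : B.IsWeakAntipode S) :
    B.IsGaloisInverse (galoisOfAntipode S) := by
  have h : B.sigma ≫ galoisOfAntipode S = insertNat B := by
    ext a
    rw [insertNat_app]
    change (B.d (B.H.obj a) ≫ B.H.map (B.m a)) ≫ B.d (B.H.obj a) ≫
      B.H.map (S.app (B.H.obj a)) ≫ B.H.map (B.m a) = _
    rw [Category.assoc, reassoc_of% B.d_nat, ← reassoc_of% B.d_coassoc]
    simp only [← Functor.map_comp]
    rw [reassoc_of% app_nat, B.m_assoc, reassoc_of% hS.d_app_m]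
  refine ⟨h, ?_, ?_⟩
  · ext a
    rw [gammaBar_app]
    change (B.d (B.H.obj a) ≫ B.H.map (S.app (B.H.obj a)) ≫ B.H.map (B.m a)) ≫
      B.d (B.H.obj a) ≫ B.H.map (B.m a) = _
    rw [gam, alpha_eq_xi]
    simp only [Category.assoc]
    rw [reassoc_of% B.d_nat, reassoc_of% B.d_nat, ← reassoc_of% B.d_coassoc]
    simp only [← Functor.map_comp]
    rw [B.m_assoc, reassoc_of% hS.d_map_m]
  · rw [h]
    ext a
    rw [NatTrans.comp_app, insertNat_app]
    change (B.d (B.H.obj a) ≫ B.H.map (S.app (B.H.obj a)) ≫ B.H.map (B.m a)) ≫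
      _ = B.d (B.H.obj a) ≫ B.H.map (S.app (B.H.obj a)) ≫ B.H.map (B.m a)
    simp only [Category.assoc]
    rw [reassoc_of% B.d_nat, reassoc_of% B.d_nat, ← reassoc_of% B.d_coassoc]
    simp only [← Functor.map_comp]
    rw [reassoc_of% B.xiBar_nat, B.m_assoc, reassoc_of% hS.d_map_xiBar_m]

namespace IsGaloisInverse

variable {β : B.H ⋙ B.H ⟶ B.H ⋙ B.H} (hβ : B.IsGaloisInverse β) (a : A)
include hβ

theorem sigma_app : B.d (B.H.obj a) ≫ B.H.map (B.m a) ≫ β.app a =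
    B.d (B.H.obj a) ≫ B.H.map (B.xiBar (B.H.obj a)) ≫ B.H.map (B.m a) := by
  rw [← insertNat_app, ← hβ.sigma_comp]
  exact (Category.assoc _ _ _).symm

theorem app_sigma :
    β.app a ≫ B.d (B.H.obj a) ≫ B.H.map (B.m a) = B.gam (B.m a) := by
  rw [← gammaBar_app, ← hβ.comp_sigma]
  rfl

theorem app_insert : β.app a ≫ B.d (B.H.obj a) ≫ B.H.map (B.xiBar (B.H.obj a)) ≫
    B.H.map (B.m a) = β.app a := by
  rw [← insertNat_app, ← hβ.sigma_comp]
  exact NatTrans.congr_app hβ.comp_sigma_comp a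

theorem gam_app : B.gam (B.m a) ≫ β.app a = β.app a := by
  rw [← gammaBar_app, ← hβ.comp_sigma]
  exact (Category.assoc _ _ _).trans (NatTrans.congr_app hβ.comp_sigma_comp a)

/-- β ≫ σ ≫ β = β allows σ ≫ β to be inserted after β, and δ passes through σ. The resulting β ≫ σ =
γ̄ is colinear by `gam_d` and is then absorbed by β. -/
theorem app_d : β.app a ≫ B.d (B.H.obj a) = B.d (B.H.obj a) ≫ B.H.map (β.app a) := by
  conv_lhs => rw [← hβ.app_insert]
  simp only [Category.assoc]
  rw [B.d_nat, reassoc_of% B.d_nat, ← reassoc_of% B.d_coassoc]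
  have h := congrArg B.H.map (hβ.sigma_app a)
  simp only [Functor.map_comp] at h
  rw [← h, reassoc_of% B.d_coassoc, ← reassoc_of% B.d_nat, reassoc_of% hβ.app_sigma,
    reassoc_of% B.gam_d, ← Functor.map_comp, hβ.gam_app]

/-- The same device as for `app_d`, with right multiplication in place of δ. -/
theorem app_map_m : β.app (B.H.obj a) ≫ B.H.map (B.m a) = B.H.map (B.m a) ≫ β.app a := by
  conv_lhs => rw [← hβ.app_insert]
  have h : B.d (B.H.obj (B.H.obj a)) ≫ B.H.map (B.xiBar (B.H.obj (B.H.obj a))) ≫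
      B.H.map (B.m (B.H.obj a)) ≫ B.H.map (B.m a) = B.H.map (B.m a) ≫
        B.d (B.H.obj a) ≫ B.H.map (B.xiBar (B.H.obj a)) ≫ B.H.map (B.m a) := by
    rw [reassoc_of% B.d_nat]
    simp only [← Functor.map_comp]
    rw [reassoc_of% B.xiBar_nat, B.m_assoc]
  simp only [Category.assoc]
  rw [h, ← hβ.sigma_app, reassoc_of% B.d_nat, ← B.H.map_comp_assoc (B.H.map (B.m a)), B.m_assoc,
    Functor.map_comp_assoc, reassoc_of% hβ.app_sigma]
  conv_rhs => rw [← hβ.gam_app]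
  simp only [gam, Category.assoc]
  rw [reassoc_of% B.alpha_nat, ← B.H.map_comp_assoc (B.H.map (B.m a)), B.m_assoc,
    Functor.map_comp_assoc]

/-- The antipode `S = εH · β · He`. -/
def antipode (β : B.H ⋙ B.H ⟶ B.H ⋙ B.H) : B.H ⟶ B.H where
  app a := B.H.map (B.e a) ≫ β.app a ≫ B.c (B.H.obj a)
  naturality X Y f := by
    have h := β.naturality f
    change B.H.map (B.H.map f) ≫ β.app Y = β.app X ≫ B.H.map (B.H.map f) at h
    rw [← B.H.map_comp_assoc, B.e_nat, B.H.map_comp_assoc, reassoc_of% h, B.c_nat]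
    simp only [Category.assoc]

/-- Right linearity: the value of β at x ⊗ y is its value at x ⊗ 1 multiplied by y. -/
theorem app_c : β.app a ≫ B.c (B.H.obj a) = (antipode β).app (B.H.obj a) ≫ B.m a := by
  change _ = (B.H.map (B.e (B.H.obj a)) ≫ β.app (B.H.obj a) ≫ B.c (B.H.obj (B.H.obj a))) ≫ B.m a
  simp only [Category.assoc]
  rw [← B.c_nat, reassoc_of% hβ.app_map_m, ← B.H.map_comp_assoc, B.e_m, B.H.map_id,
    Category.id_comp]

/-- Colinearity and `app_c` force β(x ⊗ y) = x₁ ⊗ S(x₂)y; this is the case y = 1. -/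
theorem d_map_antipode :
    B.d a ≫ B.H.map ((antipode β).app a) = B.H.map (B.e a) ≫ β.app a := by
  have h : β.app a = B.d (B.H.obj a) ≫ B.H.map ((antipode β).app (B.H.obj a) ≫ B.m a) := by
    rw [← hβ.app_c, Functor.map_comp, ← reassoc_of% hβ.app_d, B.d_Hc, Category.comp_id]
  rw [h, reassoc_of% B.d_nat]
  simp only [← Functor.map_comp]
  rw [reassoc_of% app_nat, B.He_m, Category.comp_id]

theorem isWeakAntipode : B.IsWeakAntipode (antipode β) := by
  refine isWeakAntipode_iff.2 ⟨fun a => ?_, fun a => ?_, fun a => ?_⟩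
  -- Multiplication is σ followed by ε on the first factor, so x₁S(x₂) is read off from β ≫ σ = γ̄
  -- at x ⊗ 1.
  · have h : B.d (B.H.obj a) ≫ B.H.map (B.m a) ≫ B.c (B.H.obj a) = B.m a := by
      rw [B.c_nat, reassoc_of% B.d_c]
    rw [reassoc_of% hβ.d_map_antipode]
    conv_lhs => rw [← h]
    rw [reassoc_of% hβ.app_sigma, reassoc_of% B.gam_m]
    rfl
  -- Since δ(x) = σ(x ⊗ 1), the composite S(x₁)x₂ is read off from σ ≫ β = `insertNat`.
  · have h : B.H.map (B.e a) ≫ B.d (B.H.obj a) ≫ B.H.map (B.m a) = B.d a := by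
      rw [reassoc_of% B.d_nat, ← B.H.map_comp, B.He_m, B.H.map_id, Category.comp_id]
    rw [← hβ.app_c, ← h]
    simp only [Category.assoc]
    rw [reassoc_of% hβ.sigma_app, B.c_nat, reassoc_of% B.c_nat, reassoc_of% B.d_c,
      reassoc_of% B.xiBar_nat, B.He_m, Category.comp_id]
  -- ε on the first factor of `insertNat` leaves ξ̄(x)y, and β absorbs `insertNat`.
  · have h : B.d (B.H.obj a) ≫ B.H.map (B.xiBar (B.H.obj a)) ≫ B.H.map (B.m a) ≫
        B.c (B.H.obj a) = B.xiBar (B.H.obj a) ≫ B.m a := by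
      rw [B.c_nat, reassoc_of% B.c_nat, reassoc_of% B.d_c]
    rw [reassoc_of% hβ.d_map_antipode, ← h, reassoc_of% hβ.app_insert]
    rfl

end IsGaloisInverse

theorem isWeakHopf_iff_exists_galoisInverse : B.IsWeakHopf ↔ ∃ β, B.IsGaloisInverse β :=
  ⟨fun ⟨_, hS⟩ => ⟨_, hS.isGaloisInverse⟩, fun ⟨_, hβ⟩ => ⟨_, hβ.isWeakAntipode⟩⟩

end antipode

end WeakBraidedBimonad

namespace WeakBraidedBimonad

variable {A : Type u} [Category.{v} A] {B : WeakBraidedBimonad A}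

/-! ### The canonical maps -/

theorem gammaBar_pBar (G : IdempotentSplitting B.Gamma) (a : A) :
    (pBar G).app a ≫ G.i.app (B.toMonad.free.obj a) = B.gam (B.m a) := by
  rw [← gammaBar_app]
  exact NatTrans.congr_app G.p_i _

/-- The splitting of `Γ` at the free modules. -/
def gammaBarSplitting (G : IdempotentSplitting B.Gamma) : IdempotentSplitting B.gammaBar where
  obj := Gbar G
  p := pBar G
  i := Functor.whiskerLeft B.toMonad.free G.i
  p_i := by
    ext a
    exact NatTrans.congr_app G.p_i _
  i_p := by
    ext a
    exact NatTrans.congr_app G.i_p _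

/-- The splitting of `Γ'` at the cofree comodules. -/
def gammaCoBarSplitting (T : IdempotentSplitting B.GammaCo) :
    IdempotentSplitting B.gammaCoBar where
  obj := Tbar T
  p := Functor.whiskerLeft B.toComonad.cofree T.p
  i := iBarCo T
  p_i := by
    ext a
    exact NatTrans.congr_app T.p_i _
  i_p := by
    ext a
    exact NatTrans.congr_app T.i_p _

theorem sigma_gammaBar : B.sigma ≫ B.gammaBar = B.sigma := by
  ext a
  rw [NatTrans.comp_app, gammaBar_app]
  exact B.sigma_gam (B.m_assoc a).symm

/-- `insertNat` inserts 1₁ ⊗ ξ̄(1₂) between the two factors; σ is balanced, and multiplying the two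
inserted legs together gives 1. -/
theorem insertNat_sigma (E : IdempotentSplitting B.xiBarNat) :
    insertNat B ≫ B.sigma = B.sigma := by
  rw [← tensorSection_rightAct E, Category.assoc, sigma_balanced,
    reassoc_of% tensorSection_leftAct]

theorem gammaCoBar_sigmaBar : B.gammaCoBar ≫ B.sigmaBar = B.sigmaBar := by
  ext a
  rw [NatTrans.comp_app, ← unop_gammaBar]
  exact congrArg Quiver.Hom.unop (NatTrans.congr_app (B.op.sigma_gammaBar) (Opposite.op a))

theorem sigmaBar_coinsertNat (E : IdempotentSplitting B.xiBarNat) :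
    B.sigmaBar ≫ coinsertNat B = B.sigmaBar := by
  rw [← rightCoact_retraction E, ← Category.assoc, sigmaBar_balanced, Category.assoc,
    leftCoact_retraction, Category.comp_id]

variable [IsIdempotentComplete A]

/-- The tensor product splits the idempotent `insertNat`. -/
noncomputable def tensorSplitting (E : IdempotentSplitting B.xiBarNat) :
    IdempotentSplitting (insertNat B) where
  obj := coequalizer (rightAct E) (leftAct E)
  p := coequalizer.π (rightAct E) (leftAct E)
  i := coequalizer.desc (insertNat B) (act_insert E)
  p_i := coequalizer.π_desc _ _
  i_p := by
    apply coequalizer.hom_ext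
    rw [coequalizer.π_desc_assoc, ← tensorSection_rightAct E, Category.assoc,
      coequalizer.condition, reassoc_of% tensorSection_leftAct]
    exact (Category.comp_id _).symm

/-- The cotensor product splits the idempotent `coinsertNat`. -/
noncomputable def cotensorSplitting (E : IdempotentSplitting B.xiBarNat) :
    IdempotentSplitting (coinsertNat B) where
  obj := equalizer (rightCoact E) (leftCoact E)
  p := equalizer.lift (coinsertNat B) (coinsert_coact E)
  i := equalizer.ι (rightCoact E) (leftCoact E)
  p_i := equalizer.lift_ι _ _
  i_p := by
    apply equalizer.hom_ext
    rw [Category.assoc, equalizer.lift_ι, ← rightCoact_retraction E, ← Category.assoc,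
      equalizer.condition, Category.assoc, leftCoact_retraction]
    exact (Category.comp_id _).trans (Category.id_comp _).symm

/-- γ is the map that σ induces between the splittings of `insertNat` and γ̄, so its inverses are
the Galois inverses. -/
theorem isIso_gamma_iff (E : IdempotentSplitting B.xiBarNat) (G : IdempotentSplitting B.Gamma) :
    IsIso (gamma E G) ↔ B.IsWeakHopf := by
  have h : gamma E G = (tensorSplitting E).i ≫ B.sigma ≫ (gammaBarSplitting G).p := by
    apply coequalizer.hom_ext
    refine (coequalizer.π_desc _ _).trans ?_
    have h1 : (tensorSplitting E).p ≫ (tensorSplitting E).i ≫ B.sigma ≫ (gammaBarSplitting G).p =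
        B.sigma ≫ (gammaBarSplitting G).p := by
      rw [reassoc_of% (tensorSplitting E).p_i, reassoc_of% insertNat_sigma E]
    exact h1.symm
  refine (iff_of_eq (congrArg IsIso h)).trans (((tensorSplitting E).isIso_iff (gammaBarSplitting G)
    (insertNat_sigma E) sigma_gammaBar).trans ?_)
  rw [isWeakHopf_iff_exists_galoisInverse]
  exact ⟨fun ⟨β, h1, h2, h3⟩ => ⟨β, h1, h2, h3⟩, fun ⟨β, h1, h2, h3⟩ => ⟨β, h1, h2, h3⟩⟩

theorem isIso_gammaCo_iff (E : IdempotentSplitting B.xiBarNat)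
    (T : IdempotentSplitting B.GammaCo) : IsIso (gammaCo E T) ↔ B.IsWeakHopf := by
  have h : gammaCo E T =
      (gammaCoBarSplitting T).i ≫ B.sigmaBar ≫ (cotensorSplitting E).p := by
    apply equalizer.hom_ext
    refine (equalizer.lift_ι _ _).trans ?_
    have h1 : ((gammaCoBarSplitting T).i ≫ B.sigmaBar ≫ (cotensorSplitting E).p) ≫
        (cotensorSplitting E).i = (gammaCoBarSplitting T).i ≫ B.sigmaBar := by
      rw [Category.assoc, Category.assoc, (cotensorSplitting E).p_i, sigmaBar_coinsertNat E]
    exact h1.symm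
  have h0 : B.op.IsWeakHopf ↔ B.IsWeakHopf := ⟨B.isWeakHopf_of_op, B.isWeakHopf_op⟩
  refine (iff_of_eq (congrArg IsIso h)).trans (((gammaCoBarSplitting T).isIso_iff
    (cotensorSplitting E) gammaCoBar_sigmaBar (sigmaBar_coinsertNat E)).trans ?_)
  rw [← h0, isWeakHopf_iff_exists_galoisInverse]
  constructor
  -- Passing to the opposite category reverses composition, so the equations for σ̄ ≫ β and β ≫ σ̄
  -- trade places.
  · rintro ⟨β, h1, h2, h3⟩
    refine ⟨{ app := fun X => (β.app X.unop).op
              naturality := fun X Y f => congrArg Quiver.Hom.op (β.naturality f.unop).symm },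
      ?_, ?_, ?_⟩
    · ext X
      exact congrArg Quiver.Hom.op (NatTrans.congr_app h2 X.unop)
    · ext X
      exact congrArg Quiver.Hom.op
        ((NatTrans.congr_app h1 X.unop).trans (B.unop_gammaBar X.unop).symm)
    · ext X
      exact congrArg Quiver.Hom.op
        ((Category.assoc _ _ _).trans (NatTrans.congr_app h3 X.unop))
  · rintro ⟨β, h1, h2, h3⟩
    refine ⟨{ app := fun a => (β.app (Opposite.op a)).unop
              naturality := fun X Y f => congrArg Quiver.Hom.unop (β.naturality f.op).symm },
      ?_, ?_, ?_⟩
    · ext a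
      exact (congrArg Quiver.Hom.unop (NatTrans.congr_app h2 (Opposite.op a))).trans
        (B.unop_gammaBar a)
    · ext a
      exact congrArg Quiver.Hom.unop (NatTrans.congr_app h1 (Opposite.op a))
    · ext a
      refine .trans ?_ (congrArg Quiver.Hom.unop (NatTrans.congr_app h3 (Opposite.op a)))
      exact (Category.assoc _ _ _).symm

end WeakBraidedBimonad

/-! ### Adjunctions with naturally split counit or unit -/

namespace CategoryTheory

universe v₁ v₂ u₁ u₂

variable {C : Type u₁} {D : Type u₂} [Category.{v₁} C] [Category.{v₂} D]

/-- A right adjoint functor on a Cauchy complete category is monadic if the counit has a natural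
section. -/
theorem Monad.isEquivalence_comparison_of_section {F : C ⥤ D} {R : D ⥤ C} (adj : F ⊣ R)
    [IsIdempotentComplete D] (s : 𝟭 D ⟶ R ⋙ F) (hs : s ≫ adj.counit = 𝟙 _) :
    (Monad.comparison adj).IsEquivalence := by
  let t : ∀ M : D, M ⟶ F.obj (R.obj M) := fun M => s.app M
  let ε : ∀ M : D, F.obj (R.obj M) ⟶ M := fun M => adj.counit.app M
  let η : ∀ x : C, x ⟶ R.obj (F.obj x) := fun x => adj.unit.app x
  have hs' : ∀ M, t M ≫ ε M = 𝟙 M := fun M => NatTrans.congr_app hs M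
  have hn : ∀ {M N : D} (f : M ⟶ N), f ≫ t N = t M ≫ F.map (R.map f) :=
    fun f => s.naturality f
  have hε : ∀ {M N : D} (f : M ⟶ N), F.map (R.map f) ≫ ε N = ε M ≫ f :=
    fun f => adj.counit.naturality f
  have hη : ∀ {x y : C} (f : x ⟶ y), f ≫ η y = η x ≫ R.map (F.map f) :=
    fun f => adj.unit.naturality f
  have hRε : ∀ M, η (R.obj M) ≫ R.map (ε M) = 𝟙 (R.obj M) :=
    fun M => adj.right_triangle_components M
  have faithful : (Monad.comparison adj).Faithful := by
    refine ⟨fun {M N} f g h => ?_⟩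
    have h1 : R.map f = R.map g := congrArg Monad.Algebra.Hom.f h
    rw [← Category.id_comp f, ← Category.id_comp g, ← hs' M, Category.assoc, Category.assoc,
      ← hε, ← hε, h1]
  have full : (Monad.comparison adj).Full := by
    refine ⟨fun {M N} φ => ?_⟩
    obtain ⟨f, h⟩ := φ
    change R.obj M ⟶ R.obj N at f
    change R.map (F.map f) ≫ R.map (ε N) = R.map (ε M) ≫ f at h
    -- The preimage of an algebra map f: enter by the section, apply F(f), leave by the counit.
    refine ⟨t M ≫ F.map f ≫ ε N, ?_⟩
    ext
    change R.map (t M ≫ F.map f ≫ ε N) = f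
    rw [Functor.map_comp, Functor.map_comp, h, ← R.map_comp_assoc, hs', R.map_id,
      Category.id_comp]
  have essSurj : (Monad.comparison adj).EssSurj := by
    refine ⟨fun X => ?_⟩
    obtain ⟨x, α, unit, assoc⟩ := X
    change R.obj (F.obj x) ⟶ x at α
    change η x ≫ α = 𝟙 x at unit
    change R.map (ε (F.obj x)) ≫ α = R.map (F.map α) ≫ α at assoc
    have hFα : t (F.obj (R.obj (F.obj x))) ≫ F.map (R.map (F.map α)) ≫ F.map α =
        ε (F.obj x) ≫ t (F.obj x) ≫ F.map α := by
      rw [← F.map_comp, ← assoc, F.map_comp, ← reassoc_of% hn]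
    have hj : F.map α ≫ t (F.obj x) ≫ F.map α =
        ε (F.obj x) ≫ t (F.obj x) ≫ F.map α := by
      rw [reassoc_of% hn, hFα]
    -- The object over the algebra (x, α) is cut out of F(x) by the idempotent t ≫ F(α);
    -- associativity of α gives idempotence.
    obtain ⟨⟨M, p, i, hp, hi⟩⟩ := IdempotentSplitting.nonempty_of_idem
      (t (F.obj x) ≫ F.map α) (by rw [Category.assoc, hj, reassoc_of% hs'])
    have hαp : F.map α ≫ p = ε (F.obj x) ≫ p := by
      have h1 : F.map α ≫ p ≫ i = ε (F.obj x) ≫ p ≫ i := by rw [hp, hj]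
      have := h1 =≫ p
      simpa only [Category.assoc, hi, Category.comp_id] using this
    have e1 : (η x ≫ R.map p) ≫ R.map i ≫ α = 𝟙 x := by
      rw [Category.assoc, ← R.map_comp_assoc, hp, R.map_comp, Category.assoc, ← assoc,
        ← R.map_comp_assoc, hs', R.map_id, Category.id_comp, unit]
    have e2 : α ≫ η x ≫ R.map p = R.map p := by
      rw [reassoc_of% hη, ← R.map_comp, hαp, R.map_comp, reassoc_of% hRε]
    have e3 : (R.map i ≫ α) ≫ η x ≫ R.map p = 𝟙 _ := by
      rw [Category.assoc, e2, ← R.map_comp, hi, R.map_id]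
    refine ⟨M, ⟨Monad.Algebra.isoMk ⟨R.map i ≫ α, η x ≫ R.map p, e3, e1⟩ ?_⟩⟩
    change R.map (F.map (R.map i ≫ α)) ≫ α = R.map (ε M) ≫ R.map i ≫ α
    rw [F.map_comp, R.map_comp, Category.assoc, ← assoc, ← R.map_comp_assoc, hε, R.map_comp,
      Category.assoc]
  exact {}

/-- A left adjoint functor on a Cauchy complete category is comonadic if the unit has a natural
retraction. -/
theorem Comonad.isEquivalence_comparison_of_retraction {L : C ⥤ D} {G : D ⥤ C} (adj : L ⊣ G)
    [IsIdempotentComplete C] (r : L ⋙ G ⟶ 𝟭 C) (hr : adj.unit ≫ r = 𝟙 _) :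
    (Comonad.comparison adj).IsEquivalence := by
  let t : ∀ M : C, G.obj (L.obj M) ⟶ M := fun M => r.app M
  let ε : ∀ x : D, L.obj (G.obj x) ⟶ x := fun x => adj.counit.app x
  let η : ∀ M : C, M ⟶ G.obj (L.obj M) := fun M => adj.unit.app M
  have hr' : ∀ M, η M ≫ t M = 𝟙 M := fun M => NatTrans.congr_app hr M
  have hn : ∀ {M N : C} (f : M ⟶ N), G.map (L.map f) ≫ t N = t M ≫ f :=
    fun f => r.naturality f
  have hε : ∀ {x y : D} (f : x ⟶ y), L.map (G.map f) ≫ ε y = ε x ≫ f :=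
    fun f => adj.counit.naturality f
  have hη : ∀ {M N : C} (f : M ⟶ N), f ≫ η N = η M ≫ G.map (L.map f) :=
    fun f => adj.unit.naturality f
  have hLη : ∀ M, L.map (η M) ≫ ε (L.obj M) = 𝟙 (L.obj M) :=
    fun M => adj.left_triangle_components M
  have hGε : ∀ x, η (G.obj x) ≫ G.map (ε x) = 𝟙 (G.obj x) :=
    fun x => adj.right_triangle_components x
  have faithful : (Comonad.comparison adj).Faithful := by
    refine ⟨fun {M N} f g h => ?_⟩
    have h1 : L.map f = L.map g := congrArg Comonad.Coalgebra.Hom.f h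
    rw [← Category.comp_id f, ← Category.comp_id g, ← hr' N, reassoc_of% hη, reassoc_of% hη, h1]
  have full : (Comonad.comparison adj).Full := by
    refine ⟨fun {M N} φ => ?_⟩
    obtain ⟨f, h⟩ := φ
    change L.obj M ⟶ L.obj N at f
    change L.map (η M) ≫ L.map (G.map f) = f ≫ L.map (η N) at h
    refine ⟨η M ≫ G.map f ≫ t N, ?_⟩
    ext
    change L.map (η M ≫ G.map f ≫ t N) = f
    rw [Functor.map_comp, Functor.map_comp, reassoc_of% h, ← L.map_comp, hr', L.map_id,
      Category.comp_id]
  have essSurj : (Comonad.comparison adj).EssSurj := by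
    refine ⟨fun X => ?_⟩
    obtain ⟨x, α, counit, coassoc⟩ := X
    change x ⟶ L.obj (G.obj x) at α
    change α ≫ ε x = 𝟙 x at counit
    change α ≫ L.map (η (G.obj x)) = α ≫ L.map (G.map α) at coassoc
    have hGα : G.map α ≫ G.map (L.map (G.map α)) ≫ t (G.obj (L.obj (G.obj x))) =
        G.map α ≫ t (G.obj x) ≫ η (G.obj x) := by
      rw [← G.map_comp_assoc, ← coassoc, G.map_comp_assoc, hn]
    have hj : G.map α ≫ t (G.obj x) ≫ G.map α =
        G.map α ≫ t (G.obj x) ≫ η (G.obj x) := by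
      rw [← hn, hGα]
    -- Dually, the object over a coalgebra is cut out of G(x) by G(α) followed by the retraction.
    obtain ⟨⟨M, p, i, hp, hi⟩⟩ := IdempotentSplitting.nonempty_of_idem
      (G.map α ≫ t (G.obj x)) (by
        rw [Category.assoc, reassoc_of% hj, hr', Category.comp_id])
    have hαi : i ≫ G.map α = i ≫ η (G.obj x) := by
      have h1 : p ≫ i ≫ G.map α = p ≫ i ≫ η (G.obj x) := by
        rw [reassoc_of% hp, reassoc_of% hp, hj]
      have := i ≫= h1
      simpa only [reassoc_of% hi] using this
    have e1 : (α ≫ L.map p) ≫ L.map i ≫ ε x = 𝟙 x := by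
      rw [Category.assoc, ← L.map_comp_assoc, hp, L.map_comp, Category.assoc,
        ← reassoc_of% coassoc, ← L.map_comp_assoc, hr', L.map_id, Category.id_comp, counit]
    have e2 : (L.map i ≫ ε x) ≫ α = L.map i := by
      rw [Category.assoc, ← hε, ← L.map_comp_assoc, hαi, L.map_comp_assoc, hLη, Category.comp_id]
    have e3 : (L.map i ≫ ε x) ≫ α ≫ L.map p = 𝟙 _ := by
      rw [← Category.assoc, e2, ← L.map_comp, hi, L.map_id]
    refine ⟨M, ⟨Comonad.Coalgebra.isoMk ⟨L.map i ≫ ε x, α ≫ L.map p, e3, e1⟩ ?_⟩⟩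
    change L.map (η M) ≫ L.map (G.map (L.map i ≫ ε x)) =
      (L.map i ≫ ε x) ≫ α
    rw [e2, G.map_comp, ← L.map_comp, ← reassoc_of% hη, hGε, Category.comp_id]
  exact {}

/-! ### Objects presented by a functor -/

/-- `M` is presented by `F` if there is a weakly universal map `ε : F r ⟶ M` that is the common
coequaliser of all pairs of maps out of objects `F x` that it coequalises. -/
def IsPresentedBy (F : C ⥤ D) (M : D) : Prop :=
  ∃ (r : C) (ε : F.obj r ⟶ M), (∀ (x : C) (f : F.obj x ⟶ M), ∃ u : x ⟶ r, F.map u ≫ ε = f) ∧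
    (∀ (N : D) (l l' : M ⟶ N), ε ≫ l = ε ≫ l' → l = l') ∧
    ∀ (N : D) (k : F.obj r ⟶ N),
      (∀ (x : C) (w w' : F.obj x ⟶ F.obj r), w ≫ ε = w' ≫ ε → w ≫ k = w' ≫ k) →
        ∃ l : M ⟶ N, ε ≫ l = k

theorem Monad.isPresentedBy_of_comparison {F : C ⥤ D} {R : D ⥤ C} (adj : F ⊣ R)
    [(Monad.comparison adj).IsEquivalence] (M : D) : IsPresentedBy F M := by
  refine ⟨R.obj M, adj.counit.app M, fun x f => ⟨adj.homEquiv _ _ f, ?_⟩, fun N l l' h => ?_,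
    fun N k hk => ?_⟩
  · rw [← adj.homEquiv_counit, Equiv.symm_apply_apply]
  · apply (Monad.comparison adj).map_injective
    ext
    change R.map l = R.map l'
    have h1 := adj.unit.app (R.obj M) ≫= congrArg R.map h
    simpa only [R.map_comp, adj.right_triangle_components_assoc] using h1
  · have h1 : F.map (R.map (adj.counit.app M)) ≫ k = adj.counit.app _ ≫ k :=
      hk _ _ _ (adj.counit.naturality (adj.counit.app M))
    have hF : F.map (adj.unit.app (R.obj M)) ≫ adj.counit.app (F.obj (R.obj M)) = 𝟙 _ :=
      adj.left_triangle_components _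
    have hεN : F.map (adj.unit.app (R.obj M) ≫ R.map k) ≫ adj.counit.app N = k := by
      have h2 : F.map (R.map k) ≫ adj.counit.app N = _ ≫ k := adj.counit.naturality k
      rw [F.map_comp, Category.assoc, h2, reassoc_of% hF]
    let φ : (Monad.comparison adj).obj M ⟶ (Monad.comparison adj).obj N :=
      { f := adj.unit.app (R.obj M) ≫ R.map k
        h := by
          change R.map (F.map (adj.unit.app (R.obj M) ≫ R.map k)) ≫ R.map (adj.counit.app N) =
            R.map (adj.counit.app M) ≫ adj.unit.app (R.obj M) ≫ R.map k
          have h3 : R.map (adj.counit.app M) ≫ adj.unit.app (R.obj M) = adj.unit.app _ ≫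
            R.map (F.map (R.map (adj.counit.app M))) := adj.unit.naturality _
          rw [← R.map_comp, hεN, reassoc_of% h3, ← R.map_comp, h1, R.map_comp,
            adj.right_triangle_components_assoc] }
    obtain ⟨l, hl⟩ := (Monad.comparison adj).map_surjective φ
    have hl' : R.map l = adj.unit.app (R.obj M) ≫ R.map k := congrArg Monad.Algebra.Hom.f hl
    refine ⟨l, ?_⟩
    have h4 : F.map (R.map l) ≫ adj.counit.app N = adj.counit.app M ≫ l := adj.counit.naturality l
    rw [← h4, hl', hεN]

theorem Comonad.isPresentedBy_of_comparison {L : C ⥤ D} {G : D ⥤ C} (adj : L ⊣ G)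
    [(Comonad.comparison adj).IsEquivalence] (M : C) : IsPresentedBy G.op (Opposite.op M) := by
  let ε : ∀ x : D, L.obj (G.obj x) ⟶ x := fun x => adj.counit.app x
  let η : ∀ M : C, M ⟶ G.obj (L.obj M) := fun M => adj.unit.app M
  have hε : ∀ {x y : D} (f : x ⟶ y), L.map (G.map f) ≫ ε y = ε x ≫ f :=
    fun f => adj.counit.naturality f
  have hη : ∀ {M N : C} (f : M ⟶ N), f ≫ η N = η M ≫ G.map (L.map f) :=
    fun f => adj.unit.naturality f
  have hLη : ∀ M, L.map (η M) ≫ ε (L.obj M) = 𝟙 (L.obj M) :=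
    fun M => adj.left_triangle_components M
  have hGε : ∀ x, η (G.obj x) ≫ G.map (ε x) = 𝟙 (G.obj x) :=
    fun x => adj.right_triangle_components x
  refine ⟨Opposite.op (L.obj M), (η M).op, fun x f => ?_, fun N l l' h => ?_, fun N k hk => ?_⟩
  · obtain ⟨x⟩ := x
    obtain ⟨f, rfl⟩ : ∃ f' : M ⟶ G.obj x, f = f'.op := ⟨f.unop, rfl⟩
    refine ⟨(L.map f ≫ ε x).op, Quiver.Hom.unop_inj ?_⟩
    change η M ≫ G.map (L.map f ≫ ε x) = f
    rw [G.map_comp, ← reassoc_of% hη, hGε, Category.comp_id]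
  · obtain ⟨N⟩ := N
    obtain ⟨l, rfl⟩ : ∃ f : N ⟶ M, l = f.op := ⟨l.unop, rfl⟩
    obtain ⟨l', rfl⟩ : ∃ f : N ⟶ M, l' = f.op := ⟨l'.unop, rfl⟩
    have h' : l ≫ η M = l' ≫ η M := congrArg Quiver.Hom.unop h
    refine congrArg Quiver.Hom.op ((Comonad.comparison adj).map_injective ?_)
    ext
    change L.map l = L.map l'
    rw [← Category.comp_id (L.map l), ← Category.comp_id (L.map l'), ← hLη M,
      ← L.map_comp_assoc, ← L.map_comp_assoc, h']
  · obtain ⟨N⟩ := N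
    obtain ⟨k, rfl⟩ : ∃ k' : N ⟶ G.obj (L.obj M), k = k'.op := ⟨k.unop, rfl⟩
    have h1 : k ≫ G.map (L.map (η M)) = k ≫ η (G.obj (L.obj M)) :=
      congrArg Quiver.Hom.unop (hk (Opposite.op (L.obj (G.obj (L.obj M))))
        (G.map (L.map (η M))).op (η (G.obj (L.obj M))).op
        (congrArg Quiver.Hom.op (hη (η M)).symm))
    have hηN : η N ≫ G.map (L.map k ≫ ε (L.obj M)) = k := by
      rw [G.map_comp, ← reassoc_of% hη, hGε, Category.comp_id]
    -- The adjunct of k; by `h1` it is a map of coalgebras, so fullness provides the factorisation.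
    let φ : (Comonad.comparison adj).obj N ⟶ (Comonad.comparison adj).obj M :=
      { f := L.map k ≫ ε (L.obj M)
        h := by
          change L.map (η N) ≫ L.map (G.map (L.map k ≫ ε (L.obj M))) =
            (L.map k ≫ ε (L.obj M)) ≫ L.map (η M)
          rw [← L.map_comp, hηN, Category.assoc, ← hε, ← L.map_comp_assoc, h1, L.map_comp_assoc,
            hLη, Category.comp_id] }
    obtain ⟨l, hl⟩ := (Comonad.comparison adj).map_surjective φ
    have hl' : L.map l = L.map k ≫ ε (L.obj M) := congrArg Comonad.Coalgebra.Hom.f hl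
    refine ⟨l.op, Quiver.Hom.unop_inj ?_⟩
    change l ≫ η M = k
    rw [hη, hl', hηN]

/-- All maps to be tested lie between objects in the image of Φ, so a full and faithful Φ reflects
the property. This serves to pass to the opposite bimonad. -/
theorem IsPresentedBy.of_comp {D' : Type*} [Category* D'] {F : C ⥤ D} {Φ : D ⥤ D'} [Φ.Full]
    [Φ.Faithful] {M : D} (h : IsPresentedBy (F ⋙ Φ) (Φ.obj M)) : IsPresentedBy F M := by
  obtain ⟨r, ε, h1, h2, h3⟩ := h
  obtain ⟨ε, rfl⟩ := Φ.map_surjective ε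
  refine ⟨r, ε, fun x f => ?_, fun N l l' h => ?_, fun N k hk => ?_⟩
  · obtain ⟨u, hu⟩ := h1 x (Φ.map f)
    exact ⟨u, Φ.map_injective ((Φ.map_comp _ _).trans hu)⟩
  · refine Φ.map_injective (h2 _ _ _ ?_)
    rw [← Φ.map_comp, h, Φ.map_comp]
  · obtain ⟨l, hl⟩ := h3 _ (Φ.map k) fun x w w' hw => by
      obtain ⟨w, rfl⟩ := Φ.map_surjective (X := F.obj x) (Y := F.obj r) w
      obtain ⟨w', rfl⟩ := Φ.map_surjective (X := F.obj x) (Y := F.obj r) w'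
      refine (Φ.map_comp _ _).symm.trans ((congrArg Φ.map (hk x w w' ?_)).trans (Φ.map_comp _ _))
      exact Φ.map_injective ((Φ.map_comp _ _).trans (hw.trans (Φ.map_comp _ _).symm))
    obtain ⟨l, rfl⟩ := Φ.map_surjective l
    exact ⟨l, Φ.map_injective ((Φ.map_comp _ _).trans hl)⟩

/-- A weakly universal map from `F` to a presented object splits every map that coequalises all
pairs it coequalises. -/
theorem IsPresentedBy.exists_section {F : C ⥤ D} {M : D} (hM : IsPresentedBy F M) {y : C}
    {g : F.obj y ⟶ M} (hg : ∀ (x : C) (f : F.obj x ⟶ M), ∃ u : x ⟶ y, F.map u ≫ g = f)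
    {I : F.obj y ⟶ F.obj y} (hI : I ≫ g = g)
    (hk : ∀ (x : C) (w w' : F.obj x ⟶ F.obj y), w ≫ g = w' ≫ g → w ≫ I = w' ≫ I) :
    ∃ ψ : M ⟶ F.obj y, g ≫ ψ = I ∧ ψ ≫ g = 𝟙 M := by
  obtain ⟨r, ε, h1, h2, h3⟩ := hM
  obtain ⟨u, hu⟩ := hg r ε
  obtain ⟨v, hv⟩ := h1 y g
  -- u and v compare the two weakly universal maps ε and g; the section is obtained by descending
  -- F(u) ≫ I along ε.
  obtain ⟨ψ, hψ⟩ := h3 _ (F.map u ≫ I) fun x w w' hw => by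
    rw [← Category.assoc, ← Category.assoc]
    exact hk _ _ _ (by rw [Category.assoc, Category.assoc, hu, hw])
  refine ⟨ψ, ?_, h2 _ _ _ ?_⟩
  -- F(v) ≫ F(u) and the identity agree after g, hence also after I.
  · have h := hk _ (F.map v ≫ F.map u) (𝟙 _) (by rw [Category.assoc, hu, hv, Category.id_comp])
    rw [← hv, Category.assoc, hψ, ← Category.assoc, h, Category.id_comp]
  · rw [reassoc_of% hψ, hI, hu, Category.comp_id]

end CategoryTheory

namespace WeakBraidedBimonad

variable {A : Type u} [Category.{v} A] {B : WeakBraidedBimonad A}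

/-! ### Cofree mixed bimodules -/

/-- The cofree mixed bimodule on a module `(a, h)`; its underlying object splits `Γ` at `(a, h)`. -/
def cofreeMixed {a : A} {h : B.H.obj a ⟶ a} (ha : B.m a ≫ h = B.H.map h ≫ h)
    (P : IdempotentSplitting (B.gam h)) : B.MixedBimodule where
  pt := P.obj
  act := B.H.map P.i ≫ B.diag h ≫ P.p
  coact := P.i ≫ B.d a ≫ B.H.map P.p
  unit_act := by
    rw [← reassoc_of% B.e_nat, reassoc_of% B.e_diag, P.comp_p, P.i_p]
  mul_act := by
    simp only [Functor.map_comp, Category.assoc]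
    rw [← B.H.map_comp_assoc P.p, P.p_i, reassoc_of% B.map_gam_diag ha, ← reassoc_of% B.m_diag ha,
      reassoc_of% B.m_nat]
  coact_counit := by
    simp only [Category.assoc]
    rw [B.c_nat, reassoc_of% B.d_c, P.i_p]
  coact_comul := by
    simp only [Functor.map_comp, Category.assoc]
    rw [← B.H.map_comp_assoc P.p, P.p_i, ← reassoc_of% B.gam_d, reassoc_of% P.i_comp, B.d_nat,
      reassoc_of% B.d_coassoc]
  act_coact := by
    simp only [Functor.map_comp, Category.assoc]
    rw [reassoc_of% P.p_i, reassoc_of% B.diag_gam ha, reassoc_of% B.omega_nat,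
      ← B.H.map_comp_assoc (B.H.map P.p), ← B.H.map_comp P.p, P.p_i,
      ← B.H.map_comp_assoc (B.H.map (B.gam h)), B.map_gam_diag ha, reassoc_of% B.diag_d]

/-- The splitting of `Γ` at a free module. -/
def freeSplitting (G : IdempotentSplitting B.Gamma) (a : A) :
    IdempotentSplitting (B.gam (B.m a)) where
  obj := (Gbar G).obj a
  p := (pBar G).app a
  i := G.i.app (B.toMonad.free.obj a)
  p_i := gammaBar_pBar G a
  i_p := NatTrans.congr_app G.i_p (B.toMonad.free.obj a)

/-! ### Weak universality of p · σ. -/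

section universal

variable {a : A} (P : IdempotentSplitting (B.gam (B.m a)))

/-- The map `p · σ` from the mixed bimodule `K_ω(H(a))` to the cofree one on `H(a)`. -/
def sigmaHom : B.KOmega.obj (B.H.obj a) ⟶ cofreeMixed (B.m_assoc a).symm P where
  f := B.d (B.H.obj a) ≫ B.H.map (B.m a) ≫ P.p
  act_f := by
    have h := B.map_sigma_diag (B.m_assoc a).symm
    change B.m (B.H.obj a) ≫ B.d (B.H.obj a) ≫ B.H.map (B.m a) ≫ P.p =
      B.H.map (B.d (B.H.obj a) ≫ B.H.map (B.m a) ≫ P.p) ≫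
        B.H.map P.i ≫ B.diag (B.m a) ≫ P.p
    simp only [Functor.map_comp, Category.assoc] at h ⊢
    rw [← B.H.map_comp_assoc P.p, P.p_i, reassoc_of% B.map_gam_diag (B.m_assoc a).symm,
      reassoc_of% h]
  f_coact := by
    have h := B.sigma_gam (B.m_assoc a).symm
    change (B.d (B.H.obj a) ≫ B.H.map (B.m a) ≫ P.p) ≫ P.i ≫ B.d (B.H.obj a) ≫ B.H.map P.p =
      B.d (B.H.obj a) ≫ B.H.map (B.d (B.H.obj a) ≫ B.H.map (B.m a) ≫ P.p)
    simp only [Functor.map_comp, Category.assoc] at h ⊢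
    rw [reassoc_of% P.p_i, reassoc_of% h, reassoc_of% B.d_nat, reassoc_of% B.d_coassoc]

/-- The idempotent `insertNat` as an endomorphism of `K_ω(H(a))`. -/
def insertHom (B : WeakBraidedBimonad A) (a : A) :
    B.KOmega.obj (B.H.obj a) ⟶ B.KOmega.obj (B.H.obj a) where
  f := B.H.map (B.J a) ≫ B.m (B.H.obj a)
  act_f := by
    change B.m (B.H.obj a) ≫ B.H.map (B.J a) ≫ B.m (B.H.obj a) =
      B.H.map (B.H.map (B.J a) ≫ B.m (B.H.obj a)) ≫ B.m (B.H.obj a)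
    rw [Functor.map_comp, Category.assoc, B.m_assoc, reassoc_of% B.m_nat]
  f_coact := by
    change (B.H.map (B.J a) ≫ B.m (B.H.obj a)) ≫ B.d (B.H.obj a) =
      B.d (B.H.obj a) ≫ B.H.map (B.H.map (B.J a) ≫ B.m (B.H.obj a))
    rw [B.map_J_m]
    simp only [Functor.map_comp, Category.assoc]
    rw [B.d_nat, reassoc_of% B.d_nat, reassoc_of% B.d_coassoc]

theorem mixed_ext {M N : B.MixedBimodule} {f g : M ⟶ N} (h : f.f = g.f) : f = g :=
  MixedBimodule.Hom.ext h

/-- A module map out of a free module is determined by its restriction to the generators. -/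
theorem eq_map_e_comp {x n : A} {f : B.H.obj x ⟶ n} {h : B.H.obj n ⟶ n}
    (hf : B.m x ≫ f = B.H.map f ≫ h) : f = B.H.map (B.e x ≫ f) ≫ h := by
  rw [Functor.map_comp, Category.assoc, ← hf, reassoc_of% B.He_m]

/-- δ(1) = 1₁ ⊗ 1₂ is carried to 1₁ ⊗ 1₂f(1), so a linear and colinear map sends the generators of
K_ω(x) to coinvariants. -/
theorem e_comp_coinv {x n : A} {f : B.H.obj x ⟶ n} {h : B.H.obj n ⟶ n} {k : n ⟶ B.H.obj n}
    (hf : B.m x ≫ f = B.H.map f ≫ h) (hk : f ≫ k = B.d x ≫ B.H.map f) :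
    (B.e x ≫ f) ≫ k = (B.e x ≫ f) ≫ B.e n ≫ B.d n ≫ B.H.map h := by
  rw [Category.assoc, hk, Functor.congr_map B.H (eq_map_e_comp hf), Functor.map_comp,
    ← reassoc_of% B.d_nat, ← reassoc_of% B.e_nat, Category.assoc]

/-- Maps into the cofree mixed bimodule correspond to module maps into H(a) by composing with ε, and
module maps out of the free module H(x) are determined by their restriction u to generators. Under
these correspondences f arises from u through p · σ. -/
theorem sigmaHom_universal (x : A)
    (f : B.KOmega.obj x ⟶ cofreeMixed (B.m_assoc a).symm P) :
    ∃ u : x ⟶ B.H.obj a, B.KOmega.map u ≫ sigmaHom P = f := by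
  have ha := (B.m_assoc a).symm
  obtain ⟨f, h1, h2⟩ := f
  change B.H.obj x ⟶ P.obj at f
  change B.m x ≫ f = B.H.map f ≫ B.H.map P.i ≫ B.diag (B.m a) ≫ P.p at h1
  change f ≫ P.i ≫ B.d (B.H.obj a) ≫ B.H.map P.p = B.d x ≫ B.H.map f at h2
  -- Module linearity of f followed by ε; this is where `diag_c` enters.
  have h4 : B.m x ≫ f ≫ P.i ≫ B.c (B.H.obj a) =
      B.H.map (f ≫ P.i ≫ B.c (B.H.obj a)) ≫ B.m a := by
    rw [← Category.assoc, h1]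
    simp only [Category.assoc]
    rw [reassoc_of% P.p_i, reassoc_of% B.diag_gam ha, B.diag_c ha,
      ← B.H.map_comp_assoc P.i, reassoc_of% P.i_comp, ← B.H.map_comp_assoc]
  have h2' := h2 =≫ B.H.map (P.i ≫ B.c (B.H.obj a))
  simp only [Functor.map_comp, Category.assoc] at h2'
  refine ⟨B.e x ≫ f ≫ P.i ≫ B.c (B.H.obj a), mixed_ext ?_⟩
  change B.H.map (B.e x ≫ f ≫ P.i ≫ B.c (B.H.obj a)) ≫
    B.d (B.H.obj a) ≫ B.H.map (B.m a) ≫ P.p = f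
  rw [reassoc_of% B.d_nat, ← B.H.map_comp_assoc (B.H.map _), ← eq_map_e_comp h4]
  simp only [Functor.map_comp, Category.assoc]
  rw [← reassoc_of% h2', ← B.H.map_comp_assoc P.p, P.p_i, ← reassoc_of% B.gam_d,
    reassoc_of% P.i_comp, reassoc_of% B.d_Hc, P.i_p, Category.comp_id]

theorem insertHom_sigmaHom : insertHom B a ≫ sigmaHom P = sigmaHom P := by
  refine mixed_ext ?_
  change (B.H.map (B.J a) ≫ B.m (B.H.obj a)) ≫ B.d (B.H.obj a) ≫ B.H.map (B.m a) ≫ P.p =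
    B.d (B.H.obj a) ≫ B.H.map (B.m a) ≫ P.p
  have h := B.map_m_d (B.coinv_of_xiBar (B.J_xiBar a)) =≫ B.H.map (B.m a)
  simp only [Category.assoc] at h ⊢
  rw [reassoc_of% h, reassoc_of% B.d_nat, ← B.H.map_comp_assoc (B.m (B.H.obj a)), ← B.m_assoc,
    Functor.map_comp_assoc, ← B.H.map_comp_assoc (B.H.map (B.J a)), ← B.H.map_comp, B.J_m]
  simp

/-- Applying ε after p · σ recovers m, so w and w' agree after multiplication. On generators, which
are coinvariant, `casimir` shows that `insertNat` depends only on the product. -/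
theorem comp_insertHom_eq {x : A} {w w' : B.KOmega.obj x ⟶ B.KOmega.obj (B.H.obj a)}
    (h : w ≫ sigmaHom P = w' ≫ sigmaHom P) : w ≫ insertHom B a = w' ≫ insertHom B a := by
  have hs := B.sigma_gam (B.m_assoc a).symm
  have hc : B.d (B.H.obj a) ≫ B.H.map (B.m a) ≫ B.c (B.H.obj a) = B.m a := by
    rw [B.c_nat, reassoc_of% B.d_c]
  have hI : B.m (B.H.obj a) ≫ B.H.map (B.J a) ≫ B.m (B.H.obj a) =
      B.H.map (B.H.map (B.J a) ≫ B.m (B.H.obj a)) ≫ B.m (B.H.obj a) := (insertHom B a).act_f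
  obtain ⟨w, hw, hw2⟩ := w
  obtain ⟨w', hw', hw2'⟩ := w'
  change B.H.obj x ⟶ B.H.obj (B.H.obj a) at w
  change B.H.obj x ⟶ B.H.obj (B.H.obj a) at w'
  change B.m x ≫ w = B.H.map w ≫ B.m (B.H.obj a) at hw
  change B.m x ≫ w' = B.H.map w' ≫ B.m (B.H.obj a) at hw'
  change w ≫ B.d (B.H.obj a) = B.d x ≫ B.H.map w at hw2
  change w' ≫ B.d (B.H.obj a) = B.d x ≫ B.H.map w' at hw2'
  have h2 : w ≫ B.d (B.H.obj a) ≫ B.H.map (B.m a) ≫ P.p =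
      w' ≫ B.d (B.H.obj a) ≫ B.H.map (B.m a) ≫ P.p := congrArg MixedBimodule.Hom.f h
  have h1 : w ≫ B.m a = w' ≫ B.m a := by
    have h3 := h2 =≫ (P.i ≫ B.c (B.H.obj a))
    simp only [Category.assoc] at h3 hs
    rwa [reassoc_of% P.p_i, reassoc_of% hs, hc] at h3
  have key : ∀ {w : B.H.obj x ⟶ B.H.obj (B.H.obj a)},
      B.m x ≫ w = B.H.map w ≫ B.m (B.H.obj a) →
      w ≫ B.d (B.H.obj a) = B.d x ≫ B.H.map w →
      w ≫ B.H.map (B.J a) ≫ B.m (B.H.obj a) =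
        B.H.map (B.e x ≫ (w ≫ B.m a) ≫ B.J a) ≫ B.m (B.H.obj a) := by
    intro w hw hw2
    have h2 := B.casimir a (B.xiBar_of_coinv (e_comp_coinv hw hw2))
    simp only [Category.assoc] at h2 ⊢
    rw [← h2]
    exact eq_map_e_comp (by rw [reassoc_of% hw, hI, B.H.map_comp w, Category.assoc])
  refine mixed_ext ?_
  change w ≫ B.H.map (B.J a) ≫ B.m (B.H.obj a) = w' ≫ B.H.map (B.J a) ≫ B.m (B.H.obj a)
  rw [key hw hw2, key hw' hw2', h1]

end universal

/-- If the cofree mixed bimodules on free modules are presented by `K_ω`, there is an antipode. -/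
theorem isWeakHopf_of_isPresentedBy [IsIdempotentComplete A]
    (hK : ∀ M : B.MixedBimodule, IsPresentedBy B.KOmega M) : B.IsWeakHopf := by
  obtain ⟨G⟩ := B.nonempty_splitting_Gamma
  have h : ∀ a, ∃ ψ, sigmaHom (freeSplitting G a) ≫ ψ = insertHom B a ∧
      ψ ≫ sigmaHom (freeSplitting G a) = 𝟙 _ := fun a =>
    (hK _).exists_section (sigmaHom_universal _) (insertHom_sigmaHom _)
      fun _ _ _ => comp_insertHom_eq _
  choose ψ h1 h2 using h
  let p : ∀ a, B.H.obj (B.H.obj a) ⟶ (Gbar G).obj a := fun a => (pBar G).app a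
  let i : ∀ a, (Gbar G).obj a ⟶ B.H.obj (B.H.obj a) := fun a => (freeSplitting G a).i
  let f : ∀ a, (Gbar G).obj a ⟶ B.H.obj (B.H.obj a) := fun a => (ψ a).f
  have hp : ∀ {a b : A} (k : a ⟶ b), B.H.map (B.H.map k) ≫ p b = p a ≫ (Gbar G).map k :=
    fun k => (pBar G).naturality k
  have hpi : ∀ a, p a ≫ i a = B.gam (B.m a) := fun a => (freeSplitting G a).p_i
  have hs : ∀ {a b : A} (k : a ⟶ b), B.H.map (B.H.map k) ≫ B.d (B.H.obj b) ≫ B.H.map (B.m b) =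
      (B.d (B.H.obj a) ≫ B.H.map (B.m a)) ≫ B.H.map (B.H.map k) := fun k => B.sigma.naturality k
  have hI : ∀ {a b : A} (k : a ⟶ b), B.H.map (B.H.map k) ≫ B.H.map (B.J b) ≫ B.m (B.H.obj b) =
      (B.H.map (B.J a) ≫ B.m (B.H.obj a)) ≫ B.H.map (B.H.map k) :=
    fun k => (insertNat B).naturality k
  have h3 : ∀ a, (B.d (B.H.obj a) ≫ B.H.map (B.m a) ≫ p a) ≫ f a =
      B.H.map (B.J a) ≫ B.m (B.H.obj a) := fun a => congrArg MixedBimodule.Hom.f (h1 a)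
  have h4 : ∀ a, f a ≫ B.d (B.H.obj a) ≫ B.H.map (B.m a) ≫ p a = 𝟙 ((Gbar G).obj a) :=
    fun a => congrArg MixedBimodule.Hom.f (h2 a)
  have hσ : ∀ a, (B.d (B.H.obj a) ≫ B.H.map (B.m a)) ≫ B.gam (B.m a) =
    B.d (B.H.obj a) ≫ B.H.map (B.m a) := fun a => B.sigma_gam (B.m_assoc a).symm
  simp only [Category.assoc] at hs hI h3 hσ
  -- The sections ψ come from separate choices, but p · σ is natural and they split it, so they are
  -- natural after cancelling p · σ against its section, using that σ ≫ p ≫ ψ is the natural map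
  -- `insertNat`.
  have hf : ∀ {a b : A} (k : a ⟶ b),
      (Gbar G).map k ≫ f b = f a ≫ B.H.map (B.H.map k) := by
    intro a b k
    have e : f a ≫ B.d (B.H.obj a) ≫ B.H.map (B.m a) ≫ p a ≫ (Gbar G).map k ≫ f b =
        f a ≫ B.d (B.H.obj a) ≫ B.H.map (B.m a) ≫ p a ≫ f a ≫ B.H.map (B.H.map k) := by
      rw [← reassoc_of% hp, ← reassoc_of% hs, h3, hI, reassoc_of% h3]
    rwa [reassoc_of% h4, reassoc_of% h4] at e
  refine isWeakHopf_iff_exists_galoisInverse.2 ⟨{ app := fun a => p a ≫ f a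
                                                  naturality := fun a b k => ?_ }, ?_, ?_, ?_⟩
  · change B.H.map (B.H.map k) ≫ p b ≫ f b = (p a ≫ f a) ≫ B.H.map (B.H.map k)
    rw [reassoc_of% hp, hf, Category.assoc]
  · ext a
    exact (Category.assoc _ _ _).trans (h3 a)
  · ext a
    rw [gammaBar_app]
    change (p a ≫ f a) ≫ B.d (B.H.obj a) ≫ B.H.map (B.m a) = _
    rw [← hσ, ← hpi, Category.assoc, reassoc_of% h4]
  · ext a
    change (p a ≫ f a) ≫ (B.d (B.H.obj a) ≫ B.H.map (B.m a)) ≫ p a ≫ f a = p a ≫ f a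
    simp only [Category.assoc]
    rw [reassoc_of% h4]

/-! ### Passage to the opposite bimonad. -/

/-- Mixed bimodules over the opposite bimonad are mixed bimodules in the opposite category. -/
def unopFunctor (B : WeakBraidedBimonad A) : B.op.MixedBimodule ⥤ B.MixedBimoduleᵒᵖ where
  obj M := Opposite.op
    { pt := M.pt.unop
      act := M.coact.unop
      coact := M.act.unop
      unit_act := congrArg Quiver.Hom.unop M.coact_counit
      mul_act := congrArg Quiver.Hom.unop M.coact_comul
      coact_counit := congrArg Quiver.Hom.unop M.unit_act
      coact_comul := congrArg Quiver.Hom.unop M.mul_act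
      act_coact := by
        refine (congrArg Quiver.Hom.unop M.act_coact).trans ((Category.assoc _ _ _).trans ?_)
        exact congrArg (fun w => B.H.map M.act.unop ≫ w ≫ B.H.map M.coact.unop)
          (Category.assoc _ _ _) }
  map f := Quiver.Hom.op
    { f := f.f.unop
      act_f := congrArg Quiver.Hom.unop f.f_coact
      f_coact := congrArg Quiver.Hom.unop f.act_f }

instance (B : WeakBraidedBimonad A) : B.unopFunctor.Faithful where
  map_injective {M N _ _} h := MixedBimodule.Hom.ext
    (congrArg (fun k : B.unopFunctor.obj M ⟶ B.unopFunctor.obj N => k.unop.f.op) h)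

instance (B : WeakBraidedBimonad A) : B.unopFunctor.Full where
  map_surjective g :=
    ⟨{ f := g.unop.f.op
       act_f := congrArg Quiver.Hom.op g.unop.f_coact
       f_coact := congrArg Quiver.Hom.op g.unop.act_f }, rfl⟩

/-- Under `unopFunctor` the functor K_ω of the opposite bimonad is the opposite of K_ω by
definition. -/
theorem isWeakHopf_of_isPresentedBy_op [IsIdempotentComplete A]
    (hK : ∀ M : B.MixedBimodule, IsPresentedBy B.KOmega.op (Opposite.op M)) : B.IsWeakHopf := by
  refine B.isWeakHopf_of_op (isWeakHopf_of_isPresentedBy fun M => ?_)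
  exact IsPresentedBy.of_comp (F := B.op.KOmega) (Φ := B.unopFunctor)
    (hK (B.unopFunctor.obj M).unop)

end WeakBraidedBimonad

namespace WeakBraidedBimonad

variable {A : Type u} [Category.{v} A] {B : WeakBraidedBimonad A}

/-! ### The fundamental theorem -/

/-- The comparison theorems split idempotents among mixed bimodules; the action and coaction are
carried along a splitting in the base. -/
instance [IsIdempotentComplete A] : IsIdempotentComplete B.MixedBimodule where
  idempotents_split M f hf := by
    obtain ⟨⟨Y, p, i, hp, hi⟩⟩ := IdempotentSplitting.nonempty_of_idem f.f
      (congrArg MixedBimodule.Hom.f hf)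
    have hpf : f.f ≫ p = p := by rw [← hp, Category.assoc, hi, Category.comp_id]
    have hif : i ≫ f.f = i := by rw [← hp, reassoc_of% hi]
    refine ⟨{ pt := Y
              act := B.H.map i ≫ M.act ≫ p
              coact := i ≫ M.coact ≫ B.H.map p
              unit_act := ?_
              mul_act := ?_
              coact_counit := ?_
              coact_comul := ?_
              act_coact := ?_ },
      { f := i, act_f := ?_, f_coact := ?_ }, { f := p, act_f := ?_, f_coact := ?_ },
      mixed_ext hi, mixed_ext hp⟩
    · rw [← reassoc_of% B.e_nat, reassoc_of% M.unit_act, hi]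
    · simp only [Functor.map_comp, Category.assoc]
      rw [← B.H.map_comp_assoc p, hp, ← reassoc_of% f.act_f, hpf, ← reassoc_of% M.mul_act,
        reassoc_of% B.m_nat]
    · simp only [Category.assoc]
      rw [B.c_nat, reassoc_of% M.coact_counit, hi]
    · simp only [Functor.map_comp, Category.assoc]
      rw [← B.H.map_comp_assoc p, hp, ← reassoc_of% f.f_coact, reassoc_of% hif, B.d_nat,
        reassoc_of% M.coact_comul]
    · simp only [Functor.map_comp, Category.assoc]
      rw [reassoc_of% hp, reassoc_of% f.f_coact, ← B.H.map_comp f.f, hpf,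
        reassoc_of% M.act_coact, reassoc_of% B.omega_nat, ← B.H.map_comp_assoc (B.H.map p),
        ← B.H.map_comp p, hp,
        ← B.H.map_comp_assoc (B.H.map f.f), ← f.act_f, Functor.map_comp_assoc, ← B.H.map_comp f.f, hpf]
    · simp only [Category.assoc]
      rw [hp, f.act_f, ← B.H.map_comp_assoc, hif]
    · simp only [Category.assoc]
      rw [← B.H.map_comp, hp, ← f.f_coact, reassoc_of% hif]
    · change M.act ≫ p = B.H.map p ≫ B.H.map i ≫ M.act ≫ p
      rw [← B.H.map_comp_assoc, hp, ← reassoc_of% f.act_f, hpf]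
    · change p ≫ i ≫ M.coact ≫ B.H.map p = M.coact ≫ B.H.map p
      rw [reassoc_of% hp, reassoc_of% f.f_coact, ← B.H.map_comp, hpf]

variable (B) in
/-- The forgetful functor from mixed bimodules. -/
def mixedForget : B.MixedBimodule ⥤ A where
  obj M := M.pt
  map f := f.f

/-- The map `v ↦ 1₁ ⊗ 1₂ v`. -/
def unitCoact (M : B.MixedBimodule) : M.pt ⟶ B.H.obj M.pt :=
  B.e M.pt ≫ B.d M.pt ≫ B.H.map M.act

theorem map_unitCoact_diag (M : B.MixedBimodule) :
    B.H.map (unitCoact M) ≫ B.diag M.act = B.d M.pt ≫ B.H.map M.act :=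
  B.map_unit_diag M.mul_act

/-- `θ ≫ S ≫ h`, the map `v ↦ S(v₍₋₁₎) v₍₀₎`. -/
def coinvIdem (S : B.H ⟶ B.H) : B.mixedForget ⟶ B.mixedForget where
  app M := M.coact ≫ S.app M.pt ≫ M.act
  naturality M N f := by
    change f.f ≫ N.coact ≫ S.app N.pt ≫ N.act = (M.coact ≫ S.app M.pt ≫ M.act) ≫ f.f
    simp only [Category.assoc]
    rw [reassoc_of% f.f_coact, f.act_f, reassoc_of% app_nat]

section fundamental

variable {S : B.H ⟶ B.H} (hS : B.IsWeakAntipode S)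

section

variable (M : B.MixedBimodule)

/-- The component of `coinvIdem` at `M`. -/
def coinvMap (S : B.H ⟶ B.H) (M : B.MixedBimodule) : M.pt ⟶ M.pt :=
  M.coact ≫ S.app M.pt ≫ M.act

variable {M}

include hS

/-- S(1₁)1₂v = ξ̄(1)v = v. -/
theorem coinvMap_of_coinv {X : A} {f : X ⟶ M.pt} (hf : f ≫ M.coact = f ≫ unitCoact M) :
    f ≫ coinvMap S M = f := by
  rw [coinvMap, reassoc_of% hf, unitCoact]
  simp only [Category.assoc]
  rw [reassoc_of% app_nat, ← M.mul_act, reassoc_of% hS.d_app_m, reassoc_of% B.e_xiBar, M.unit_act,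
    Category.comp_id]

variable (M)

/-- v₋₂S(v₋₁)v₀ = ξ(v₋₁)v₀, and this is ε applied to the coaction of 1 · v. -/
theorem coact_map_coinvMap_act : M.coact ≫ B.H.map (coinvMap S M) ≫ M.act = 𝟙 _ := by
  simp only [coinvMap, Functor.map_comp, Category.assoc]
  rw [← reassoc_of% M.coact_comul, ← M.mul_act, reassoc_of% hS.d_map_m]
  simp only [xi, alpha, Category.assoc]
  rw [← B.c_nat, reassoc_of% B.e_nat, ← reassoc_of% M.act_coact, reassoc_of% M.unit_act,
    M.coact_counit]

theorem coact_map_coinvMap_xiBar_act :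
    M.coact ≫ B.H.map (coinvMap S M) ≫ B.xiBar M.pt ≫ M.act = coinvMap S M := by
  simp only [coinvMap, Functor.map_comp, Category.assoc]
  rw [← reassoc_of% M.coact_comul, reassoc_of% B.xiBar_nat, ← M.mul_act,
    reassoc_of% hS.d_map_xiBar_m]

/-- Expands ξ̄ as S * 1, so that the left side depends on r only through v ↦ v₋₁ · r(v₀), the action
being diagonal. -/
theorem xiBar_diag {r : M.pt ⟶ B.H.obj M.pt} :
    M.coact ≫ B.H.map r ≫ B.xiBar (B.H.obj M.pt) ≫ B.diag M.act =
      M.coact ≫ B.H.map (M.coact ≫ B.H.map r ≫ B.diag M.act) ≫ S.app (B.H.obj M.pt) ≫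
        B.diag M.act := by
  rw [← hS.d_app_m]
  simp only [Category.assoc]
  rw [B.m_diag M.mul_act, ← reassoc_of% app_nat, reassoc_of% B.d_nat, reassoc_of% M.coact_comul]
  simp only [Functor.map_comp, Category.assoc]

/-- Both sides are maps r with r(v) = ξ̄(v₋₁) · r(v₀) and with v₋₁ · r(v₀) equal to the coaction of
v. By `xiBar_diag` these two properties determine r. -/
theorem coinvMap_coact : coinvMap S M ≫ M.coact = coinvMap S M ≫ unitCoact M := by
  have hact : M.act ≫ M.coact = B.H.map M.coact ≫ B.diag M.act := M.act_coact
  have h0 : M.coact ≫ B.H.map (coinvMap S M ≫ M.coact) ≫ B.diag M.act = M.coact := by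
    rw [Functor.map_comp, Category.assoc, ← hact, reassoc_of% coact_map_coinvMap_act hS]
  have h1 : coinvMap S M ≫ M.coact =
      M.coact ≫ B.H.map M.coact ≫ S.app (B.H.obj M.pt) ≫ B.diag M.act := by
    conv_lhs => lhs; rw [← coact_map_coinvMap_xiBar_act hS]
    simp only [Category.assoc]
    rw [hact, ← reassoc_of% B.xiBar_nat, ← B.H.map_comp_assoc, xiBar_diag hS, h0]
  have h2 : B.xiBar M.pt ≫ M.act ≫ unitCoact M =
      B.xiBar M.pt ≫ B.H.map (unitCoact M) ≫ B.diag M.act := by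
    rw [map_unitCoact_diag, reassoc_of% B.xiBar_d]
    simp only [unitCoact]
    rw [reassoc_of% B.e_nat, reassoc_of% B.d_nat, ← B.H.map_comp, ← B.H.map_comp, M.mul_act]
  have h3 : M.coact ≫ B.H.map (coinvMap S M ≫ unitCoact M) ≫ B.diag M.act = M.coact := by
    rw [Functor.map_comp, Category.assoc, map_unitCoact_diag, reassoc_of% B.d_nat,
      reassoc_of% M.coact_comul, ← B.H.map_comp, ← B.H.map_comp, coact_map_coinvMap_act hS,
      B.H.map_id, Category.comp_id]
  rw [h1]
  conv_rhs => lhs; rw [← coact_map_coinvMap_xiBar_act hS]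
  simp only [Category.assoc]
  rw [h2, ← reassoc_of% B.xiBar_nat, ← B.H.map_comp_assoc, xiBar_diag hS, h3]

theorem coinvIdem_idem : coinvIdem S ≫ coinvIdem S = coinvIdem S := by
  ext M
  exact coinvMap_of_coinv hS (coinvMap_coact hS M)

/-- Here the idempotent is S * 1; this later identifies the generated monad with H^ξ̄. -/
theorem coinvMap_KOmega (a : A) : coinvMap S (B.KOmega.obj a) = B.xiBar a := hS.d_app_m a

end

/-! The coinvariants functor `R` splits `coinvIdem`. -/

variable (R : IdempotentSplitting (coinvIdem S))

/-- The inclusion of the coinvariants. -/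
def coinvInc (M : B.MixedBimodule) : R.obj.obj M ⟶ M.pt := R.i.app M

/-- The projection onto the coinvariants. -/
def coinvProj (M : B.MixedBimodule) : M.pt ⟶ R.obj.obj M := R.p.app M

theorem coinvProj_inc (M : B.MixedBimodule) : coinvProj R M ≫ coinvInc R M = coinvMap S M :=
  NatTrans.congr_app R.p_i M

theorem coinvInc_proj (M : B.MixedBimodule) : coinvInc R M ≫ coinvProj R M = 𝟙 _ :=
  NatTrans.congr_app R.i_p M

theorem coinvInc_nat {M N : B.MixedBimodule} (f : M ⟶ N) :
    R.obj.map f ≫ coinvInc R N = coinvInc R M ≫ f.f := R.i.naturality f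

theorem coinvProj_nat {M N : B.MixedBimodule} (f : M ⟶ N) :
    f.f ≫ coinvProj R N = coinvProj R M ≫ R.obj.map f := R.p.naturality f

theorem coinvInc_map (M : B.MixedBimodule) : coinvInc R M ≫ coinvMap S M = coinvInc R M := by
  rw [← coinvProj_inc R, reassoc_of% coinvInc_proj R]

include hS in
theorem coinvInc_coact (M : B.MixedBimodule) :
    coinvInc R M ≫ M.coact = coinvInc R M ≫ unitCoact M := by
  rw [← coinvInc_map, Category.assoc, coinvMap_coact hS, Category.assoc]

/-- The natural map `K_ω R M ⟶ M`. -/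
def coinvCounit : R.obj ⋙ B.KOmega ⟶ 𝟭 B.MixedBimodule where
  app M :=
    { f := B.H.map (coinvInc R M) ≫ M.act
      act_f := by
        change B.m _ ≫ B.H.map (coinvInc R M) ≫ M.act =
          B.H.map (B.H.map (coinvInc R M) ≫ M.act) ≫ M.act
        rw [Functor.map_comp, Category.assoc, ← M.mul_act, reassoc_of% B.m_nat]
      f_coact := by
        change (B.H.map (coinvInc R M) ≫ M.act) ≫ M.coact =
          B.d _ ≫ B.H.map (B.H.map (coinvInc R M) ≫ M.act)
        have hact : M.act ≫ M.coact = B.H.map M.coact ≫ B.diag M.act := M.act_coact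
        rw [Category.assoc, hact, ← B.H.map_comp_assoc, coinvInc_coact hS, Functor.map_comp,
          Category.assoc, map_unitCoact_diag, reassoc_of% B.d_nat, Functor.map_comp] }
  naturality M N f := by
    refine mixed_ext ?_
    change B.H.map (R.obj.map f) ≫ B.H.map (coinvInc R N) ≫ N.act =
      (B.H.map (coinvInc R M) ≫ M.act) ≫ f.f
    rw [← B.H.map_comp_assoc, coinvInc_nat, Category.assoc, f.act_f, Functor.map_comp_assoc]

include hS in
theorem map_coinvInc_act_coact (M : B.MixedBimodule) :
    B.H.map (coinvInc R M) ≫ M.act ≫ M.coact =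
      B.H.map (coinvInc R M) ≫ B.d M.pt ≫ B.H.map M.act := by
  have hact : M.act ≫ M.coact = B.H.map M.coact ≫ B.diag M.act := M.act_coact
  rw [hact, ← B.H.map_comp_assoc, coinvInc_coact hS, Functor.map_comp, Category.assoc,
    map_unitCoact_diag]

include hS in
-- For a coinvariant v, the element xv has coaction x₁ ⊗ x₂v, and S(x₁)x₂v = ξ̄(x)v.
theorem map_coinvInc_act_coinvMap (M : B.MixedBimodule) :
    B.H.map (coinvInc R M) ≫ M.act ≫ coinvMap S M =
      B.H.map (coinvInc R M) ≫ B.xiBar M.pt ≫ M.act := by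
  rw [coinvMap, reassoc_of% map_coinvInc_act_coact hS, reassoc_of% app_nat,
    ← M.mul_act,
    reassoc_of% hS.d_app_m]

include hS in
-- Writing x1₁ ⊗ ξ̄(1₂) for x₁ ⊗ ξ̄(x₂) makes left linearity in x visible.
theorem map_coinvInc_act_coact_coinvMap (M : B.MixedBimodule) :
    B.H.map (coinvInc R M) ≫ M.act ≫ M.coact ≫ B.H.map (coinvMap S M) =
      B.H.map (coinvInc R M) ≫ B.L M.pt ≫ B.H.map (B.xiBar M.pt) ≫ B.H.map M.act := by
  rw [reassoc_of% map_coinvInc_act_coact hS, reassoc_of% B.d_nat, ← B.H.map_comp, ← B.H.map_comp,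
    map_coinvInc_act_coinvMap hS, Functor.map_comp, ← reassoc_of% B.d_nat, Functor.map_comp,
    reassoc_of% B.L_map_xiBar]

theorem m_L (a : A) : B.m a ≫ B.L a = B.H.map (B.L a) ≫ B.m (B.H.obj a) := by
  simp only [L, Functor.map_comp, Category.assoc]
  rw [B.m_assoc, reassoc_of% B.m_nat, reassoc_of% B.m_nat]

include hS in
theorem act_coact_coinvProj (M : B.MixedBimodule) :
    M.act ≫ M.coact ≫ B.H.map (coinvProj R M) =
      B.H.map (M.coact ≫ B.H.map (coinvProj R M)) ≫ B.m (R.obj.obj M) := by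
  obtain ⟨s, hs⟩ : ∃ s, s = M.coact ≫ B.H.map (coinvProj R M) := ⟨_, rfl⟩
  -- Q is the idempotent of H(R(M)) with image M: multiply out, then apply s. Linearity of s reduces
  -- to linearity of Q, because s ≫ Q = s and every element xv of M is the image of x · s(v).
  obtain ⟨Q, hQ⟩ : ∃ Q, Q = B.H.map (coinvInc R M) ≫ M.act ≫ s := ⟨_, rfl⟩
  have h1 : s ≫ B.H.map (coinvInc R M) ≫ M.act = 𝟙 _ := by
    rw [hs, Category.assoc, ← B.H.map_comp_assoc, coinvProj_inc, coact_map_coinvMap_act hS]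
  have h2 : Q ≫ B.H.map (coinvInc R M) =
      B.H.map (coinvInc R M) ≫ B.L M.pt ≫ B.H.map (B.xiBar M.pt) ≫ B.H.map M.act := by
    rw [← map_coinvInc_act_coact_coinvMap hS, hQ, hs, ← coinvProj_inc R]
    simp only [Functor.map_comp, Category.assoc]
  have h3 : B.m (R.obj.obj M) ≫ Q = B.H.map Q ≫ B.m (R.obj.obj M) := by
    have h4 : (B.m (R.obj.obj M) ≫ Q) ≫ B.H.map (coinvInc R M) =
        (B.H.map Q ≫ B.m (R.obj.obj M)) ≫ B.H.map (coinvInc R M) := by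
      rw [Category.assoc, Category.assoc, h2, ← B.m_nat, ← B.H.map_comp_assoc, h2,
        ← reassoc_of% B.m_nat, reassoc_of% m_L]
      simp only [Functor.map_comp, Category.assoc]
      rw [B.m_nat, reassoc_of% B.m_nat]
    have h5 := h4 =≫ B.H.map (coinvProj R M)
    simpa only [Category.assoc, ← B.H.map_comp, coinvInc_proj, B.H.map_id, Category.comp_id]
      using h5
  have h4 : s ≫ Q = s := by rw [hQ, reassoc_of% h1]
  have h5 : M.act = B.H.map s ≫ B.m _ ≫ B.H.map (coinvInc R M) ≫ M.act := by
    rw [← reassoc_of% B.m_nat, M.mul_act, ← B.H.map_comp_assoc, ← B.H.map_comp_assoc,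
      Category.assoc, h1, B.H.map_id, Category.id_comp]
  rw [← hs, h5]
  simp only [Category.assoc]
  rw [← hQ, h3, ← B.H.map_comp_assoc, h4]

/-- The natural section `M ⟶ K_ω R M` of `coinvCounit`. -/
def coinvSection : 𝟭 B.MixedBimodule ⟶ R.obj ⋙ B.KOmega where
  app M :=
    { f := M.coact ≫ B.H.map (coinvProj R M)
      act_f := act_coact_coinvProj hS R M
      f_coact := by
        change (M.coact ≫ B.H.map (coinvProj R M)) ≫ B.d _ =
          M.coact ≫ B.H.map (M.coact ≫ B.H.map (coinvProj R M))
        rw [Category.assoc, B.d_nat, reassoc_of% M.coact_comul, Functor.map_comp] }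
  naturality M N f := by
    refine mixed_ext ?_
    change f.f ≫ N.coact ≫ B.H.map (coinvProj R N) =
      (M.coact ≫ B.H.map (coinvProj R M)) ≫ B.H.map (R.obj.map f)
    rw [reassoc_of% f.f_coact, Category.assoc, ← B.H.map_comp, ← B.H.map_comp, coinvProj_nat]

theorem coinvSection_counit : coinvSection hS R ≫ coinvCounit hS R = 𝟙 _ := by
  ext M
  refine mixed_ext ?_
  change (M.coact ≫ B.H.map (coinvProj R M)) ≫ B.H.map (coinvInc R M) ≫ M.act = 𝟙 _
  rw [Category.assoc, ← B.H.map_comp_assoc, coinvProj_inc, coact_map_coinvMap_act hS]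

/-! The coinvariants of `K_ω(x)`. -/

/-- The inclusion of the coinvariants of `K_ω(x)` into `H(x)`. -/
def freeInc (x : A) : R.obj.obj (B.KOmega.obj x) ⟶ B.H.obj x := coinvInc R (B.KOmega.obj x)

/-- The projection of `H(x)` onto the coinvariants of `K_ω(x)`. -/
def freeProj (x : A) : B.H.obj x ⟶ R.obj.obj (B.KOmega.obj x) := coinvProj R (B.KOmega.obj x)

include hS in
theorem freeProj_inc (x : A) : freeProj R x ≫ freeInc R x = B.xiBar x :=
  (coinvProj_inc R (B.KOmega.obj x)).trans (coinvMap_KOmega hS x)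

theorem freeInc_proj (x : A) : freeInc R x ≫ freeProj R x = 𝟙 _ :=
  coinvInc_proj R (B.KOmega.obj x)

include hS in
theorem freeInc_xiBar (x : A) : freeInc R x ≫ B.xiBar x = freeInc R x := by
  rw [← freeProj_inc hS R, reassoc_of% freeInc_proj]

theorem freeInc_nat {x y : A} (f : x ⟶ y) :
    R.obj.map (B.KOmega.map f) ≫ freeInc R y = freeInc R x ≫ B.H.map f :=
  coinvInc_nat R (B.KOmega.map f)

theorem freeProj_nat {x y : A} (f : x ⟶ y) :
    B.H.map f ≫ freeProj R y = freeProj R x ≫ R.obj.map (B.KOmega.map f) :=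
  coinvProj_nat R (B.KOmega.map f)

theorem map_section_freeInc (M : B.MixedBimodule) :
    R.obj.map ((coinvSection hS R).app M) ≫ freeInc R (R.obj.obj M) =
      coinvInc R M ≫ M.coact ≫ B.H.map (coinvProj R M) :=
  coinvInc_nat R ((coinvSection hS R).app M)

theorem freeProj_map_counit (M : B.MixedBimodule) :
    freeProj R (R.obj.obj M) ≫ R.obj.map ((coinvCounit hS R).app M) =
      (B.H.map (coinvInc R M) ≫ M.act) ≫ coinvProj R M :=
  (coinvProj_nat R ((coinvCounit hS R).app M)).symm

theorem map_counit_freeInc (x : A) :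
    R.obj.map ((coinvCounit hS R).app (B.KOmega.obj x)) ≫ freeInc R x =
      freeInc R (R.obj.obj (B.KOmega.obj x)) ≫ B.H.map (freeInc R x) ≫ B.m x :=
  coinvInc_nat R ((coinvCounit hS R).app (B.KOmega.obj x))

/-- The functor `K_ω` is left adjoint to the coinvariants. -/
def coinvAdjRight : B.KOmega ⊣ R.obj :=
  Adjunction.mkOfUnitCounit
    { unit :=
        { app := fun x => B.e x ≫ freeProj R x
          naturality := fun x y f => by
            change f ≫ B.e y ≫ freeProj R y =
              (B.e x ≫ freeProj R x) ≫ R.obj.map (B.KOmega.map f)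
            rw [reassoc_of% B.e_nat, Category.assoc, freeProj_nat] }
      counit := coinvCounit hS R
      left_triangle := by
        ext x
        refine mixed_ext ?_
        change B.H.map (B.e x ≫ freeProj R x) ≫ 𝟙 _ ≫ B.H.map (freeInc R x) ≫ B.m x = 𝟙 _
        rw [Category.id_comp, ← B.H.map_comp_assoc, Category.assoc, freeProj_inc hS, B.e_xiBar,
          B.He_m]
      right_triangle := by
        ext M
        change (B.e (R.obj.obj M) ≫ freeProj R (R.obj.obj M)) ≫ 𝟙 _ ≫
          R.obj.map ((coinvCounit hS R).app M) = 𝟙 (R.obj.obj M)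
        refine (congrArg (_ ≫ ·) (Category.id_comp _)).trans ((Category.assoc _ _ _).trans ?_)
        rw [freeProj_map_counit, Category.assoc, ← reassoc_of% B.e_nat, reassoc_of% M.unit_act,
          coinvInc_proj] }

/-- The functor `K_ω` is right adjoint to the coinvariants. -/
def coinvAdjLeft : R.obj ⊣ B.KOmega :=
  Adjunction.mkOfUnitCounit
    { unit := coinvSection hS R
      counit :=
        { app := fun x => freeInc R x ≫ B.c x
          naturality := fun x y f => by
            change R.obj.map (B.KOmega.map f) ≫ freeInc R y ≫ B.c y = (freeInc R x ≫ B.c x) ≫ f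
            rw [reassoc_of% freeInc_nat, Category.assoc, B.c_nat] }
      left_triangle := by
        ext M
        change R.obj.map ((coinvSection hS R).app M) ≫ 𝟙 _ ≫
          freeInc R (R.obj.obj M) ≫ B.c (R.obj.obj M) = 𝟙 (R.obj.obj M)
        refine (congrArg (_ ≫ ·) (Category.id_comp _)).trans ?_
        refine (Category.assoc _ _ _).symm.trans
          ((congrArg (· ≫ B.c (R.obj.obj M)) (map_section_freeInc hS R M)).trans ?_)
        simp only [Category.assoc]
        rw [B.c_nat, reassoc_of% M.coact_counit, coinvInc_proj]
      right_triangle := by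
        ext x
        refine mixed_ext ?_
        change (B.d x ≫ B.H.map (freeProj R x)) ≫ 𝟙 _ ≫ B.H.map (freeInc R x ≫ B.c x) = 𝟙 _
        rw [Category.id_comp, Category.assoc, ← B.H.map_comp, reassoc_of% freeProj_inc hS,
          B.xiBar_c, B.d_Hc] }

/-- The monad generated by `K_ω` and the coinvariants is `H^ξ̄`. -/
def coinvMonadIso (E : IdempotentSplitting B.xiBarNat) :
    (coinvAdjRight hS R).toMonad ≅ xiMonad E :=
  MonadIso.mk
    (NatIso.ofComponents (F := B.KOmega ⋙ R.obj) (G := E.obj) (fun x =>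
      { hom := freeInc R x ≫ proj E x
        inv := inc E x ≫ freeProj R x
        hom_inv_id := by
          rw [Category.assoc, reassoc_of% proj_inc, reassoc_of% freeInc_xiBar hS, freeInc_proj]
          rfl
        inv_hom_id := by
          rw [Category.assoc, reassoc_of% freeProj_inc hS, reassoc_of% inc_xiBar, inc_proj] })
      (fun {x y} f => by
        change R.obj.map (B.KOmega.map f) ≫ freeInc R y ≫ proj E y =
          (freeInc R x ≫ proj E x) ≫ E.obj.map f
        rw [reassoc_of% freeInc_nat, Category.assoc, proj_nat]))
    (fun x => by
      change (B.e x ≫ freeProj R x) ≫ freeInc R x ≫ proj E x = B.e x ≫ proj E x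
      rw [Category.assoc, reassoc_of% freeProj_inc hS, reassoc_of% B.e_xiBar])
    (fun x => by
      change R.obj.map ((coinvCounit hS R).app (B.KOmega.obj x)) ≫ freeInc R x ≫ proj E x =
        (R.obj.map (B.KOmega.map (freeInc R x ≫ proj E x)) ≫
          freeInc R (E.obj.obj x) ≫ proj E (E.obj.obj x)) ≫
            inc E (E.obj.obj x) ≫ B.H.map (inc E x) ≫ B.m x ≫ proj E x
      refine (Category.assoc _ _ _).symm.trans
        ((congrArg (· ≫ proj E x) (map_counit_freeInc hS R x)).trans ?_)
      simp only [Category.assoc]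
      rw [reassoc_of% freeInc_nat, reassoc_of% proj_inc, reassoc_of% B.xiBar_nat,
        reassoc_of% freeInc_xiBar hS, ← B.H.map_comp_assoc, Category.assoc, proj_inc,
        freeInc_xiBar hS])

end fundamental

end WeakBraidedBimonad

theorem theorem7p7 {A : Type u} [Category.{v} A] [IsIdempotentComplete A]
    (B : WeakBraidedBimonad A)
    (E : IdempotentSplitting B.xiBarNat)
    (G : IdempotentSplitting B.Gamma)
    (T : IdempotentSplitting B.GammaCo) :
    List.TFAE
      [B.IsWeakHopf,
        B.KOmega.IsRightAdjoint ∧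
          ∃ (R : B.MixedBimodule ⥤ A) (adj : B.KOmega ⊣ R),
            (Monad.comparison adj).IsEquivalence,
        B.KOmega.IsLeftAdjoint ∧
          ∃ (L : B.MixedBimodule ⥤ A) (adj : L ⊣ B.KOmega),
            (Comonad.comparison adj).IsEquivalence,
        IsIso (WeakBraidedBimonad.gamma E G),
        IsIso (WeakBraidedBimonad.gammaCo E T)] ∧
    (B.IsWeakHopf →
      Nonempty ((WeakBraidedBimonad.xiMonad E).Algebra ≌ B.MixedBimodule)) := by
  have split : ∀ {S : B.H ⟶ B.H}, B.IsWeakAntipode S →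
      Nonempty (IdempotentSplitting (WeakBraidedBimonad.coinvIdem S)) := fun hS =>
    IdempotentSplitting.nonempty_of_idem _ (WeakBraidedBimonad.coinvIdem_idem hS)
  constructor
  · tfae_have 1 → 2 := by
      rintro ⟨S, hS⟩
      obtain ⟨R⟩ := split hS
      exact ⟨⟨R.obj, ⟨WeakBraidedBimonad.coinvAdjLeft hS R⟩⟩, R.obj,
        WeakBraidedBimonad.coinvAdjRight hS R, Monad.isEquivalence_comparison_of_section _ _
          (WeakBraidedBimonad.coinvSection_counit hS R)⟩
    tfae_have 1 → 3 := by
      rintro ⟨S, hS⟩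
      obtain ⟨R⟩ := split hS
      exact ⟨⟨R.obj, ⟨WeakBraidedBimonad.coinvAdjRight hS R⟩⟩, R.obj,
        WeakBraidedBimonad.coinvAdjLeft hS R, Comonad.isEquivalence_comparison_of_retraction _ _
          (WeakBraidedBimonad.coinvSection_counit hS R)⟩
    tfae_have 2 → 1 := fun ⟨_, _, adj, _⟩ =>
      WeakBraidedBimonad.isWeakHopf_of_isPresentedBy (Monad.isPresentedBy_of_comparison adj)
    tfae_have 3 → 1 := fun ⟨_, _, adj, _⟩ =>
      WeakBraidedBimonad.isWeakHopf_of_isPresentedBy_op (Comonad.isPresentedBy_of_comparison adj)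
    tfae_have 4 ↔ 1 := WeakBraidedBimonad.isIso_gamma_iff E G
    tfae_have 5 ↔ 1 := WeakBraidedBimonad.isIso_gammaCo_iff E T
    tfae_finish
  · rintro ⟨S, hS⟩
    obtain ⟨R⟩ := split hS
    have := Monad.isEquivalence_comparison_of_section (WeakBraidedBimonad.coinvAdjRight hS R) _
      (WeakBraidedBimonad.coinvSection_counit hS R)
    exact ⟨((Monad.comparison (WeakBraidedBimonad.coinvAdjRight hS R)).asEquivalence.trans
      (Monad.algebraEquivOfIsoMonads (WeakBraidedBimonad.coinvMonadIso hS R E))).symm⟩
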